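/- **Setting.** Let $\beta>1$ be a Pisot unit of degree $d$ with minimal polynomial $x^d-c_1x^{d-1}-\cdots-c_d\in\mathbb{Z}[x]$ and Galois conjugates $\beta_1=\beta,\beta_2,\ldots,\beta_d$ (so $|\beta_j|<1$ for $j\ge2$ and $|c_d|=1$). Let $A\subset\mathbb{Z}[\beta]$ be finite, let $X\subset\mathbb{R}$ be the disjoint union of non-empty sets $X_a$, $a\in A$, where each $X_a$ is a finite union of intervals $[\ell_i,r_i)$, $i\in I_a$, and assume that $\bigcup_{a\in A}(\beta X_a-a)=X$. Let $T:X\to X$ be given by $Tx=\beta x-a$ for $x\in X_a$. For $x\in X$ and $k\ge1$ let $b_k(x)\in A$ be the digit with $T^{k-1}x\in X_{b_k(x)}$, and let $b(x)=b_1(x)b_2(x)\cdots$. Put $\widetilde X_a=\bigcup_{i\in I_a}(\ell_i,r_i]$, $\widetilde X=\bigcup_{a\in A}\widetilde X_a$, and $\widetilde Tx=\beta x-a$ for $x\in\widetilde X_a$. Let $M_\beta$ be the companion matrix with first row $(c_1,\ldots,c_d)$ and ones below the diagonal, and let $\mathbf{v}_j=\nu_j(\beta_j^{d-1},\ldots,\beta_j,1)^t$,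 $\nu_j\in\mathbb{C}$, be its eigenvectors with $\mathbf{v}_1+\cdots+\mathbf{v}_d=(1,0,\ldots,0)^t$. Let $H\subset\mathbb{R}^d$ be the hyperplane spanned by the real and imaginary parts of $\mathbf{v}_2,\ldots,\mathbf{v}_d$, let $\Gamma_j:\mathbb{Q}(\beta)\to\mathbb{Q}(\beta_j)$ be the isomorphism with $\Gamma_j(\beta)=\beta_j$, and put $\Phi(x)=\sum_{j=2}^d\Gamma_j(x)\mathbf{v}_j$ for $x\in\mathbb{Q}(\beta)$. For a left-infinite sequence $w=(w_k)_{k\le0}$ in $A$ put $\varphi(w)=\sum_{k\le0}\Phi(w_k\beta^{-k})$, and for a two-sided sequence $u\in A^{\mathbb{Z}}$ put $\psi(u)=\bigl(\sum_{k\ge1}u_k\beta^{-k}\bigr)\mathbf{v}_1-\varphi(\cdots u_{-1}u_0)$. Let $$\mathcal{S}=\{u\in A^{\mathbb{Z}}:\ \text{for every } k\in\mathbb{Z} \text{ there is } x\in X \text{ with } u_ku_{k+1}\cdots=b(x)\},$$ $\widehat X=\psi(\mathcal{S})$, $\widehat X_a=\psi(\{u\in\mathcal{S}:u_1=a\})$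 for $a\in A$, and $\mathcal{D}_x=\{\varphi(w):w\cdot b(x)\in\mathcal{S}\}\subset H$ for $x\in X$, where $w\cdot b(x)$ is the two-sided sequence with entries $w_k$ for $k\le0$ and $b_k(x)$ for $k\ge1$. Let $\pi:\widehat X\to\mathbb{R}$ map $t\mathbf{v}_1+\mathbf{y}$, $\mathbf{y}\in H$, to $t$, and let $\mu=\lambda^d\circ\pi^{-1}$, where $\lambda^d$ is Lebesgue measure. **Assumptions.** (i) The support of $\mu$ is $X$ (i.e., its closed support in $\mathbb{R}$ is $\overline X$). (ii) The set $$\mathcal{V}=(X\setminus\widetilde X)\cup\bigcup_{x\in X\cap\widetilde X}\ \bigcup_{1\le k<m_x}\{T^kx,\widetilde T^kx\}\cap X$$ is finite, where $m_x$ is the least $m\ge1$ with $\widetilde T^mx=T^mx$ ($m_x=\infty$ if there is none). (iii) Property (W) holds: with $P$ the set of all $x\in\mathbb{Z}[\beta]\cap X$ such that $T^nx=x$ for some $n\ge1$, and $\varepsilon=\min_{y\in P}\bigl(\min\{z>y:z\notin X_{b_1(y)}\}-y\bigr)\beta$, $$\exists\,x\in P:\ \forall\,y\in P\ \ \exists\,z\in\mathbb{Z}[\beta]\cap[0,\varepsilon),\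 k\ge0:\quad T^k(y+z)=T^k(x+z)=x.$$ **Theorem.** For every $x\in X$ such that $\mathbf{0}$ is an inner point of $\mathcal{D}_x$ (with respect to $H$), every $k\ge1$ and every $a\in A$, $$b_k(x)=a\quad\text{if and only if}\quad\beta^{k-1}x\,\mathbf{v}_1\in\widehat X_a\pmod{\mathbb{Z}^d},$$ i.e., if and only if $\beta^{k-1}x\,\mathbf{v}_1-\mathbf{n}\in\widehat X_a$ for some $\mathbf{n}\in\mathbb{Z}^d$. -/

import Mathlib

/-- A Pisot unit: a real number `β > 1` which is an algebraic integer and a unit, and all of whose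
other Galois conjugates lie in the open unit disc. -/
structure PisotUnit where
  /-- the underlying real number -/
  toReal : ℝ
  one_lt : 1 < toReal
  isIntegral : IsIntegral ℤ toReal
  isIntegral_inv : IsIntegral ℤ toReal⁻¹
  norm_conj_lt_one : ∀ z ∈ (minpoly ℚ toReal).rootSet ℂ, z ≠ (toReal : ℂ) → ‖z‖ < 1

/-- `ℤ[β]`, as a subset of `ℝ`. -/
def ZBeta (β : ℝ) : Set ℝ := (Algebra.adjoin ℤ {β} : Subalgebra ℤ ℝ)

/-- A right-continuous `β`-transformation: a finite digit set `A ⊂ ℝ` and, for each digit `a ∈ A`,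
a non-empty finite union `X_a` of intervals `[ℓ, r)`, the `X_a` being pairwise disjoint with union
`X`, such that `⋃_{a ∈ A} (β X_a - a) = X`. -/
structure BetaTransformation (β : ℝ) where
  /-- the digit set -/
  A : Finset ℝ
  /-- the endpoint pairs `(ℓ_i, r_i)`, `i ∈ I_a`, of the intervals that make up `X_a` -/
  endpoints : ℝ → Finset (ℝ × ℝ)
  left_lt_right : ∀ a ∈ A, ∀ p ∈ endpoints a, p.1 < p.2
  nonempty : ∀ a ∈ A, (endpoints a).Nonempty
  disjoint : ∀ a ∈ A, ∀ a' ∈ A, a ≠ a' →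
    Disjoint (⋃ p ∈ endpoints a, Set.Ico p.1 p.2) (⋃ p ∈ endpoints a', Set.Ico p.1 p.2)
  image_eq : (⋃ a ∈ A, (fun x : ℝ => β * x - a) '' (⋃ p ∈ endpoints a, Set.Ico p.1 p.2)) =
    ⋃ a ∈ A, ⋃ p ∈ endpoints a, Set.Ico p.1 p.2

namespace BetaTransformation

variable {β : ℝ} (T : BetaTransformation β)

/-- `X_a`, a finite union of intervals `[ℓ_i, r_i)`. -/
def Xa (a : ℝ) : Set ℝ := ⋃ p ∈ T.endpoints a, Set.Ico p.1 p.2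

/-- `X̃_a`, the corresponding union of the intervals `(ℓ_i, r_i]`. -/
def XaLeft (a : ℝ) : Set ℝ := ⋃ p ∈ T.endpoints a, Set.Ioc p.1 p.2

/-- `X = ⋃_{a ∈ A} X_a`. -/
def X : Set ℝ := ⋃ a ∈ T.A, T.Xa a

/-- `X̃ = ⋃_{a ∈ A} X̃_a`. -/
def XLeft : Set ℝ := ⋃ a ∈ T.A, T.XaLeft a

open Classical in
/-- The first digit `b_1(x)`: the digit `a ∈ A` with `x ∈ X_a` (and `0` if `x ∉ X`). -/
noncomputable def digit (x : ℝ) : ℝ :=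
  if h : ∃ a ∈ T.A, x ∈ T.Xa a then h.choose else 0

open Classical in
/-- The digit `a ∈ A` with `x ∈ X̃_a` (and `0` if `x ∉ X̃`). -/
noncomputable def digitLeft (x : ℝ) : ℝ :=
  if h : ∃ a ∈ T.A, x ∈ T.XaLeft a then h.choose else 0

/-- The transformation `T x = β x - a` for `x ∈ X_a` (it is used on `X` only). -/
noncomputable def map (x : ℝ) : ℝ := β * x - T.digit x

/-- The corresponding left-continuous transformation `T̃ x = β x - a` for `x ∈ X̃_a`
(it is used on `X̃` only). -/
noncomputable def mapLeft (x : ℝ) : ℝ := β * x - T.digitLeft x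

/-- The `k`-th digit `b_k(x)`, `k ≥ 1`, of the `T`-expansion of `x`. -/
noncomputable def b (k : ℕ) (x : ℝ) : ℝ := T.digit (T.map^[k - 1] x)

/-- A sequence `u 0, u 1, …` is `T`-admissible if it is the `T`-expansion
`b_1(x) b_2(x) ⋯` of some `x ∈ X`. -/
def Admissible (u : ℕ → ℝ) : Prop := ∃ x ∈ T.X, ∀ n : ℕ, u n = T.b (n + 1) x

/-- The set `𝒮` of two-sided sequences of digits all of whose right tails are `T`-admissible. -/
def S : Set (ℤ → ℝ) :=
  {u | (∀ k, u k ∈ T.A) ∧ ∀ k : ℤ, T.Admissible fun n : ℕ => u (k + n)}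

/-- The least `m ≥ 1` with `T̃^m x = T^m x`, or `∞` if there is none. -/
noncomputable def mergeTime (x : ℝ) : ℕ∞ :=
  ⨅ (m : ℕ) (_ : 1 ≤ m ∧ T.mapLeft^[m] x = T.map^[m] x), (m : ℕ∞)

/-- The set `𝒱 = (X ∖ X̃) ∪ ⋃_{x ∈ X ∩ X̃} ⋃_{1 ≤ k < m_x} {T^k x, T̃^k x} ∩ X`. -/
def V : Set ℝ :=
  (T.X \ T.XLeft) ∪
    ⋃ x ∈ T.X ∩ T.XLeft, ⋃ (k : ℕ) (_ : 1 ≤ k ∧ (k : ℕ∞) < T.mergeTime x),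
      ({T.map^[k] x, T.mapLeft^[k] x} ∩ T.X : Set ℝ)

/-- The set `P` of points of `ℤ[β] ∩ X` with purely periodic `T`-expansion. -/
def P : Set ℝ := {x | x ∈ ZBeta β ∩ T.X ∧ ∃ n : ℕ, 1 ≤ n ∧ T.map^[n] x = x}

/-- `ε = min_{y ∈ P} (min {z > y : z ∉ X_{b_1(y)}} - y) β`. -/
noncomputable def epsilon : ℝ :=
  sInf ((fun y => (sInf {z | y < z ∧ z ∉ T.Xa (T.b 1 y)} - y) * β) '' T.P)

/-- Property (W). -/
def PropertyW : Prop :=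
  ∃ x ∈ T.P, ∀ y ∈ T.P, ∃ z ∈ ZBeta β ∩ Set.Ico 0 T.epsilon, ∃ k : ℕ,
    T.map^[k] (y + z) = x ∧ T.map^[k] (x + z) = x

end BetaTransformation

namespace PisotUnit

variable (β : PisotUnit)

/-- The degree `d` of `β`. -/
noncomputable def degree : ℕ := (minpoly ℚ β.toReal).natDegree

/-- The field `ℚ(β) ⊂ ℝ`. -/
noncomputable abbrev field : IntermediateField ℚ ℝ := IntermediateField.adjoin ℚ {β.toReal}

/-- The embeddings of `ℚ(β)` into `ℂ`. They are the isomorphisms `Γ_j : ℚ(β) → ℚ(β_j)`,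
`1 ≤ j ≤ d`, one for each Galois conjugate `β_j`. -/
abbrev Emb : Type := β.field →ₐ[ℚ] ℂ

/-- `β` as an element of `ℚ(β)`. -/
noncomputable def gen : β.field := IntermediateField.AdjoinSimple.gen ℚ β.toReal

theorem isIntegral_rat : IsIntegral ℚ β.toReal := β.isIntegral.tower_top

noncomputable instance : Fintype β.Emb :=
  IntermediateField.fintypeOfAlgHomAdjoinIntegral ℚ β.isIntegral_rat

open Classical in
/-- The embeddings `Γ_2, …, Γ_d`, i.e., those with `Γ_j(β) ≠ β`. -/
noncomputable def otherEmb : Finset β.Emb := {σ | σ β.gen ≠ (β.toReal : ℂ)}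

open Classical in
/-- `Γ_j(x)` for a real number `x ∈ ℚ(β)` (and `0` for other real numbers). -/
noncomputable def conj (σ : β.Emb) (x : ℝ) : ℂ :=
  if h : x ∈ β.field then σ ⟨x, h⟩ else 0

/-- The vector `ν (α^{d-1}, …, α, 1)ᵗ` with `ν = 1 / f'(α)`, where `f` is the minimal polynomial
of `β` and `α` is one of its roots. It is an eigenvector of the companion matrix of `f`, see
`companion_mulVec_eigvec`; the factor `ν` is the one for which these vectors sum up to
`(1, 0, …, 0)ᵗ`, see `sum_eigvec`. -/
noncomputable def eigvec {K : Type} [Field K] [Algebra ℚ K] (α : K) : Fin β.degree → K :=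
  fun i => (Polynomial.aeval α (Polynomial.derivative (minpoly ℚ β.toReal)))⁻¹ *
    α ^ (β.degree - 1 - (i : ℕ))

/-- The companion matrix `M_β`, with first row `(c_1, …, c_d)`, where the minimal polynomial of
`β` is `x^d - c_1 x^{d-1} - ⋯ - c_d`. -/
noncomputable def companion : Matrix (Fin β.degree) (Fin β.degree) ℚ :=
  fun i j => if (i : ℕ) = 0 then -(minpoly ℚ β.toReal).coeff (β.degree - 1 - j)
    else if (i : ℕ) = j + 1 then 1 else 0

/-- The vector `v_1 ∈ ℝ^d`. -/
noncomputable def v1 : Fin β.degree → ℝ := β.eigvec β.toReal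

/-- The vector `v_j ∈ ℂ^d` that belongs to the conjugate `β_j = Γ_j(β)`. -/
noncomputable def v (σ : β.Emb) : Fin β.degree → ℂ := β.eigvec (σ β.gen)

/-- The hyperplane `H ⊂ ℝ^d` spanned by the real and imaginary parts of `v_2, …, v_d`. -/
noncomputable def H : Submodule ℝ (Fin β.degree → ℝ) :=
  Submodule.span ℝ (⋃ σ ∈ β.otherEmb, {fun i => (β.v σ i).re, fun i => (β.v σ i).im})

/-- The map `Φ(x) = ∑_{j=2}^d Γ_j(x) v_j` for `x ∈ ℚ(β)`. The sum has real coordinates, see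
`sum_conj_smul_v_im`; taking real parts only serves to view it as a vector in `ℝ^d`. -/
noncomputable def Phi (x : ℝ) : Fin β.degree → ℝ :=
  fun i => (∑ σ ∈ β.otherEmb, β.conj σ x * β.v σ i).re

/-- `φ(w) = ∑_{k ≤ 0} Φ(w_k β^{-k})` for a left-infinite sequence `⋯ w_{-1} w_0`;
here `w n` stands for `w_{-n}`. -/
noncomputable def phi (w : ℕ → ℝ) : Fin β.degree → ℝ :=
  ∑' n : ℕ, β.Phi (w n * β.toReal ^ n)

/-- `ψ(u) = (∑_{k ≥ 1} u_k β^{-k}) v_1 - ∑_{k ≤ 0} ∑_{j=2}^d Γ_j(u_k) β_j^{-k} v_j`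
for a two-sided infinite sequence `u`. -/
noncomputable def psi (u : ℤ → ℝ) : Fin β.degree → ℝ :=
  (∑' n : ℕ, u (n + 1) / β.toReal ^ (n + 1)) • β.v1 - β.phi fun n => u (-n)

open Classical in
/-- `π_1(y) = t` if `y = t v_1 + h` with `h ∈ H`. -/
noncomputable def pi1 (y : Fin β.degree → ℝ) : ℝ :=
  if h : ∃ t : ℝ, y - t • β.v1 ∈ β.H then h.choose else 0

theorem emb_ext {σ τ : β.Emb} (h : σ β.gen = τ β.gen) : σ = τ := by
  apply IntermediateField.algHom_ext_of_eq_adjoin _ rfl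
  rintro x hx
  obtain rfl : x = β.toReal := hx
  exact h

theorem aeval_gen (σ : β.Emb) : Polynomial.aeval (σ β.gen) (minpoly ℚ β.toReal) = 0 := by
  rw [Polynomial.aeval_algHom_apply]
  have : Polynomial.aeval β.gen (minpoly ℚ β.toReal) = 0 :=
    IntermediateField.aeval_gen_minpoly ℚ β.toReal
  rw [this, map_zero]

/-- `M_β v_j = β_j v_j`. -/
theorem companion_mulVec_eigvec {K : Type} [Field K] [Algebra ℚ K] (α : K)
    (hα : Polynomial.aeval α (minpoly ℚ β.toReal) = 0) :
    (β.companion.map (algebraMap ℚ K)).mulVec (β.eigvec α) = α • β.eigvec α := by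
  have hd : 0 < β.degree := minpoly.natDegree_pos β.isIntegral_rat
  have hsum : ∑ j : Fin β.degree,
      algebraMap ℚ K ((minpoly ℚ β.toReal).coeff (β.degree - 1 - j)) * α ^ (β.degree - 1 - (j : ℕ))
        = -α ^ β.degree := by
    rw [Polynomial.aeval_eq_sum_range, Finset.sum_range_succ] at hα
    have h1 : (minpoly ℚ β.toReal).coeff (minpoly ℚ β.toReal).natDegree = 1 :=
      minpoly.monic β.isIntegral_rat
    rw [h1, one_smul] at hα
    rw [Finset.sum_fin_eq_sum_range, ← Finset.sum_range_reflect]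
    refine (Finset.sum_congr rfl fun j hj => ?_).trans (eq_neg_of_add_eq_zero_left hα)
    have hj' : j < β.degree := Finset.mem_range.1 hj
    rw [dif_pos (by omega), show β.degree - 1 - (β.degree - 1 - j) = j by omega,
      Algebra.smul_def]
  ext i
  simp only [Matrix.mulVec, dotProduct, Matrix.map_apply, companion, eigvec, Pi.smul_apply,
    smul_eq_mul]
  set c := (Polynomial.aeval α (Polynomial.derivative (minpoly ℚ β.toReal)))⁻¹
  by_cases hi : (i : ℕ) = 0
  · simp only [hi, if_true, map_neg, tsub_zero]
    have h2 : α * (c * α ^ (β.degree - 1)) = -c * (-α ^ β.degree) := by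
      obtain ⟨m, hm⟩ : ∃ m, β.degree = m + 1 := ⟨β.degree - 1, by omega⟩
      rw [hm, Nat.add_sub_cancel, pow_succ]; ring
    rw [h2, ← hsum, Finset.mul_sum]
    exact Finset.sum_congr rfl fun j _ => by ring
  · simp only [hi, if_false]
    have hi2 := i.2
    rw [Finset.sum_eq_single (⟨i - 1, by omega⟩ : Fin β.degree)]
    · rw [if_pos (by simp only; omega), map_one, one_mul,
        show β.degree - 1 - ((i : ℕ) - 1) = β.degree - 1 - i + 1 by omega, pow_succ]
      ring
    · intro j _ hj
      rw [if_neg, map_zero, zero_mul]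
      intro h
      apply hj
      ext
      simp only
      omega
    · simp

theorem card_emb : Fintype.card β.Emb = β.degree :=
  Nat.card_eq_fintype_card.symm.trans
    (IntermediateField.card_algHom_adjoin_integral ℚ (K := ℂ) β.isIntegral_rat
      (minpoly.irreducible β.isIntegral_rat).separable (IsAlgClosed.splits _))

theorem map_minpoly_eq_nodal :
    (minpoly ℚ β.toReal).map (algebraMap ℚ ℂ) =
      Lagrange.nodal Finset.univ fun σ : β.Emb => σ β.gen := by
  have hmonic := (minpoly.monic β.isIntegral_rat).map (algebraMap ℚ ℂ)
  have hdeg : ((minpoly ℚ β.toReal).map (algebraMap ℚ ℂ)).degree =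
      (Finset.univ : Finset β.Emb).card := by
    rw [Polynomial.degree_map, Polynomial.degree_eq_natDegree
      (minpoly.ne_zero β.isIntegral_rat), Finset.card_univ, card_emb, degree]
  refine Polynomial.eq_of_degree_le_of_eval_index_eq Finset.univ
    (fun σ _ τ _ h => β.emb_ext h) hdeg.le (hdeg.trans Lagrange.degree_nodal.symm)
    (hmonic.leadingCoeff.trans Lagrange.nodal_monic.leadingCoeff.symm) fun σ hσ => ?_
  rw [Lagrange.eval_nodal_at_node (v := fun σ : β.Emb => σ β.gen) hσ, Polynomial.eval_map_algebraMap, aeval_gen]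

/-- `v_1 + ⋯ + v_d = (1, 0, …, 0)ᵗ`. -/
theorem sum_eigvec (i : Fin β.degree) :
    ∑ σ : β.Emb, β.v σ i = if (i : ℕ) = 0 then 1 else 0 := by
  classical
  have hi := i.2
  have hcard : (Finset.univ : Finset β.Emb).card = β.degree := by
    rw [Finset.card_univ, card_emb]
  have h := Lagrange.coeff_eq_sum (s := Finset.univ) (v := fun σ : β.Emb => σ β.gen)
    (fun σ _ τ _ h => β.emb_ext h) (P := Polynomial.X ^ (β.degree - 1 - (i : ℕ))) (by
      rw [Polynomial.degree_X_pow, hcard]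
      exact_mod_cast (by omega : β.degree - 1 - (i : ℕ) < β.degree))
  rw [hcard, Polynomial.coeff_X_pow] at h
  have h0 : (β.degree - 1 = β.degree - 1 - (i : ℕ)) ↔ (i : ℕ) = 0 := by omega
  rw [if_congr h0 rfl rfl] at h
  rw [h]
  refine Finset.sum_congr rfl fun σ hσ => ?_
  rw [v, eigvec, ← Polynomial.eval_map_algebraMap, ← Polynomial.derivative_map,
    map_minpoly_eq_nodal,
    ← Lagrange.nodalWeight_eq_eval_derivative_nodal (v := fun σ : β.Emb => σ β.gen) hσ,
    Lagrange.nodalWeight, Finset.prod_inv_distrib, Polynomial.eval_pow, Polynomial.eval_X,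
    div_eq_inv_mul]

/-- The sum that defines `Φ(x)` has real coordinates. -/
theorem sum_conj_smul_v_im (x : ℝ) (i : Fin β.degree) :
    (∑ σ ∈ β.otherEmb, β.conj σ x * β.v σ i).im = 0 := by
  have hre : (starRingEnd ℂ) (∑ σ ∈ β.otherEmb, β.conj σ x * β.v σ i) =
      ∑ σ ∈ β.otherEmb, β.conj σ x * β.v σ i := by
    let c : ℂ →ₐ[ℚ] ℂ := (Complex.conjAe.toAlgHom.restrictScalars ℚ)
    have hc : ∀ z, c z = (starRingEnd ℂ) z := fun z => rfl
    have hcc : ∀ σ : β.Emb, c.comp (c.comp σ) = σ := fun σ => by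
      ext z
      simp [hc]
    have hmem : ∀ σ ∈ β.otherEmb, c.comp σ ∈ β.otherEmb := fun σ hσ => by
      simp only [otherEmb, Finset.mem_filter, Finset.mem_univ, true_and, AlgHom.comp_apply, hc]
        at hσ ⊢
      intro h
      apply hσ
      rw [← Complex.conj_conj (σ β.gen), h, Complex.conj_ofReal]
    rw [map_sum]
    refine Finset.sum_nbij' (fun σ => c.comp σ) (fun σ => c.comp σ) hmem hmem
      (fun σ _ => hcc σ) (fun σ _ => hcc σ) fun σ _ => ?_
    rw [map_mul]
    congr 1
    · unfold conj
      split_ifs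
      · rfl
      · simp
    · simp only [v, eigvec, ← hc, map_mul, map_inv₀, map_pow, AlgHom.comp_apply,
        Polynomial.aeval_algHom_apply]
  exact Complex.conj_eq_iff_im.1 hre

end PisotUnit

namespace BetaTransformation

variable {β : PisotUnit} (T : BetaTransformation β.toReal)

/-- The natural extension domain `X̂ = ψ(𝒮)`. -/
noncomputable def XHat : Set (Fin β.degree → ℝ) := β.psi '' T.S

/-- `X̂_a = ψ({u ∈ 𝒮 : u_1 = a})`. -/
noncomputable def XHatA (a : ℝ) : Set (Fin β.degree → ℝ) := β.psi '' {u ∈ T.S | u 1 = a}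

/-- `𝒟_x = {φ(w) : w · b(x) ∈ 𝒮}`. -/
noncomputable def D (x : ℝ) : Set (Fin β.degree → ℝ) :=
  (fun u : ℤ → ℝ => β.phi fun n => u (-n)) '' {u ∈ T.S | ∀ k : ℕ, 1 ≤ k → u k = T.b k x}

/-- The invariant measure `μ = λ^d ∘ π⁻¹`, where `π` is the restriction of `π_1` to `X̂`. -/
noncomputable def mu : MeasureTheory.Measure ℝ :=
  ((MeasureTheory.volume : MeasureTheory.Measure (Fin β.degree → ℝ)).restrict T.XHat).map β.pi1

end BetaTransformation

/-! Put Ψ(x) = x v_1 + Φ(x). Since Ψ(1) is the first basis vector and Ψ(βx) = M_β Ψ(x), Ψ is a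
bijection from ℤ[β] to ℤ^d. Hence the natural extension map T̂ y = M_β y − Ψ(b_1(π y)), which maps
X̂ onto itself and lies over T, agrees with M_β modulo ℤ^d. If 0 is an inner point of 𝒟_x, then x
v_1 ∈ X̂, and T̂^{k-1}(x v_1) = β^{k-1} x v_1 − m is a point of X̂ over T^{k-1} x, with m integral.
This gives one direction.

For the converse, suppose that z = β^{k-1} x v_1 − n lies in X̂_a with a ≠ b_k(x), so that n ≠ m. By
the assumption on the support of μ, X̂ has positive measure in every right half-ball at z
(`volume_XHat_inter_ball_pos`). Pulled back by M_β^{k-1}, such a half-ball lands to the right of x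
v_1, where X̂ fills a half-neighbourhood (`eventually_mem_XHat`). Thus q and q + n − m both lie in
X̂ for a set of q of positive measure, against `volume_overlap`.

The half-neighbourhood comes from 𝒟_x ⊆ 𝒟_y for y slightly to the right of x
(`eventually_right_D_subset`), where finiteness of 𝒱 enters: a backward branch that cannot be
translated from x to y infinitely often would produce a cycle of T̃ among the finitely many points
of X̃ ∖ X which nevertheless enters X.

`volume_overlap` has two ingredients. T̂ preserves volume and maps X̂ onto itself, so it is almost
everywhere injective, and the set of multiply covered points is invariant under M_β almost
everywhere. As M_β contracts H and H + ℤ^d is dense, such a set is null once it misses an open set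
(`Periodic.volume_eq_zero_of_isOpen`). Property (W) supplies the open set: one common shift merges
all orbits starting in P, and this makes a point Φ(Z) belong to a single tile
(`eq_of_Phi_eq_add_tailValue`, `exists_exclusive_nhds`). -/

open Filter Topology MeasureTheory
open scoped symmDiff

/-! ### The ring ℤ[β] and the conjugation maps -/

namespace PisotUnit

variable (β : PisotUnit)

/-- The ring `ℤ[β]` as a subalgebra of `ℝ`. -/
noncomputable abbrev ring : Subalgebra ℤ ℝ := Algebra.adjoin ℤ {β.toReal}

theorem pos : 0 < β.toReal := zero_lt_one.trans β.one_lt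

theorem degree_pos : 0 < β.degree := minpoly.natDegree_pos β.isIntegral_rat

theorem toReal_mem_ring : β.toReal ∈ β.ring := Algebra.self_mem_adjoin_singleton ℤ _

/-- The monic equation of β⁻¹, reversed, is a polynomial equation for β with constant term 1;
dividing by β expresses β⁻¹ as a polynomial in β. -/
theorem inv_mem_ring : β.toReal⁻¹ ∈ β.ring := by
  obtain ⟨q, hq, h0⟩ := β.isIntegral_inv
  have h0' : Polynomial.eval₂ (algebraMap ℤ ℝ) β.toReal q.reverse = 0 := by
    let _ : Invertible β.toReal⁻¹ := invertibleOfNonzero (inv_ne_zero β.pos.ne')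
    have := Polynomial.eval₂_reverse_mul_pow (algebraMap ℤ ℝ) β.toReal⁻¹ q
    rw [h0, invOf_eq_inv, inv_inv] at this
    exact (mul_eq_zero.1 this).resolve_right (pow_ne_zero _ (inv_ne_zero β.pos.ne'))
  rw [← Polynomial.divX_mul_X_add q.reverse, Polynomial.coeff_zero_reverse, hq.leadingCoeff] at h0'
  simp only [Polynomial.eval₂_add, Polynomial.eval₂_mul, Polynomial.eval₂_X, Polynomial.C_1,
    Polynomial.eval₂_one] at h0'
  have h2 : β.toReal⁻¹ = -Polynomial.aeval β.toReal q.reverse.divX := by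
    rw [Polynomial.aeval_def]
    field_simp [β.pos.ne']
    linarith
  rw [h2]
  exact neg_mem (Polynomial.aeval_mem_adjoin_singleton ℤ _)

theorem ring_subset_field {x : ℝ} (hx : x ∈ β.ring) : x ∈ β.field := by
  have h : β.ring ≤ (β.field.toSubalgebra.restrictScalars ℤ) :=
    Algebra.adjoin_le (Set.singleton_subset_iff.2 (IntermediateField.mem_adjoin_simple_self ℚ _))
  exact h hx

theorem conj_of_mem (σ : β.Emb) {x : ℝ} (hx : x ∈ β.field) : β.conj σ x = σ ⟨x, hx⟩ := dif_pos hx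

theorem conj_add (σ : β.Emb) {x y : ℝ} (hx : x ∈ β.field) (hy : y ∈ β.field) :
    β.conj σ (x + y) = β.conj σ x + β.conj σ y := by
  rw [conj_of_mem β σ hx, conj_of_mem β σ hy, conj_of_mem β σ (add_mem hx hy), ← map_add]
  rfl

theorem conj_mul (σ : β.Emb) {x y : ℝ} (hx : x ∈ β.field) (hy : y ∈ β.field) :
    β.conj σ (x * y) = β.conj σ x * β.conj σ y := by
  rw [conj_of_mem β σ hx, conj_of_mem β σ hy, conj_of_mem β σ (mul_mem hx hy), ← map_mul]
  rfl

theorem toReal_mem_field : β.toReal ∈ β.field := IntermediateField.mem_adjoin_simple_self ℚ _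

theorem conj_toReal (σ : β.Emb) : β.conj σ β.toReal = σ β.gen := conj_of_mem β σ β.toReal_mem_field

theorem conj_one (σ : β.Emb) : β.conj σ 1 = 1 := by
  rw [conj_of_mem β σ (one_mem _)]
  exact map_one σ

/-- The inclusion `ℚ(β) ⊂ ℂ`, i.e. the embedding `Γ_1`. -/
noncomputable def idEmb : β.Emb := (Complex.ofRealAm.restrictScalars ℚ).comp β.field.val

theorem idEmb_apply (z : β.field) : β.idEmb z = ((z : ℝ) : ℂ) := rfl

theorem otherEmb_eq [DecidableEq β.Emb] : β.otherEmb = Finset.univ.erase β.idEmb := by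
  ext σ
  simp only [otherEmb, Finset.mem_filter, Finset.mem_univ, true_and, Finset.mem_erase, and_true]
  refine not_congr ⟨fun h => β.emb_ext h, fun h => ?_⟩
  rw [h]
  rfl

theorem v_idEmb (i : Fin β.degree) : β.v β.idEmb i = (β.v1 i : ℂ) := by
  have h1 : β.idEmb β.gen = ((β.toReal : ℝ) : ℂ) := rfl
  have h2 : ∀ p : Polynomial ℚ, Polynomial.aeval ((β.toReal : ℝ) : ℂ) p =
      ((Polynomial.aeval β.toReal p : ℝ) : ℂ) := fun p => by
    exact Polynomial.aeval_algebraMap_apply ℂ β.toReal p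
  simp only [v, v1, eigvec, h1, h2]
  push_cast
  rfl

/-- `x v_1 + Φ(x) = ∑_{j=1}^d Γ_j(x) v_j`. -/
noncomputable def Psi (x : ℝ) : Fin β.degree → ℝ := x • β.v1 + β.Phi x

theorem Psi_apply {x : ℝ} (hx : x ∈ β.field) (i : Fin β.degree) :
    β.Psi x i = (∑ σ : β.Emb, β.conj σ x * β.v σ i).re := by
  classical
  rw [← Finset.add_sum_erase _ _ (Finset.mem_univ β.idEmb), ← otherEmb_eq, v_idEmb,
    conj_of_mem β _ hx, idEmb_apply]
  simp [Psi, Phi]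

theorem Phi_add {x y : ℝ} (hx : x ∈ β.field) (hy : y ∈ β.field) :
    β.Phi (x + y) = β.Phi x + β.Phi y := by
  ext i
  simp only [Phi, Pi.add_apply, ← Complex.add_re, ← Finset.sum_add_distrib]
  simp_rw [conj_add β _ hx hy, add_mul]

theorem Phi_zero : β.Phi 0 = 0 := by
  have h := β.Phi_add (zero_mem _) (zero_mem _)
  rw [add_zero] at h
  exact left_eq_add.1 h

theorem Phi_neg {x : ℝ} (hx : x ∈ β.field) : β.Phi (-x) = -β.Phi x := by
  rw [eq_neg_iff_add_eq_zero, ← Phi_add β (neg_mem hx) hx, neg_add_cancel, Phi_zero]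

theorem Phi_sub {x y : ℝ} (hx : x ∈ β.field) (hy : y ∈ β.field) :
    β.Phi (x - y) = β.Phi x - β.Phi y := by
  rw [sub_eq_add_neg, Phi_add β hx (neg_mem hy), Phi_neg β hy, sub_eq_add_neg]

theorem Psi_add {x y : ℝ} (hx : x ∈ β.field) (hy : y ∈ β.field) :
    β.Psi (x + y) = β.Psi x + β.Psi y := by
  simp only [Psi, Phi_add β hx hy, add_smul]; abel

theorem Psi_sub {x y : ℝ} (hx : x ∈ β.field) (hy : y ∈ β.field) :
    β.Psi (x - y) = β.Psi x - β.Psi y := by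
  simp only [Psi, Phi_sub β hx hy, sub_smul]; abel

theorem Psi_neg {x : ℝ} (hx : x ∈ β.field) : β.Psi (-x) = -β.Psi x := by
  simp only [Psi, Phi_neg β hx, neg_smul]; abel

theorem Psi_zero : β.Psi 0 = 0 := by
  simp [Psi, Phi_zero]

/-! ### The action of M_β and its contraction on H -/

/-- The real linear map given by the companion matrix `M_β`. -/
noncomputable def M : (Fin β.degree → ℝ) →ₗ[ℝ] (Fin β.degree → ℝ) :=
  Matrix.toLin' (β.companion.map (algebraMap ℚ ℝ))

theorem M_apply (y : Fin β.degree → ℝ) (i : Fin β.degree) :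
    β.M y i = ∑ j, (β.companion i j : ℝ) * y j := by
  simp [M, Matrix.mulVec, dotProduct]

theorem M_re (w : Fin β.degree → ℂ) :
    β.M (fun i => (w i).re) =
      fun i => ((β.companion.map (algebraMap ℚ ℂ)).mulVec w i).re := by
  ext i
  simp [M_apply, Matrix.mulVec, dotProduct]

theorem M_im (w : Fin β.degree → ℂ) :
    β.M (fun i => (w i).im) =
      fun i => ((β.companion.map (algebraMap ℚ ℂ)).mulVec w i).im := by
  ext i
  simp [M_apply, Matrix.mulVec, dotProduct]

theorem M_v1 : β.M β.v1 = β.toReal • β.v1 := by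
  have h := β.companion_mulVec_eigvec β.toReal (minpoly.aeval ℚ β.toReal)
  rw [M, Matrix.toLin'_apply]
  exact h

theorem M_Phi {x : ℝ} (hx : x ∈ β.field) : β.M (β.Phi x) = β.Phi (β.toReal * x) := by
  have h := β.M_re (∑ σ ∈ β.otherEmb, β.conj σ x • β.v σ)
  have h1 : (fun i => ((∑ σ ∈ β.otherEmb, β.conj σ x • β.v σ) i).re) = β.Phi x := by
    ext i
    simp [Phi, Finset.sum_apply]
  rw [h1] at h
  rw [h]
  ext i
  simp only [Matrix.mulVec_sum, Matrix.mulVec_smul, v, companion_mulVec_eigvec β _ (β.aeval_gen _),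
    Phi]
  rw [Finset.sum_apply]
  congr 1
  refine Finset.sum_congr rfl fun σ _ => ?_
  rw [conj_mul β σ β.toReal_mem_field hx, conj_toReal]
  simp only [Pi.smul_apply, smul_eq_mul]
  ring

theorem M_Psi {x : ℝ} (hx : x ∈ β.field) : β.M (β.Psi x) = β.Psi (β.toReal * x) := by
  simp only [Psi, map_add, map_smul, M_v1, M_Phi β hx, smul_smul]
  rw [mul_comm]

theorem M_pow_Phi {x : ℝ} (hx : x ∈ β.field) (n : ℕ) :
    (β.M ^ n) (β.Phi x) = β.Phi (β.toReal ^ n * x) := by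
  induction n with
  | zero => simp
  | succ n ih =>
    rw [pow_succ', Module.End.mul_apply, ih,
      M_Phi β (mul_mem (pow_mem β.toReal_mem_field n) hx), ← mul_assoc, ← pow_succ']

theorem M_pow_v1 (n : ℕ) : (β.M ^ n) β.v1 = β.toReal ^ n • β.v1 := by
  induction n with
  | zero => simp
  | succ n ih =>
    rw [pow_succ', Module.End.mul_apply, ih, map_smul, M_v1, smul_smul, pow_succ]

theorem Phi_mem_H (x : ℝ) : β.Phi x ∈ β.H := by
  have h : β.Phi x = ∑ σ ∈ β.otherEmb, ((β.conj σ x).re • (fun i => (β.v σ i).re) -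
      (β.conj σ x).im • (fun i => (β.v σ i).im)) := by
    ext i
    simp [Phi, Finset.sum_apply]
  rw [h]
  refine Submodule.sum_mem _ fun σ hσ => Submodule.sub_mem _ ?_ ?_ <;>
    refine Submodule.smul_mem _ _ (Submodule.subset_span (Set.mem_iUnion₂.2 ⟨σ, hσ, ?_⟩)) <;> simp

theorem M_pow_re (σ : β.Emb) (n : ℕ) :
    (β.M ^ n) (fun i => (β.v σ i).re) = (fun i => (σ β.gen ^ n * β.v σ i).re) ∧
    (β.M ^ n) (fun i => (β.v σ i).im) = (fun i => (σ β.gen ^ n * β.v σ i).im) := by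
  have hM : ∀ n : ℕ, (β.companion.map (algebraMap ℚ ℂ)).mulVec
      (fun i => σ β.gen ^ n * β.v σ i) = fun i => σ β.gen ^ (n + 1) * β.v σ i := by
    intro n
    have h := Matrix.mulVec_smul (β.companion.map (algebraMap ℚ ℂ)) (σ β.gen ^ n) (β.v σ)
    rw [v, companion_mulVec_eigvec β _ (β.aeval_gen _)] at h
    refine (Eq.trans ?_ h).trans ?_
    · rfl
    · ext i
      simp only [Pi.smul_apply, smul_eq_mul, v]
      ring
  induction n with
  | zero => simp
  | succ n ih =>
    rw [pow_succ', Module.End.mul_apply, Module.End.mul_apply, ih.1, ih.2, M_re, M_im, hM]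
    exact ⟨rfl, rfl⟩

theorem M_mem_H {y : Fin β.degree → ℝ} (hy : y ∈ β.H) : β.M y ∈ β.H := by
  induction hy using Submodule.span_induction with
  | mem y hy =>
    obtain ⟨σ, hσ, h⟩ := Set.mem_iUnion₂.1 hy
    have h1 := β.M_pow_re σ 1
    simp only [pow_one, Complex.mul_re, Complex.mul_im] at h1
    have hre : (fun i => (β.v σ i).re) ∈ β.H :=
      Submodule.subset_span (Set.mem_iUnion₂.2 ⟨σ, hσ, by simp⟩)
    have him : (fun i => (β.v σ i).im) ∈ β.H :=
      Submodule.subset_span (Set.mem_iUnion₂.2 ⟨σ, hσ, by simp⟩)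
    rcases h with rfl | rfl
    · rw [h1.1]
      exact β.H.sub_mem (β.H.smul_mem _ hre) (β.H.smul_mem _ him)
    · rw [h1.2]
      exact β.H.add_mem (β.H.smul_mem _ him) (β.H.smul_mem _ hre)
  | zero => simp
  | add a b _ _ ha hb => rw [map_add]; exact β.H.add_mem ha hb
  | smul c a _ ha => rw [map_smul]; exact β.H.smul_mem c ha

theorem norm_emb_lt_one {σ : β.Emb} (hσ : σ ∈ β.otherEmb) : ‖σ β.gen‖ < 1 := by
  refine β.norm_conj_lt_one _ ?_ (by simpa [otherEmb] using hσ)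
  rw [Polynomial.mem_rootSet]
  exact ⟨minpoly.ne_zero β.isIntegral_rat, β.aeval_gen σ⟩

theorem exists_rho : ∃ ρ : ℝ, 0 < ρ ∧ ρ < 1 ∧ ∀ σ ∈ β.otherEmb, ‖σ β.gen‖ ≤ ρ := by
  have h : ∀ s : Finset β.Emb, s ⊆ β.otherEmb →
      ∃ ρ : ℝ, 0 < ρ ∧ ρ < 1 ∧ ∀ σ ∈ s, ‖σ β.gen‖ ≤ ρ := by
    classical
    intro s
    induction s using Finset.induction with
    -- Starting from 1/2 rather than 0 keeps ρ positive.
    | empty => exact fun _ => ⟨1 / 2, by norm_num, by norm_num, by simp⟩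
    | insert a s _ ih =>
      intro hs
      obtain ⟨ρ, h0, h1, h2⟩ := ih ((Finset.subset_insert a s).trans hs)
      refine ⟨max ρ ‖a β.gen‖, lt_max_of_lt_left h0,
        max_lt h1 (β.norm_emb_lt_one (hs (Finset.mem_insert_self a s))), fun σ hσ => ?_⟩
      rcases Finset.mem_insert.1 hσ with rfl | hσ
      · exact le_max_right _ _
      · exact (h2 σ hσ).trans (le_max_left _ _)
  exact h _ subset_rfl

/-- A contraction ratio of `M_β` on `H`. -/
noncomputable def rho : ℝ := β.exists_rho.choose

theorem rho_pos : 0 < β.rho := β.exists_rho.choose_spec.1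

theorem rho_lt_one : β.rho < 1 := β.exists_rho.choose_spec.2.1

theorem norm_emb_le_rho {σ : β.Emb} (hσ : σ ∈ β.otherEmb) : ‖σ β.gen‖ ≤ β.rho :=
  β.exists_rho.choose_spec.2.2 σ hσ

/-- On the generators of H, M_β^n multiplies a complex eigenvector by a number of modulus at most
ρ^n, and linearity does the rest. The constant depends on y because M_β need not shrink the sup norm
in one step. -/
theorem exists_norm_M_pow_le {y : Fin β.degree → ℝ} (hy : y ∈ β.H) :
    ∃ C : ℝ, 0 ≤ C ∧ ∀ n : ℕ, ‖(β.M ^ n) y‖ ≤ C * β.rho ^ n := by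
  induction hy using Submodule.span_induction with
  | mem y hy =>
    obtain ⟨σ, hσ, h⟩ := Set.mem_iUnion₂.1 hy
    have key : ∀ (n : ℕ) i, ‖σ β.gen ^ n * β.v σ i‖ ≤ ‖β.v σ‖ * β.rho ^ n := fun n i => by
      rw [norm_mul, norm_pow, mul_comm]
      exact mul_le_mul (norm_le_pi_norm _ i) (pow_le_pow_left₀ (norm_nonneg _)
        (β.norm_emb_le_rho hσ) n) (by positivity) (norm_nonneg _)
    have hn : ∀ n : ℕ, 0 ≤ ‖β.v σ‖ * β.rho ^ n := fun n =>
      mul_nonneg (norm_nonneg _) (pow_nonneg β.rho_pos.le n)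
    refine ⟨‖β.v σ‖, norm_nonneg _, fun n => ?_⟩
    rcases h with rfl | rfl
    · rw [(β.M_pow_re σ n).1, pi_norm_le_iff_of_nonneg (hn n)]
      exact fun i => (Complex.abs_re_le_norm _).trans (key n i)
    · rw [(β.M_pow_re σ n).2, pi_norm_le_iff_of_nonneg (hn n)]
      exact fun i => (Complex.abs_im_le_norm _).trans (key n i)
  | zero => exact ⟨0, le_rfl, by simp⟩
  | add a b _ _ ha hb =>
    obtain ⟨C, hC, h⟩ := ha
    obtain ⟨D, hD, h'⟩ := hb
    refine ⟨C + D, add_nonneg hC hD, fun n => ?_⟩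
    rw [map_add, add_mul]
    exact (norm_add_le _ _).trans (add_le_add (h n) (h' n))
  | smul c a _ ha =>
    obtain ⟨C, hC, h⟩ := ha
    refine ⟨|c| * C, mul_nonneg (abs_nonneg c) hC, fun n => ?_⟩
    rw [map_smul, norm_smul, Real.norm_eq_abs, mul_assoc]
    exact mul_le_mul_of_nonneg_left (h n) (abs_nonneg c)

theorem tendsto_rho_pow (C : ℝ) : Tendsto (fun n => C * β.rho ^ n) atTop (𝓝 0) := by
  simpa using (tendsto_pow_atTop_nhds_zero_of_lt_one β.rho_pos.le β.rho_lt_one).const_mul C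

theorem tendsto_M_pow {y : Fin β.degree → ℝ} (hy : y ∈ β.H) :
    Tendsto (fun n => (β.M ^ n) y) atTop (𝓝 0) := by
  obtain ⟨C, _, h⟩ := β.exists_norm_M_pow_le hy
  exact squeeze_zero_norm h (β.tendsto_rho_pow C)

theorem v1_ne_zero : β.v1 ≠ 0 := by
  intro h
  have hd := β.degree_pos
  have h1 := congrFun h ⟨0, hd⟩
  have h2 : Polynomial.aeval β.toReal (Polynomial.derivative (minpoly ℚ β.toReal)) ≠ 0 :=
    (minpoly.irreducible β.isIntegral_rat).separable.aeval_derivative_ne_zero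
      (minpoly.aeval ℚ β.toReal)
  simp [v1, eigvec, h2, β.pos.ne'] at h1

/-- The powers of M_β tend to 0 on H, whereas they expand v_1. -/
theorem v1_notMem_H : β.v1 ∉ β.H := by
  intro h
  have h1 := (β.tendsto_M_pow h).norm
  simp only [M_pow_v1, norm_smul, norm_zero] at h1
  have h2 := h1.eventually (gt_mem_nhds (norm_pos_iff.2 β.v1_ne_zero))
  obtain ⟨n, hn⟩ := h2.exists
  have h3 : (1 : ℝ) ≤ ‖β.toReal ^ n‖ := by
    rw [norm_pow, Real.norm_of_nonneg β.pos.le]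
    exact one_le_pow₀ β.one_lt.le
  nlinarith [norm_pos_iff.2 β.v1_ne_zero]

/-! ### Ψ identifies ℤ[β] with ℤ^d -/

/-- The standard basis vector `e_i` of `ℤ^d`, as a real vector. -/
noncomputable abbrev e (i : Fin β.degree) : Fin β.degree → ℝ := Pi.single i 1

theorem Psi_one : β.Psi 1 = β.e ⟨0, β.degree_pos⟩ := by
  ext i
  rw [Psi_apply β (one_mem _)]
  simp_rw [conj_one, one_mul, sum_eigvec, e, Pi.single_apply, Fin.ext_iff]
  split_ifs <;> simp

theorem exists_companion_int (i j : Fin β.degree) : ∃ m : ℤ, β.companion i j = m := by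
  unfold companion
  split_ifs
  · rw [minpoly.isIntegrallyClosed_eq_field_fractions' ℚ β.isIntegral, Polynomial.coeff_map]
    exact ⟨-(minpoly ℤ β.toReal).coeff (β.degree - 1 - j), by simp⟩
  · exact ⟨1, by simp⟩
  · exact ⟨0, by simp⟩

/-- The companion matrix with integer entries. -/
noncomputable def companionInt : Matrix (Fin β.degree) (Fin β.degree) ℤ :=
  fun i j => (β.exists_companion_int i j).choose

theorem companionInt_cast (i j : Fin β.degree) :
    (β.companionInt i j : ℝ) = (β.companion i j : ℝ) := by
  have h := (β.exists_companion_int i j).choose_spec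
  rw [h]; simp [companionInt]

theorem M_eq_toLin' : β.M = Matrix.toLin' (β.companionInt.map (Int.cast : ℤ → ℝ)) := by
  unfold M
  congr 1
  ext i j
  simp [companionInt_cast]

/-- An integer vector as a real vector. -/
def intVec (n : Fin β.degree → ℤ) : Fin β.degree → ℝ := fun i => (n i : ℝ)

theorem M_intVec (n : Fin β.degree → ℤ) :
    β.M (β.intVec n) = β.intVec (β.companionInt.mulVec n) := by
  ext i
  rw [M_apply]
  simp [intVec, Matrix.mulVec, dotProduct, companionInt_cast]

theorem intVec_add (m n : Fin β.degree → ℤ) : β.intVec (m + n) = β.intVec m + β.intVec n := by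
  ext i; simp [intVec]

theorem intVec_sub (m n : Fin β.degree → ℤ) : β.intVec (m - n) = β.intVec m - β.intVec n := by
  ext i; simp [intVec]

theorem intVec_injective : Function.Injective β.intVec := fun m n h => by
  ext i
  have := congrFun h i
  simpa [intVec] using this

/-- Multiplication by β corresponds to M_β, whose entries are integers, so integrality propagates
from Ψ(1) to all polynomials in β. -/
theorem exists_intVec_eq_Psi {x : ℝ} (hx : x ∈ β.ring) : ∃ n, β.Psi x = β.intVec n := by
  have h1 : ∀ k : ℕ, ∃ n, β.Psi (β.toReal ^ k) = β.intVec n := by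
    intro k
    induction k with
    | zero =>
      refine ⟨Pi.single ⟨0, β.degree_pos⟩ 1, ?_⟩
      rw [pow_zero, Psi_one]
      ext i
      simp only [e, intVec, Pi.single_apply]
      split_ifs <;> simp
    | succ k ih =>
      obtain ⟨n, hn⟩ := ih
      exact ⟨_, by rw [pow_succ', ← M_Psi β (pow_mem β.toReal_mem_field k), hn, M_intVec]⟩
  obtain ⟨p, rfl⟩ : ∃ p : Polynomial ℤ, Polynomial.aeval β.toReal p = x := by
    have h := Algebra.adjoin_singleton_eq_range_aeval ℤ β.toReal
    have hx' : x ∈ (Polynomial.aeval (R := ℤ) β.toReal).range := h ▸ hx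
    exact hx'
  have hmem : ∀ q : Polynomial ℤ, Polynomial.aeval β.toReal q ∈ β.field := fun q =>
    β.ring_subset_field (Polynomial.aeval_mem_adjoin_singleton ℤ _)
  have h2 : ∀ (q : Polynomial ℤ), ∃ n, β.Psi (Polynomial.aeval β.toReal q) = β.intVec n := by
    intro q
    induction q using Polynomial.induction_on with
    | C a =>
      induction a using Int.induction_on with
      | zero => exact ⟨0, by ext i; simp [Psi_zero, intVec]⟩
      | succ i ih =>
        obtain ⟨n, hn⟩ := ih
        obtain ⟨m, hm⟩ := h1 0
        refine ⟨n + m, ?_⟩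
        rw [map_add, map_add, Psi_add β (hmem _) (hmem _), hn, intVec_add, ← hm]
        simp
      | pred i ih =>
        obtain ⟨n, hn⟩ := ih
        obtain ⟨m, hm⟩ := h1 0
        refine ⟨n - m, ?_⟩
        rw [map_sub, map_sub, Psi_sub β (hmem _) (hmem _), hn, intVec_sub, ← hm]
        simp
    | add p q hp hq =>
      obtain ⟨n, hn⟩ := hp
      obtain ⟨m, hm⟩ := hq
      exact ⟨n + m, by rw [map_add, Psi_add β (hmem _) (hmem _), hn, hm, intVec_add]⟩
    | monomial k a ih =>
      obtain ⟨n, hn⟩ := ih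
      refine ⟨β.companionInt.mulVec n, ?_⟩
      rw [← M_intVec, ← hn, M_Psi β (hmem _)]
      congr 1
      simp [pow_succ]; ring
  exact h2 p

/-- Column i of M_β has an integer c in the top row and a 1 in row i + 1. So if Ψ(x) = e_i, then
Ψ(βx − c) = e_{i+1}. -/
theorem exists_Psi_eq_e (i : ℕ) (hi : i < β.degree) : ∃ x ∈ β.ring, β.Psi x = β.e ⟨i, hi⟩ := by
  induction i with
  | zero => exact ⟨1, one_mem _, β.Psi_one⟩
  | succ i ih =>
    obtain ⟨x, hx, h⟩ := ih (by omega)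
    set c : ℤ := β.companionInt ⟨0, β.degree_pos⟩ ⟨i, by omega⟩
    have hc : (c : ℝ) ∈ β.ring := intCast_mem _ c
    have hP : ∀ m : ℤ, β.Psi (m : ℝ) = (m : ℝ) • β.Psi 1 := by
      intro m
      induction m using Int.induction_on with
      | zero => simp [Psi_zero]
      | succ i ih =>
        push_cast at ih ⊢
        rw [Psi_add β (natCast_mem _ i) (one_mem _), ih, add_smul, one_smul]
      | pred i ih =>
        push_cast at ih ⊢
        rw [Psi_sub β (neg_mem (natCast_mem _ i)) (one_mem _), ih, sub_smul, one_smul]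
    refine ⟨β.toReal * x - c, sub_mem (mul_mem β.toReal_mem_ring hx) hc, ?_⟩
    rw [Psi_sub β (β.ring_subset_field (mul_mem β.toReal_mem_ring hx)) (β.ring_subset_field hc),
      ← M_Psi β (β.ring_subset_field hx), h, hP, Psi_one]
    ext k
    simp only [Pi.sub_apply, Pi.smul_apply, smul_eq_mul, M_apply, c, companionInt_cast, e]
    rw [Finset.sum_eq_single ⟨i, by omega⟩ (fun j _ hj => by rw [Pi.single_eq_of_ne hj, mul_zero])
      (by simp), Pi.single_eq_same, mul_one]
    simp only [Pi.single_apply, companion, Fin.ext_iff]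
    by_cases hk : (k : ℕ) = 0
    · simp [hk]
    · by_cases hk' : (k : ℕ) = i + 1 <;> simp [hk, hk']

theorem exists_Psi_eq_intVec (n : Fin β.degree → ℤ) : ∃ x ∈ β.ring, β.Psi x = β.intVec n := by
  let G : AddSubgroup (Fin β.degree → ℝ) :=
    { carrier := {y | ∃ x ∈ β.ring, β.Psi x = y}
      add_mem' := by
        rintro _ _ ⟨x, hx, rfl⟩ ⟨y, hy, rfl⟩
        exact ⟨x + y, add_mem hx hy, Psi_add β (β.ring_subset_field hx) (β.ring_subset_field hy)⟩
      zero_mem' := ⟨0, zero_mem _, β.Psi_zero⟩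
      neg_mem' := by
        rintro _ ⟨x, hx, rfl⟩
        exact ⟨-x, neg_mem hx, Psi_neg β (β.ring_subset_field hx)⟩ }
  have h : β.intVec n = ∑ i, n i • β.e i := by
    ext k
    simp [intVec, e, Finset.sum_apply, Pi.single_apply]
  change β.intVec n ∈ G
  rw [h]
  exact AddSubgroup.sum_mem _ fun i _ => AddSubgroup.zsmul_mem _ (β.exists_Psi_eq_e i i.2) _

/-- Each standard basis vector has the form Ψ(x) = x v_1 + Φ(x), so no independence or dimension
count of eigenvectors is needed. -/
theorem H_sup_span : Submodule.span ℝ {β.v1} ⊔ β.H = ⊤ := by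
  rw [eq_top_iff, ← (Pi.basisFun ℝ (Fin β.degree)).span_eq, Submodule.span_le]
  rintro _ ⟨i, rfl⟩
  rw [Pi.basisFun_apply]
  obtain ⟨x, _, hx⟩ := β.exists_Psi_eq_e i i.2
  have : Pi.single i 1 = x • β.v1 + β.Phi x := hx.symm
  rw [this]
  exact Submodule.add_mem_sup (Submodule.smul_mem _ _ (Submodule.mem_span_singleton_self _))
    (β.Phi_mem_H x)

theorem exists_proj : ∃ p : (Fin β.degree → ℝ) →ₗ[ℝ] ℝ, p β.v1 = 1 ∧ ∀ y ∈ β.H, p y = 0 := by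
  have h := Submodule.exists_le_ker_of_notMem (p := β.H) β.v1_notMem_H
  obtain ⟨f, hf, hf'⟩ := h
  exact ⟨(f β.v1)⁻¹ • f, by simp [hf], fun y hy => by simp [LinearMap.mem_ker.1 (hf' hy)]⟩

/-- The projection to the `v_1`-coordinate along `H`, as a continuous linear map. -/
noncomputable def proj : (Fin β.degree → ℝ) →L[ℝ] ℝ :=
  LinearMap.toContinuousLinearMap β.exists_proj.choose

theorem proj_v1 : β.proj β.v1 = 1 := β.exists_proj.choose_spec.1

theorem proj_of_mem_H {y : Fin β.degree → ℝ} (hy : y ∈ β.H) : β.proj y = 0 :=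
  β.exists_proj.choose_spec.2 y hy

theorem sub_proj_mem_H (y : Fin β.degree → ℝ) : y - β.proj y • β.v1 ∈ β.H := by
  have hy : y ∈ Submodule.span ℝ {β.v1} ⊔ β.H := by rw [H_sup_span]; trivial
  obtain ⟨a, ha, h, hh, rfl⟩ := Submodule.mem_sup.1 hy
  obtain ⟨t, rfl⟩ := Submodule.mem_span_singleton.1 ha
  simp [proj_v1, proj_of_mem_H β hh, hh]

theorem mem_H_iff {y : Fin β.degree → ℝ} : y ∈ β.H ↔ β.proj y = 0 := by
  refine ⟨β.proj_of_mem_H, fun h => ?_⟩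
  have := β.sub_proj_mem_H y
  rwa [h, zero_smul, sub_zero] at this

theorem pi1_eq (y : Fin β.degree → ℝ) : β.pi1 y = β.proj y := by
  have h : ∃ t : ℝ, y - t • β.v1 ∈ β.H := ⟨_, β.sub_proj_mem_H y⟩
  rw [pi1, dif_pos h]
  have := h.choose_spec
  rw [mem_H_iff, map_sub, map_smul, proj_v1, smul_eq_mul, mul_one] at this
  linarith

theorem proj_M (y : Fin β.degree → ℝ) : β.proj (β.M y) = β.toReal * β.proj y := by
  have h := β.M_mem_H (β.sub_proj_mem_H y)
  rw [mem_H_iff, map_sub, map_sub, map_smul, map_smul, M_v1, map_smul, proj_v1] at h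
  simp only [smul_eq_mul, mul_one] at h
  linarith

theorem proj_Psi (x : ℝ) : β.proj (β.Psi x) = x := by
  simp [Psi, proj_v1, proj_of_mem_H β (β.Phi_mem_H x)]

theorem Psi_injective : Function.Injective β.Psi := fun x y h => by
  rw [← β.proj_Psi x, h, proj_Psi]

/-- Ψ embeds ℤ[β] in a lattice, and the two bounds confine Ψ(x) to a ball. All pigeonhole arguments
on orbits in ℤ[β] rest on this. -/
theorem finite_ring_bounded (R : ℝ) : {x | x ∈ β.ring ∧ |x| ≤ R ∧ ‖β.Phi x‖ ≤ R}.Finite := by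
  have h1 : (Metric.closedBall (0 : Fin β.degree → ℤ) (R * ‖β.v1‖ + R)).Finite :=
    (isCompact_closedBall _ _).finite_of_discrete
  have h2 : (β.Psi ⁻¹' (β.intVec '' (Metric.closedBall 0 (R * ‖β.v1‖ + R)))).Finite :=
    (h1.image _).preimage β.Psi_injective.injOn
  refine h2.subset ?_
  rintro x ⟨hx, hx1, hx2⟩
  obtain ⟨n, hn⟩ := β.exists_intVec_eq_Psi hx
  refine ⟨n, ?_, hn.symm⟩
  have h3 : ‖β.intVec n‖ ≤ R * ‖β.v1‖ + R := by
    rw [← hn, Psi]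
    refine (norm_add_le _ _).trans (add_le_add ?_ hx2)
    rw [norm_smul]
    exact mul_le_mul_of_nonneg_right hx1 (norm_nonneg _)
  have h4 : 0 ≤ R * ‖β.v1‖ + R := (norm_nonneg _).trans h3
  rw [mem_closedBall_zero_iff, pi_norm_le_iff_of_nonneg h4]
  intro i
  have := (pi_norm_le_iff_of_nonneg h4).1 h3 i
  simpa [intVec, Int.norm_eq_abs] using this

theorem countable_ring : (β.ring : Set ℝ).Countable := by
  have h2 : (β.Psi ⁻¹' (Set.range β.intVec)).Countable :=
    (Set.countable_range _).preimage_of_injOn β.Psi_injective.injOn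
  refine h2.mono fun x hx => ?_
  obtain ⟨n, hn⟩ := β.exists_intVec_eq_Psi hx
  exact ⟨n, hn.symm⟩

theorem exists_M_intVec_eq (n : Fin β.degree → ℤ) : ∃ m, β.M (β.intVec m) = β.intVec n := by
  obtain ⟨x, hx, h⟩ := β.exists_Psi_eq_intVec n
  have hx' : β.toReal⁻¹ * x ∈ β.ring := mul_mem β.inv_mem_ring hx
  obtain ⟨m, hm⟩ := β.exists_intVec_eq_Psi hx'
  refine ⟨m, ?_⟩
  rw [← hm, M_Psi β (β.ring_subset_field hx'), ← h, mul_inv_cancel_left₀ β.pos.ne']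

/-- Since β⁻¹ ∈ ℤ[β], M_β maps ℤ^d onto itself. Preimages of the basis vectors are the columns of an
integral right inverse, so the determinant is a unit of ℤ. -/
theorem abs_det_M : |LinearMap.det β.M| = 1 := by
  choose m hm using fun i : Fin β.degree => β.exists_M_intVec_eq (Pi.single i 1)
  have h : β.companionInt * (Matrix.of m).transpose = 1 := by
    ext i j
    have := hm j
    rw [M_intVec] at this
    have := congrFun (β.intVec_injective this) i
    rw [Matrix.mul_apply]
    simp only [Matrix.mulVec, dotProduct] at this
    simp only [Matrix.transpose_apply, Matrix.of_apply, this, Pi.single_apply, Matrix.one_apply]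
  have hu : IsUnit β.companionInt.det := by
    rw [isUnit_iff_exists_inv]
    exact ⟨_, by rw [← Matrix.det_mul, h, Matrix.det_one]⟩
  rw [M_eq_toLin', LinearMap.det_toLin']
  have h3 : (β.companionInt.map (Int.cast : ℤ → ℝ)).det = ((β.companionInt.det : ℤ) : ℝ) :=
    ((Int.castRingHom ℝ).map_det β.companionInt).symm
  rw [h3]
  rcases Int.isUnit_iff.1 hu with h | h <;> simp [h]

end PisotUnit

/-! ### The transformation T: right-continuity and expansions -/

namespace BetaTransformation

variable {β : PisotUnit} (T : BetaTransformation β.toReal)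

theorem mem_X {x : ℝ} : x ∈ T.X ↔ ∃ a ∈ T.A, x ∈ T.Xa a := by
  simp [X]

theorem digit_eq {x a : ℝ} (ha : a ∈ T.A) (hx : x ∈ T.Xa a) : T.digit x = a := by
  have h : ∃ a ∈ T.A, x ∈ T.Xa a := ⟨a, ha, hx⟩
  rw [digit, dif_pos h]
  by_contra hne
  exact Set.disjoint_left.1 (T.disjoint _ h.choose_spec.1 a ha hne) h.choose_spec.2 hx

theorem digit_mem {x : ℝ} (hx : x ∈ T.X) : T.digit x ∈ T.A := by
  obtain ⟨a, ha, h⟩ := T.mem_X.1 hx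
  rwa [T.digit_eq ha h]

theorem mem_Xa_digit {x : ℝ} (hx : x ∈ T.X) : x ∈ T.Xa (T.digit x) := by
  obtain ⟨a, ha, h⟩ := T.mem_X.1 hx
  rwa [T.digit_eq ha h]

theorem image_X : (⋃ a ∈ T.A, (fun x : ℝ => β.toReal * x - a) '' (T.Xa a)) = T.X := T.image_eq

theorem map_mem {x : ℝ} (hx : x ∈ T.X) : T.map x ∈ T.X := by
  rw [← image_X]
  exact Set.mem_iUnion₂.2 ⟨_, T.digit_mem hx, x, T.mem_Xa_digit hx, rfl⟩

theorem exists_map_eq {y : ℝ} (hy : y ∈ T.X) : ∃ x ∈ T.X, T.map x = y := by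
  rw [← image_X] at hy
  obtain ⟨a, ha, x, hx, rfl⟩ := Set.mem_iUnion₂.1 hy
  exact ⟨x, T.mem_X.2 ⟨a, ha, hx⟩, by rw [map, T.digit_eq ha hx]⟩

theorem iterate_mem {x : ℝ} (hx : x ∈ T.X) (n : ℕ) : T.map^[n] x ∈ T.X := by
  induction n with
  | zero => exact hx
  | succ n ih => rw [Function.iterate_succ_apply']; exact T.map_mem ih

/-- Membership in [ℓ, r) is locally constant from the right at every point, inside or outside the
interval. This is why limits of orbits are taken in `𝓝[≥] x`. -/
theorem eventually_right_mem_Xa (x a : ℝ) : ∀ᶠ y in 𝓝[≥] x, (y ∈ T.Xa a ↔ x ∈ T.Xa a) := by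
  have h : ∀ᶠ y in 𝓝[≥] x, ∀ p ∈ T.endpoints a, (y ∈ Set.Ico p.1 p.2 ↔ x ∈ Set.Ico p.1 p.2) := by
    rw [eventually_all_finset]
    intro p _
    have h1 : ∀ᶠ y in 𝓝[≥] x, (p.1 ≤ y ↔ p.1 ≤ x) := by
      by_cases hp : p.1 ≤ x
      · filter_upwards [self_mem_nhdsWithin] with y hy
        exact iff_of_true (hp.trans hy) hp
      · filter_upwards [mem_nhdsWithin_of_mem_nhds (gt_mem_nhds (not_le.1 hp))] with y hy
        exact iff_of_false (not_le.2 hy) hp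
    have h2 : ∀ᶠ y in 𝓝[≥] x, (y < p.2 ↔ x < p.2) := by
      by_cases hp : x < p.2
      · filter_upwards [mem_nhdsWithin_of_mem_nhds (gt_mem_nhds hp)] with y hy
        exact iff_of_true hy hp
      · filter_upwards [self_mem_nhdsWithin] with y hy
        exact iff_of_false (fun h => hp (lt_of_le_of_lt hy h)) hp
    filter_upwards [h1, h2] with y h1 h2
    rw [Set.mem_Ico, Set.mem_Ico, h1, h2]
  filter_upwards [h] with y hy
  simp only [Xa, Set.mem_iUnion]
  exact exists_congr fun p => exists_congr fun hp => hy p hp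

theorem eventually_right_mem_Xa_all (x : ℝ) :
    ∀ᶠ y in 𝓝[≥] x, ∀ a ∈ T.A, (y ∈ T.Xa a ↔ x ∈ T.Xa a) := by
  rw [eventually_all_finset]
  exact fun a _ => T.eventually_right_mem_Xa x a

theorem eventually_right_mem_X (x : ℝ) : ∀ᶠ y in 𝓝[≥] x, (y ∈ T.X ↔ x ∈ T.X) := by
  filter_upwards [T.eventually_right_mem_Xa_all x] with y hy
  rw [mem_X, mem_X]
  exact exists_congr fun a => and_congr_right fun ha => hy a ha

theorem eventually_right_digit {x : ℝ} (hx : x ∈ T.X) :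
    ∀ᶠ y in 𝓝[≥] x, y ∈ T.X ∧ T.digit y = T.digit x := by
  filter_upwards [T.eventually_right_mem_Xa_all x] with y hy
  have h := (hy _ (T.digit_mem hx)).2 (T.mem_Xa_digit hx)
  exact ⟨T.mem_X.2 ⟨_, T.digit_mem hx, h⟩, T.digit_eq (T.digit_mem hx) h⟩

theorem tendsto_affine_right {x c s : ℝ} (hs : 0 ≤ s) :
    Tendsto (fun y => c + s * (y - x)) (𝓝[≥] x) (𝓝[≥] c) := by
  refine tendsto_nhdsWithin_iff.2 ⟨?_, ?_⟩
  · have : Continuous fun y => c + s * (y - x) := by fun_prop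
    have h := this.tendsto x
    simp only [sub_self, mul_zero, add_zero] at h
    exact h.mono_left nhdsWithin_le_nhds
  · filter_upwards [self_mem_nhdsWithin] with y hy
    exact le_add_of_nonneg_right (mul_nonneg hs (sub_nonneg.2 hy))

theorem eventually_right_iterate {x : ℝ} (hx : x ∈ T.X) (n : ℕ) :
    ∀ᶠ y in 𝓝[≥] x, T.map^[n] y ∈ T.X ∧ T.digit (T.map^[n] y) = T.digit (T.map^[n] x) ∧
      T.map^[n] y = T.map^[n] x + β.toReal ^ n * (y - x) := by
  induction n with
  | zero =>
    filter_upwards [T.eventually_right_digit hx] with y hy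
    exact ⟨hy.1, hy.2, by simp⟩
  | succ n ih =>
    have h2 := (tendsto_affine_right (x := x) (c := T.map^[n + 1] x)
      (pow_nonneg β.pos.le (n + 1))).eventually (T.eventually_right_digit (T.iterate_mem hx (n + 1)))
    filter_upwards [ih, h2] with y hy hy2
    have h3 : T.map^[n + 1] y = T.map^[n + 1] x + β.toReal ^ (n + 1) * (y - x) := by
      rw [Function.iterate_succ_apply', Function.iterate_succ_apply', map, map, hy.2.1, hy.2.2]
      ring
    rw [h3]
    exact ⟨hy2.1, hy2.2, rfl⟩

theorem exists_bound : ∃ R : ℝ, 0 ≤ R ∧ ∀ x ∈ T.X, |x| ≤ R := by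
  have h : Bornology.IsBounded T.X := by
    refine (Bornology.isBounded_biUnion_finset T.A).2 fun a _ => ?_
    exact (Bornology.isBounded_biUnion_finset _).2 fun p _ => Metric.isBounded_Ico _ _
  obtain ⟨R, hR⟩ := h.exists_norm_le
  exact ⟨max R 0, le_max_right _ _, fun x hx => (hR x hx).trans (le_max_left _ _)⟩

theorem digit_iterate_eq (x : ℝ) (n : ℕ) :
    T.digit (T.map^[n] x) = β.toReal * T.map^[n] x - T.map^[n + 1] x := by
  rw [Function.iterate_succ_apply', map]; ring

/-- The n-th term is T^n x / β^n − T^{n+1} x / β^{n+1}, so the series telescopes, and X is bounded.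
-/
theorem tsum_digit {x : ℝ} (hx : x ∈ T.X) :
    ∑' n : ℕ, T.digit (T.map^[n] x) / β.toReal ^ (n + 1) = x := by
  have hβ := β.pos
  have h1 : ∀ n : ℕ, T.digit (T.map^[n] x) / β.toReal ^ (n + 1) =
      T.map^[n] x / β.toReal ^ n - T.map^[n + 1] x / β.toReal ^ (n + 1) := fun n => by
    rw [digit_iterate_eq, pow_succ]; field_simp
  obtain ⟨R, hR, hX⟩ := T.exists_bound
  have hle : ∀ n : ℕ, ‖T.map^[n] x / β.toReal ^ n‖ ≤ R * (β.toReal⁻¹) ^ n := fun n => by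
    rw [norm_div, norm_pow, Real.norm_of_nonneg hβ.le, inv_pow, ← div_eq_mul_inv]
    gcongr
    exact hX _ (T.iterate_mem hx n)
  have hlim : Tendsto (fun n => T.map^[n] x / β.toReal ^ n) atTop (𝓝 0) := by
    refine squeeze_zero_norm hle ?_
    simpa using (tendsto_pow_atTop_nhds_zero_of_lt_one (inv_nonneg.2 hβ.le)
      (inv_lt_one_of_one_lt₀ β.one_lt)).const_mul R
  have hsum : Summable fun n : ℕ => T.digit (T.map^[n] x) / β.toReal ^ (n + 1) := by
    have hs : Summable fun n : ℕ => T.map^[n] x / β.toReal ^ n :=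
      Summable.of_norm_bounded ((summable_geometric_of_lt_one (inv_nonneg.2 hβ.le)
        (inv_lt_one_of_one_lt₀ β.one_lt)).mul_left R) hle
    simp_rw [h1]
    exact hs.sub ((summable_nat_add_iff 1).2 hs)
  have h2 := hsum.hasSum.tendsto_sum_nat
  simp_rw [h1, Finset.sum_range_sub'] at h2
  have h3 := hlim.const_sub (T.map^[0] x / β.toReal ^ 0)
  have h4 := tendsto_nhds_unique h2 h3
  simp_rw [h1, h4]
  simp

theorem eq_of_digits_eq {x y : ℝ} (hx : x ∈ T.X) (hy : y ∈ T.X)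
    (h : ∀ n : ℕ, T.digit (T.map^[n] x) = T.digit (T.map^[n] y)) : x = y := by
  rw [← T.tsum_digit hx, ← T.tsum_digit hy]
  simp_rw [h]

/-! ### Backward orbits and their values φ(w) -/

/-- A backward orbit `⋯ ↦ o 2 ↦ o 1 ↦ o 0 = x` of `T` in `X`. -/
def IsBackOrbit (x : ℝ) (o : ℕ → ℝ) : Prop := o 0 = x ∧ ∀ n, o n ∈ T.X ∧ T.map (o (n + 1)) = o n

/-- The value `φ(w)` of the digit sequence `w` of a backward orbit. -/
noncomputable def tailValue (o : ℕ → ℝ) : Fin β.degree → ℝ := β.phi fun n => T.digit (o (n + 1))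

variable {T}

theorem IsBackOrbit.mem {x : ℝ} {o : ℕ → ℝ} (h : T.IsBackOrbit x o) : x ∈ T.X := h.1 ▸ (h.2 0).1

theorem IsBackOrbit.cons {x : ℝ} {o : ℕ → ℝ} (h : T.IsBackOrbit x o) :
    T.IsBackOrbit (T.map x) (fun n => Nat.casesOn n (T.map x) o) := by
  refine ⟨rfl, fun n => ?_⟩
  cases n with
  | zero => exact ⟨T.map_mem h.mem, congrArg T.map h.1⟩
  | succ n => exact h.2 n

theorem IsBackOrbit.shift {x : ℝ} {o : ℕ → ℝ} (h : T.IsBackOrbit x o) (m : ℕ) :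
    T.IsBackOrbit (o m) (fun n => o (n + m)) := by
  refine ⟨by simp, fun n => ⟨(h.2 _).1, ?_⟩⟩
  have := (h.2 (n + m)).2
  rwa [← Nat.add_right_comm] at this

theorem IsBackOrbit.iterate {x : ℝ} {o : ℕ → ℝ} (h : T.IsBackOrbit x o) (n m : ℕ) :
    T.map^[n] (o (m + n)) = o m := by
  induction n with
  | zero => rfl
  | succ n ih => rw [Function.iterate_succ_apply, ← add_assoc, (h.2 _).2, ih]

theorem IsBackOrbit.iterate_zero {x : ℝ} {o : ℕ → ℝ} (h : T.IsBackOrbit x o) (n : ℕ) :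
    T.map^[n] (o n) = x := by
  have := h.iterate n 0
  rwa [zero_add, h.1] at this

variable (T)

theorem exists_isBackOrbit {x : ℝ} (hx : x ∈ T.X) : ∃ o, T.IsBackOrbit x o := by
  choose! f hf hf' using fun y (hy : y ∈ T.X) => T.exists_map_eq hy
  have hmem : ∀ n, f^[n] x ∈ T.X := fun n => by
    induction n with
    | zero => exact hx
    | succ n ih => rw [Function.iterate_succ_apply']; exact hf _ ih
  refine ⟨fun n => f^[n] x, rfl, fun n => ⟨hmem n, ?_⟩⟩
  simp only [Function.iterate_succ_apply', hf' _ (hmem n)]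

theorem exists_isBackOrbit_of_isBackOrbit {x : ℝ} {o : ℕ → ℝ} (h : T.IsBackOrbit x o) (n : ℕ) :
    ∃ o', T.IsBackOrbit (T.map^[n] x) o' ∧ ∀ m, o' (m + n) = o m := by
  induction n with
  | zero => exact ⟨o, h, fun _ => rfl⟩
  | succ n ih =>
    obtain ⟨o', h', hn⟩ := ih
    rw [Function.iterate_succ_apply']
    exact ⟨_, h'.cons, hn⟩

theorem exists_isBackOrbit_apply {x : ℝ} (hx : x ∈ T.X) (n : ℕ) :
    ∃ o, T.IsBackOrbit (T.map^[n] x) o ∧ o n = x := by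
  obtain ⟨o, ho⟩ := T.exists_isBackOrbit hx
  obtain ⟨o', h', h⟩ := T.exists_isBackOrbit_of_isBackOrbit ho n
  exact ⟨o', h', by rw [← ho.1, ← h 0, zero_add]⟩

variable {T}

theorem digit_mem_ring (hA : ∀ a ∈ T.A, a ∈ ZBeta β.toReal)
    {x : ℝ} (hx : x ∈ T.X) : T.digit x ∈ β.ring := hA _ (T.digit_mem hx)

theorem exists_norm_M_pow_Phi_digit_le (T : BetaTransformation β.toReal) :
    ∃ C : ℝ, 0 ≤ C ∧ ∀ a ∈ T.A, ∀ n : ℕ,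
    ‖(β.M ^ n) (β.Phi a)‖ ≤ C * β.rho ^ n := by
  choose C hC h using fun a => β.exists_norm_M_pow_le (β.Phi_mem_H a)
  refine ⟨∑ a ∈ T.A, C a, Finset.sum_nonneg fun a _ => hC a, fun a ha n => (h a n).trans ?_⟩
  exact mul_le_mul_of_nonneg_right (Finset.single_le_sum (fun a _ => hC a) ha)
    (pow_nonneg β.rho_pos.le n)

theorem summable_tailValue (hA : ∀ a ∈ T.A, a ∈ ZBeta β.toReal)
    {x : ℝ} {o : ℕ → ℝ} (h : T.IsBackOrbit x o) :
    Summable fun n => β.Phi (T.digit (o (n + 1)) * β.toReal ^ n) := by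
  obtain ⟨C, _, hC⟩ := exists_norm_M_pow_Phi_digit_le T
  refine Summable.of_norm_bounded ((summable_geometric_of_lt_one β.rho_pos.le
    β.rho_lt_one).mul_left C) fun n => ?_
  rw [mul_comm, ← β.M_pow_Phi (β.ring_subset_field (digit_mem_ring hA (h.2 _).1))]
  exact hC _ (T.digit_mem (h.2 _).1) n

theorem tailValue_eq_add (hA : ∀ a ∈ T.A, a ∈ ZBeta β.toReal)
    {x : ℝ} {o : ℕ → ℝ} (h : T.IsBackOrbit x o) :
    T.tailValue o = β.Phi (T.digit (o 1)) + β.M (T.tailValue fun n => o (n + 1)) := by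
  have hs := summable_tailValue hA h
  have hs' := summable_tailValue hA (h.shift 1)
  simp only [tailValue, PisotUnit.phi]
  rw [hs.tsum_eq_zero_add, pow_zero, mul_one]
  have hM := (LinearMap.toContinuousLinearMap β.M).map_tsum hs'
  simp only [LinearMap.coe_toContinuousLinearMap'] at hM
  rw [hM]
  congr 1
  refine tsum_congr fun n => ?_
  have hm := β.ring_subset_field (digit_mem_ring hA (h.2 (n + 1 + 1)).1)
  rw [β.M_Phi (mul_mem hm (pow_mem β.toReal_mem_field n))]
  congr 1
  rw [pow_succ]; ring

theorem IsBackOrbit.sub_mem_ring (hA : ∀ a ∈ T.A, a ∈ ZBeta β.toReal)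
    {x : ℝ} {o : ℕ → ℝ} (h : T.IsBackOrbit x o) (n : ℕ) :
    β.toReal ^ n * o n - x ∈ β.ring := by
  induction n with
  | zero => simp [h.1]
  | succ n ih =>
    have h1 : β.toReal ^ (n + 1) * o (n + 1) - x =
        (β.toReal ^ n * o n - x) + β.toReal ^ n * T.digit (o (n + 1)) := by
      rw [← (h.2 n).2, map]; ring
    rw [h1]
    exact add_mem ih (mul_mem (pow_mem β.toReal_mem_ring n) (digit_mem_ring hA (h.2 _).1))

/-- The n digits between o_n and x add up to the single element β^n o_n − x of ℤ[β]; the remaining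
digits form another tail, contracted by M_β^n. Hence o_n determines the tail value up to an error
O(ρ^n). -/
theorem IsBackOrbit.tailValue_eq (hA : ∀ a ∈ T.A, a ∈ ZBeta β.toReal)
    {x : ℝ} {o : ℕ → ℝ} (h : T.IsBackOrbit x o) (n : ℕ) :
    T.tailValue o = β.Phi (β.toReal ^ n * o n - x) +
      (β.M ^ n) (T.tailValue fun m => o (m + n)) := by
  induction n with
  | zero => simp [h.1, β.Phi_zero]
  | succ n ih =>
    have hd := digit_mem_ring hA (h.2 (n + 1)).1
    have h1 : β.toReal ^ (n + 1) * o (n + 1) - x =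
        (β.toReal ^ n * o n - x) + β.toReal ^ n * T.digit (o (n + 1)) := by
      rw [← (h.2 n).2, map]; ring
    rw [ih, tailValue_eq_add hA (h.shift n), h1, map_add, pow_succ, Module.End.mul_apply,
      β.Phi_add (β.ring_subset_field (h.sub_mem_ring hA n))
        (mul_mem (pow_mem β.toReal_mem_field n) (β.ring_subset_field hd)),
      β.M_pow_Phi (by rw [add_comm 1 n]; exact β.ring_subset_field hd), add_assoc]
    simp only [add_comm, add_left_comm]

/-- The constant is uniform in the backward orbit because there are only finitely many digits. -/
theorem exists_norm_M_pow_tailValue_le (hA : ∀ a ∈ T.A, a ∈ ZBeta β.toReal) :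
    ∃ C : ℝ, 0 ≤ C ∧ ∀ x o, T.IsBackOrbit x o → ∀ n : ℕ,
    ‖(β.M ^ n) (T.tailValue o)‖ ≤ C * β.rho ^ n := by
  obtain ⟨C, h0, hC⟩ := exists_norm_M_pow_Phi_digit_le T
  refine ⟨C * (1 - β.rho)⁻¹, mul_nonneg h0 (inv_nonneg.2 (sub_nonneg.2 β.rho_lt_one.le)),
    fun x o h n => ?_⟩
  have hs := summable_tailValue hA h
  have hM := (LinearMap.toContinuousLinearMap (β.M ^ n)).map_tsum hs
  simp only [LinearMap.coe_toContinuousLinearMap'] at hM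
  simp only [tailValue, PisotUnit.phi]
  rw [hM]
  refine tsum_of_norm_bounded (g := fun k => (C * β.rho ^ n) * β.rho ^ k) ?_ fun k => ?_
  · have := (hasSum_geometric_of_lt_one β.rho_pos.le β.rho_lt_one).mul_left (C * β.rho ^ n)
    rw [mul_right_comm C]
    exact this
  · have hd := digit_mem_ring hA (h.2 (k + 1)).1
    rw [mul_comm (T.digit _), ← β.M_pow_Phi (β.ring_subset_field hd), ← Module.End.mul_apply,
      ← pow_add, mul_assoc, ← pow_add]
    exact hC _ (T.digit_mem (h.2 _).1) _

theorem tailValue_mem_H (hA : ∀ a ∈ T.A, a ∈ ZBeta β.toReal)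
    {x : ℝ} {o : ℕ → ℝ} (h : T.IsBackOrbit x o) : T.tailValue o ∈ β.H := by
  have hs := summable_tailValue hA h
  have hc : IsClosed (β.H : Set (Fin β.degree → ℝ)) := β.H.closed_of_finiteDimensional
  exact hc.mem_of_tendsto hs.hasSum (Eventually.of_forall fun s =>
    β.H.sum_mem fun n _ => β.Phi_mem_H _)

/-- Right upper semicontinuity of the sets `𝒟_x`. -/
theorem exists_isBackOrbit_of_tendsto (hA : ∀ a ∈ T.A, a ∈ ZBeta β.toReal)
    {ι : Type*} (U : Ultrafilter ι) {x : ℝ} {y : ι → ℝ}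
    {o : ι → ℕ → ℝ} (hy : Tendsto y U (𝓝[≥] x)) (ho : ∀ᶠ i in U, T.IsBackOrbit (y i) (o i)) :
    ∃ o', T.IsBackOrbit x o' ∧ Tendsto (fun i => T.tailValue (o i)) U (𝓝 (T.tailValue o')) := by
  have hβ := β.pos
  -- Compactness of the digit sequences: A is finite, so along the ultrafilter every digit position
  -- is eventually constant.
  have hdig : ∀ n : ℕ, ∃ a ∈ T.A, ∀ᶠ i in U, T.digit (o i (n + 1)) = a := by
    intro n
    have h1 : ∀ᶠ i in U, ∃ a ∈ T.A, T.digit (o i (n + 1)) = a :=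
      ho.mono fun i hi => ⟨_, T.digit_mem (hi.2 _).1, rfl⟩
    exact (Ultrafilter.eventually_exists_mem_iff T.A.finite_toSet).1 h1
  choose w hwA hw using hdig
  -- The inverse branches selected by the limit digits, applied to x.
  let o' : ℕ → ℝ := fun n => Nat.rec x (fun n z => (z + w n) / β.toReal) n
  have ho'0 : o' 0 = x := rfl
  have ho'1 : ∀ n, β.toReal * o' (n + 1) - w n = o' n := fun n => by
    change β.toReal * ((o' n + w n) / β.toReal) - w n = o' n
    field_simp; ring
  have hform : ∀ n, ∀ᶠ i in U, o i n = o' n + (β.toReal ^ n)⁻¹ * (y i - x) := by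
    intro n
    induction n with
    | zero =>
      filter_upwards [ho] with i hi
      rw [hi.1, ho'0]; simp
    | succ n ih =>
      filter_upwards [ih, hw n, ho] with i hi hwi hoi
      have h1 := (hoi.2 n).2
      rw [map, hwi, hi] at h1
      have h2 := ho'1 n
      have h3 : β.toReal * o i (n + 1) =
          β.toReal * o' (n + 1) + (β.toReal ^ n)⁻¹ * (y i - x) := by linarith
      rw [← mul_right_inj' hβ.ne', h3, pow_succ]
      field_simp
  have hlim : ∀ n, Tendsto (fun i => o i n) U (𝓝[≥] (o' n)) := fun n =>
    Tendsto.congr' ((hform n).mono fun i hi => hi.symm)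
      ((tendsto_affine_right (inv_nonneg.2 (pow_nonneg hβ.le n))).comp hy)
  -- The points o i n lie in X and approach o' n from the right, which suffices for right-closed-off
  -- membership: near o' n from the right, lying in X is the same as o' n lying in X.
  have hX : ∀ n, o' n ∈ T.X := fun n => by
    obtain ⟨i, h1, h2⟩ := ((hlim n).eventually (T.eventually_right_mem_X (o' n))).and ho |>.exists
    exact h1.1 (h2.2 n).1
  have hd : ∀ n, T.digit (o' (n + 1)) = w n := fun n => by
    obtain ⟨i, h1, h2⟩ := ((hlim (n + 1)).eventually
      (T.eventually_right_digit (hX (n + 1)))).and (hw n) |>.exists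
    rw [← h1.2, h2]
  have hback : T.IsBackOrbit x o' := ⟨rfl, fun n => ⟨hX n, by rw [map, hd, ho'1]⟩⟩
  refine ⟨o', hback, ?_⟩
  obtain ⟨C, hC0, hC⟩ := exists_norm_M_pow_tailValue_le hA
  rw [tendsto_iff_norm_sub_tendsto_zero]
  refine Metric.tendsto_nhds.2 fun ε hε => ?_
  obtain ⟨n, hn⟩ := ((β.tendsto_rho_pow (2 * C)).eventually (gt_mem_nhds hε)).exists
  filter_upwards [hform n, ho] with i hi hoi
  rw [dist_zero_right, norm_norm, hoi.tailValue_eq hA n, hback.tailValue_eq hA n]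
  have h1 : β.toReal ^ n * o i n - y i = β.toReal ^ n * o' n - x := by
    rw [hi]; field_simp; ring
  rw [h1, add_sub_add_left_eq_sub]
  refine ((norm_sub_le _ _).trans (add_le_add (hC _ _ (hoi.shift n) n)
    (hC _ _ (hback.shift n) n))).trans_lt ?_
  linarith

/-! ### The sets 𝒮, X̂, X̂_a and 𝒟_x in terms of orbits -/

theorem b_succ (n : ℕ) (x : ℝ) : T.b (n + 1) x = T.digit (T.map^[n] x) := rfl

/-- The two-sided sequences in `𝒮` are the digit sequences of two-sided orbits of `T` in `X`. -/
theorem mem_S_iff {u : ℤ → ℝ} : u ∈ T.S ↔ ∃ z : ℤ → ℝ,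
    (∀ k, z k ∈ T.X ∧ T.map (z k) = z (k + 1)) ∧ ∀ k, u k = T.digit (z k) := by
  constructor
  · rintro ⟨-, h⟩
    choose z hz hu using h
    refine ⟨z, fun k => ⟨hz k, ?_⟩, fun k => ?_⟩
    · refine T.eq_of_digits_eq (T.map_mem (hz k)) (hz _) fun n => ?_
      rw [← Function.iterate_succ_apply, ← b_succ, ← b_succ, ← hu, ← hu]
      push_cast
      congr 1
      ring
    · have := hu k 0
      simpa [b_succ] using this
  · rintro ⟨z, hz, hu⟩
    refine ⟨fun k => hu k ▸ T.digit_mem (hz k).1, fun k => ⟨z k, (hz k).1, fun n => ?_⟩⟩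
    have h : ∀ n : ℕ, T.map^[n] (z k) = z (k + n) := by
      intro n
      induction n with
      | zero => simp
      | succ n ih =>
        rw [Function.iterate_succ_apply', ih, (hz _).2]
        push_cast
        congr 1
        ring
    simp only [b_succ, h, hu]

theorem iterate_of_orbit {z : ℤ → ℝ} (hz : ∀ k, z k ∈ T.X ∧ T.map (z k) = z (k + 1)) (k : ℤ)
    (n : ℕ) : T.map^[n] (z k) = z (k + n) := by
  induction n with
  | zero => simp
  | succ n ih =>
    rw [Function.iterate_succ_apply', ih, (hz _).2]
    push_cast
    congr 1
    ring

theorem isBackOrbit_of_orbit {z : ℤ → ℝ} (hz : ∀ k, z k ∈ T.X ∧ T.map (z k) = z (k + 1)) :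
    T.IsBackOrbit (z 1) (fun n => z (1 - n)) := by
  refine ⟨by simp, fun n => ⟨(hz _).1, ?_⟩⟩
  simp only [(hz _).2]
  push_cast
  congr 1
  ring

theorem IsBackOrbit.exists_orbit {x : ℝ} {o : ℕ → ℝ} (h : T.IsBackOrbit x o) : ∃ z : ℤ → ℝ,
    (∀ k, z k ∈ T.X ∧ T.map (z k) = z (k + 1)) ∧ ∀ n : ℕ, z (1 - n) = o n := by
  -- The point x sits at index 1, because u_1 is its first digit; the digits at indices 0, −1, … are
  -- those of o 1, o 2, ….
  refine ⟨fun k => if 1 ≤ k then T.map^[(k - 1).toNat] x else o (1 - k).toNat,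
    fun k => ?_, fun n => ?_⟩
  · by_cases hk : 1 ≤ k
    · have h1 : (k + 1 - 1).toNat = (k - 1).toNat + 1 := by omega
      simp only [hk, if_true, show (1 : ℤ) ≤ k + 1 by omega, h1, Function.iterate_succ_apply',
        and_true]
      exact T.iterate_mem h.mem _
    · simp only [hk, if_false]
      refine ⟨(h.2 _).1, ?_⟩
      by_cases hk' : k = 0
      · subst hk'
        simpa [h.1] using (h.2 0).2
      · have h1 : (1 - k).toNat = (1 - (k + 1)).toNat + 1 := by omega
        rw [if_neg (by omega), h1]
        exact (h.2 _).2
  · cases n with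
    | zero => simp [h.1]
    | succ n =>
      simp only [show ¬ (1 : ℤ) ≤ 1 - ((n + 1 : ℕ) : ℤ) by omega, if_false]
      congr 1
      omega

theorem psi_orbit {z : ℤ → ℝ} (hz : ∀ k, z k ∈ T.X ∧ T.map (z k) = z (k + 1)) :
    β.psi (fun k => T.digit (z k)) = z 1 • β.v1 - T.tailValue fun n => z (1 - n) := by
  rw [PisotUnit.psi, tailValue]
  congr 2
  · rw [← T.tsum_digit (hz 1).1]
    refine tsum_congr fun n => ?_
    rw [iterate_of_orbit hz, add_comm (1 : ℤ)]
  · ext n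
    congr 2
    push_cast
    ring

theorem mem_XHatA_iff {a : ℝ} {y : Fin β.degree → ℝ} : y ∈ T.XHatA a ↔
    ∃ x o, T.IsBackOrbit x o ∧ T.digit x = a ∧ y = x • β.v1 - T.tailValue o := by
  constructor
  · rintro ⟨u, ⟨hu, rfl⟩, rfl⟩
    obtain ⟨z, hz, h⟩ := mem_S_iff.1 hu
    obtain rfl : u = fun k => T.digit (z k) := funext h
    exact ⟨_, _, isBackOrbit_of_orbit hz, rfl, psi_orbit hz⟩
  · rintro ⟨x, o, ho, rfl, rfl⟩
    obtain ⟨z, hz, h⟩ := ho.exists_orbit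
    have h1 : z 1 = x := by
      have := h 0
      rwa [Nat.cast_zero, sub_zero, ho.1] at this
    refine ⟨fun k => T.digit (z k), ⟨mem_S_iff.2 ⟨z, hz, fun _ => rfl⟩, congrArg T.digit h1⟩, ?_⟩
    rw [psi_orbit hz, h1]
    simp_rw [h]

theorem mem_XHat_iff {y : Fin β.degree → ℝ} : y ∈ T.XHat ↔
    ∃ x o, T.IsBackOrbit x o ∧ y = x • β.v1 - T.tailValue o := by
  have h : y ∈ T.XHat ↔ ∃ a, y ∈ T.XHatA a := by
    constructor
    · rintro ⟨u, hu, rfl⟩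
      exact ⟨_, u, ⟨hu, rfl⟩, rfl⟩
    · rintro ⟨a, u, hu, rfl⟩
      exact ⟨u, hu.1, rfl⟩
  simp [h, mem_XHatA_iff]

theorem mem_D_iff {x : ℝ} (hx : x ∈ T.X) {y : Fin β.degree → ℝ} : y ∈ T.D x ↔
    ∃ o, T.IsBackOrbit x o ∧ T.tailValue o = y := by
  have key : ∀ z : ℤ → ℝ, (β.phi fun n => T.digit (z (-n))) =
      T.tailValue fun n => z (1 - n) := fun z => by
    rw [tailValue]
    congr 1
    ext n
    congr 2
    push_cast
    ring
  constructor
  · rintro ⟨u, ⟨hu, hx'⟩, rfl⟩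
    obtain ⟨z, hz, h⟩ := mem_S_iff.1 hu
    obtain rfl : u = fun k => T.digit (z k) := funext h
    have h1 : z 1 = x := by
      refine T.eq_of_digits_eq (hz 1).1 hx fun n => ?_
      have := hx' (n + 1) (by omega)
      rw [iterate_of_orbit hz, ← b_succ, ← this]
      push_cast
      rw [add_comm]
    exact ⟨_, h1 ▸ isBackOrbit_of_orbit hz, (key z).symm⟩
  · rintro ⟨o, ho, rfl⟩
    obtain ⟨z, hz, h⟩ := ho.exists_orbit
    have h1 : z 1 = x := by
      have := h 0
      rwa [Nat.cast_zero, sub_zero, ho.1] at this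
    refine ⟨fun k => T.digit (z k), ⟨mem_S_iff.2 ⟨z, hz, fun _ => rfl⟩, fun k hk => ?_⟩, ?_⟩
    · obtain ⟨n, rfl⟩ : ∃ n, k = n + 1 := ⟨k - 1, by omega⟩
      rw [b_succ, ← h1, iterate_of_orbit hz]
      push_cast
      rw [add_comm]
    · refine (key z).trans ?_
      simp_rw [h]

theorem proj_sub_tailValue (hA : ∀ a ∈ T.A, a ∈ ZBeta β.toReal) {x : ℝ} {o : ℕ → ℝ}
    (h : T.IsBackOrbit x o) : β.proj (x • β.v1 - T.tailValue o) = x := by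
  rw [map_sub, map_smul, β.proj_v1, β.proj_of_mem_H (tailValue_mem_H hA h)]
  simp

theorem mem_XHat_iff_proj (hA : ∀ a ∈ T.A, a ∈ ZBeta β.toReal) {y : Fin β.degree → ℝ} :
    y ∈ T.XHat ↔ ∃ o, T.IsBackOrbit (β.proj y) o ∧ y = β.proj y • β.v1 - T.tailValue o := by
  rw [mem_XHat_iff]
  constructor
  · rintro ⟨x, o, h, rfl⟩
    rw [proj_sub_tailValue hA h]
    exact ⟨o, h, rfl⟩
  · rintro ⟨o, h, hy⟩
    exact ⟨_, o, h, hy⟩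

theorem mem_XHatA_iff_proj (hA : ∀ a ∈ T.A, a ∈ ZBeta β.toReal) {a : ℝ}
    {y : Fin β.degree → ℝ} :
    y ∈ T.XHatA a ↔ y ∈ T.XHat ∧ T.digit (β.proj y) = a := by
  rw [mem_XHatA_iff, mem_XHat_iff]
  constructor
  · rintro ⟨x, o, h, ha, rfl⟩
    rw [proj_sub_tailValue hA h]
    exact ⟨⟨x, o, h, rfl⟩, ha⟩
  · rintro ⟨⟨x, o, h, rfl⟩, ha⟩
    rw [proj_sub_tailValue hA h] at ha
    exact ⟨x, o, h, ha, rfl⟩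

theorem proj_mem_X (hA : ∀ a ∈ T.A, a ∈ ZBeta β.toReal) {y : Fin β.degree → ℝ}
    (hy : y ∈ T.XHat) : β.proj y ∈ T.X := by
  obtain ⟨o, h, -⟩ := (mem_XHat_iff_proj hA).1 hy
  exact h.mem

/-- `ψ` conjugates the shift with `y ↦ M_β y - Ψ(b_1)`. -/
theorem IsBackOrbit.smul_v1_sub_cons (hA : ∀ a ∈ T.A, a ∈ ZBeta β.toReal) {x : ℝ} {o : ℕ → ℝ}
    (h : T.IsBackOrbit x o) :
    T.map x • β.v1 - T.tailValue (fun n => Nat.casesOn n (T.map x) o) =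
      β.M (x • β.v1 - T.tailValue o) - β.Psi (T.digit x) := by
  have h1 := tailValue_eq_add hA h.cons
  change _ = β.Phi (T.digit (o 0)) + β.M (T.tailValue o) at h1
  rw [h1, h.1]
  simp only [map_sub, map_smul, β.M_v1, PisotUnit.Psi, map, sub_smul, smul_smul]
  rw [mul_comm]
  abel

/-- The natural extension map `T̂ y = M_β y - Ψ(b_1(π y))` maps `X̂` to itself. -/
theorem M_sub_Psi_mem_XHat (hA : ∀ a ∈ T.A, a ∈ ZBeta β.toReal) {y : Fin β.degree → ℝ}
    (hy : y ∈ T.XHat) : β.M y - β.Psi (T.digit (β.proj y)) ∈ T.XHat := by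
  obtain ⟨x, o, h, rfl⟩ := mem_XHat_iff.1 hy
  rw [proj_sub_tailValue hA h, ← h.smul_v1_sub_cons hA]
  exact mem_XHat_iff.2 ⟨_, _, h.cons, rfl⟩

theorem exists_M_sub_Psi_eq (hA : ∀ a ∈ T.A, a ∈ ZBeta β.toReal) {y : Fin β.degree → ℝ}
    (hy : y ∈ T.XHat) : ∃ y' ∈ T.XHat, β.M y' - β.Psi (T.digit (β.proj y')) = y := by
  obtain ⟨x, o, h, rfl⟩ := mem_XHat_iff.1 hy
  refine ⟨_, mem_XHat_iff.2 ⟨_, _, h.shift 1, rfl⟩, ?_⟩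
  rw [proj_sub_tailValue hA (h.shift 1), ← (h.shift 1).smul_v1_sub_cons hA]
  have h1 : T.map (o 1) = x := by rw [(h.2 0).2, h.1]
  rw [h1]
  congr 2
  ext n
  cases n with
  | zero => exact h.1.symm
  | succ n => rfl

theorem exists_norm_XHat_le (hA : ∀ a ∈ T.A, a ∈ ZBeta β.toReal) :
    ∃ R, ∀ y ∈ T.XHat, ‖y‖ ≤ R := by
  obtain ⟨R, hR0, hR⟩ := T.exists_bound
  obtain ⟨C, hC0, hC⟩ := exists_norm_M_pow_tailValue_le hA
  refine ⟨R * ‖β.v1‖ + C, fun y hy => ?_⟩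
  obtain ⟨x, o, h, rfl⟩ := mem_XHat_iff.1 hy
  refine (norm_sub_le _ _).trans (add_le_add ?_ ?_)
  · rw [norm_smul]
    exact mul_le_mul_of_nonneg_right (hR x h.mem) (norm_nonneg _)
  · simpa using hC _ _ h 0

/-! ### Measurability of X̂ -/

theorem measurableSet_Xa (a : ℝ) : MeasurableSet (T.Xa a) :=
  Finset.measurableSet_biUnion _ fun _ _ => measurableSet_Ico

theorem measurableSet_X : MeasurableSet T.X :=
  Finset.measurableSet_biUnion _ fun _ _ => measurableSet_Xa _

theorem measurable_digit : Measurable T.digit := by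
  classical
  have h : T.digit = fun x => ∑ a ∈ T.A, (T.Xa a).indicator (fun _ => a) x := by
    ext x
    by_cases hx : x ∈ T.X
    · rw [Finset.sum_eq_single (T.digit x)]
      · rw [Set.indicator_of_mem (T.mem_Xa_digit hx)]
      · intro a ha hne
        refine Set.indicator_of_notMem (fun h => hne ?_) _
        rw [T.digit_eq ha h]
      · exact fun h => absurd (T.digit_mem hx) h
    · have h1 : ¬ ∃ a ∈ T.A, x ∈ T.Xa a := fun h => hx (T.mem_X.2 h)
      rw [digit, dif_neg h1]
      exact (Finset.sum_eq_zero fun a ha =>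
        Set.indicator_of_notMem (fun h => h1 ⟨a, ha, h⟩) _).symm
  rw [h]
  exact Finset.measurable_sum _ fun a _ => measurable_const.indicator (measurableSet_Xa a)

theorem measurable_map : Measurable T.map :=
  (measurable_const.mul measurable_id).sub measurable_digit

/-- A point lies in X̂ as soon as it is approximated to order ρ^n by a backward orbit at each level
n, by compactness; and at each level the approximation only involves one of the countably many
elements of ℤ[β]. -/
theorem measurableSet_XHat (hA : ∀ a ∈ T.A, a ∈ ZBeta β.toReal) : MeasurableSet T.XHat := by
  have hβ := β.pos
  obtain ⟨C, hC0, hC⟩ := exists_norm_M_pow_tailValue_le hA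
  -- Here c stands for β^n o_n − π(y), so (π(y) + c) / β^n is the candidate for o_n.
  have key : T.XHat = ⋂ n : ℕ, ⋃ c ∈ (β.ring : Set ℝ), {y |
      (β.proj y + c) / β.toReal ^ n ∈ T.X ∧ T.map^[n] ((β.proj y + c) / β.toReal ^ n) = β.proj y ∧
      ‖β.proj y • β.v1 - y - β.Phi c‖ ≤ C * β.rho ^ n} := by
    ext y
    simp only [Set.mem_iInter, Set.mem_iUnion, Set.mem_ofPred_eq, exists_prop]
    constructor
    · intro hy n
      obtain ⟨o, ho, h⟩ := (mem_XHat_iff_proj hA).1 hy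
      have h1 : (β.proj y + (β.toReal ^ n * o n - β.proj y)) / β.toReal ^ n = o n := by
        field_simp; ring
      refine ⟨_, ho.sub_mem_ring hA n, by rw [h1]; exact (ho.2 n).1,
        by rw [h1]; exact ho.iterate_zero n, ?_⟩
      have h2 : β.proj y • β.v1 - y = T.tailValue o := by
        nth_rw 2 [h]; abel
      rw [h2, ho.tailValue_eq hA n, add_sub_cancel_left]
      exact hC _ _ (ho.shift n) n
    · intro h
      choose c hc hX hT hn using h
      choose o ho ho' using fun n => T.exists_isBackOrbit_apply (hX n) n
      simp only [hT] at ho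
      obtain ⟨o', h1, h2⟩ := exists_isBackOrbit_of_tendsto hA (hyperfilter ℕ) (x := β.proj y)
        (y := fun _ => β.proj y) (o := o)
        (tendsto_nhdsWithin_iff.2 ⟨tendsto_const_nhds, by simp⟩) (Eventually.of_forall ho)
      have h3 : Tendsto (fun n => T.tailValue (o n)) atTop (𝓝 (β.proj y • β.v1 - y)) := by
        rw [tendsto_iff_norm_sub_tendsto_zero]
        refine squeeze_zero (fun _ => norm_nonneg _) (fun n => ?_) (β.tendsto_rho_pow (2 * C))
        have h4 : β.toReal ^ n * o n n - β.proj y = c n := by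
          rw [ho']; field_simp; ring
        have h5 := (ho n).tailValue_eq hA n
        rw [h4] at h5
        have h6 : T.tailValue (o n) - (β.proj y • β.v1 - y) =
            (β.M ^ n) (T.tailValue fun m => o n (m + n)) -
              (β.proj y • β.v1 - y - β.Phi (c n)) := by rw [h5]; abel
        rw [h6]
        refine (norm_sub_le _ _).trans ((add_le_add (hC _ _ ((ho n).shift n) n) (hn n)).trans ?_)
        linarith
      have h7 := tendsto_nhds_unique h2 (h3.mono_left Nat.hyperfilter_le_atTop)
      exact mem_XHat_iff.2 ⟨_, _, h1, by rw [h7]; abel⟩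
  rw [key]
  refine MeasurableSet.iInter fun n => MeasurableSet.biUnion β.countable_ring fun c _ => ?_
  have hp : Measurable β.proj := β.proj.continuous.measurable
  have h1 : Measurable fun y => (β.proj y + c) / β.toReal ^ n := (hp.add_const c).div_const _
  refine (h1 measurableSet_X).inter (MeasurableSet.inter ?_ ?_)
  · exact measurableSet_eq_fun ((measurable_map.iterate n).comp h1) hp
  · have hc : Continuous fun y : Fin β.degree → ℝ => ‖β.proj y • β.v1 - y - β.Phi c‖ := by
      have := β.proj.continuous
      fun_prop
    exact (isClosed_le hc continuous_const).measurableSet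

end BetaTransformation

/-! ### Periodic sets and ergodicity of the toral automorphism -/

namespace PisotUnit

variable (β : PisotUnit)

/-- The lattice `ℤ^d ⊂ ℝ^d`. -/
def lattice : AddSubgroup (Fin β.degree → ℝ) where
  carrier := Set.range β.intVec
  add_mem' := by
    rintro _ _ ⟨m, rfl⟩ ⟨n, rfl⟩
    exact ⟨m + n, β.intVec_add m n⟩
  zero_mem' := ⟨0, by ext; simp [intVec]⟩
  neg_mem' := by
    rintro _ ⟨m, rfl⟩
    exact ⟨-m, by ext; simp [intVec]⟩

instance : Countable β.lattice := (Set.countable_range β.intVec).to_subtype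

/-- The half-open unit cube. -/
def cube : Set (Fin β.degree → ℝ) := Set.univ.pi fun _ => Set.Ico 0 1

theorem isAddFundamentalDomain_cube : IsAddFundamentalDomain β.lattice β.cube volume := by
  refine IsAddFundamentalDomain.mk'
    (MeasurableSet.univ_pi fun _ => measurableSet_Ico).nullMeasurableSet fun p => ?_
  refine ⟨⟨β.intVec fun i => -⌊p i⌋, Set.mem_range_self _⟩, ?_, ?_⟩
  · intro i _
    simp only [AddSubgroup.vadd_def, vadd_eq_add, Pi.add_apply, intVec, Int.cast_neg]
    exact ⟨by linarith [Int.floor_le (p i)], by linarith [Int.lt_floor_add_one (p i)]⟩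
  · rintro ⟨_, m, rfl⟩ hm
    ext i
    have h := hm i (Set.mem_univ i)
    simp only [AddSubgroup.vadd_def, vadd_eq_add, Pi.add_apply, intVec, Set.mem_Ico] at h
    have h1 : ⌊p i⌋ = -m i := by
      rw [Int.floor_eq_iff]
      push_cast
      constructor <;> linarith [h.1, h.2]
    simp [intVec, h1]

theorem volume_cube_ne_top : volume β.cube ≠ ⊤ := by
  simp [cube, MeasureTheory.volume_pi_pi]

theorem volume_preimage_M (s : Set (Fin β.degree → ℝ)) : volume (β.M ⁻¹' s) = volume s := by
  have h : LinearMap.det β.M ≠ 0 := fun h => by simpa [h] using β.abs_det_M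
  rw [Measure.addHaar_preimage_linearMap volume h, abs_inv, β.abs_det_M]
  simp

theorem volume_image_M (s : Set (Fin β.degree → ℝ)) : volume (β.M '' s) = volume s := by
  rw [Measure.addHaar_image_linearMap, β.abs_det_M]
  simp

theorem continuous_M : Continuous β.M := LinearMap.continuous_of_finiteDimensional _

theorem measurePreserving_M : MeasurePreserving β.M volume volume :=
  ⟨β.continuous_M.measurable, by
    ext s hs
    rw [Measure.map_apply β.continuous_M.measurable hs, volume_preimage_M]⟩

/-- `M_β` as a linear automorphism. -/
noncomputable def equivM : (Fin β.degree → ℝ) ≃ₗ[ℝ] (Fin β.degree → ℝ) :=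
  LinearMap.equivOfDetNeZero β.M fun h => by simpa [h] using β.abs_det_M

theorem equivM_apply (p : Fin β.degree → ℝ) : β.equivM p = β.M p := rfl

theorem M_injective : Function.Injective β.M := β.equivM.injective

/-- M_β permutes ℤ^d and preserves volume, so M_β(cube) is a second fundamental domain. Comparing
the two shows that M_β preserves the volume of periodic sets modulo ℤ^d. -/
theorem isAddFundamentalDomain_preimage_symm :
    IsAddFundamentalDomain β.lattice (β.equivM.symm ⁻¹' β.cube) volume := by
  have hmem : ∀ g : β.lattice, β.M g ∈ β.lattice := by
    rintro ⟨_, m, rfl⟩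
    exact ⟨_, (β.M_intVec m).symm⟩
  have hq : MeasurePreserving β.equivM.symm volume volume := by
    have hm : Measurable β.equivM.symm :=
      (LinearMap.continuous_of_finiteDimensional β.equivM.symm.toLinearMap).measurable
    refine ⟨hm, ?_⟩
    ext s hs
    rw [Measure.map_apply hm hs, ← volume_preimage_M]
    congr 1
    ext p
    simp [← equivM_apply]
  refine β.isAddFundamentalDomain_cube.preimage_of_equiv hq.quasiMeasurePreserving
    (e := fun g => ⟨β.M g, hmem g⟩) ⟨fun g g' h => ?_, ?_⟩ fun g p => ?_
  · exact Subtype.ext (β.M_injective (congrArg Subtype.val h))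
  · rintro ⟨_, m, rfl⟩
    obtain ⟨n, hn⟩ := β.exists_M_intVec_eq m
    exact ⟨⟨_, n, rfl⟩, Subtype.ext hn⟩
  · simp only [AddSubgroup.vadd_def, vadd_eq_add, map_add]
    congr 1
    rw [← equivM_apply, LinearEquiv.symm_apply_apply]

/-- Invariance under translations by `ℤ^d`. -/
def Periodic (s : Set (Fin β.degree → ℝ)) : Prop := ∀ p m, p + β.intVec m ∈ s ↔ p ∈ s

variable {β}

theorem Periodic.preimage_vadd {s : Set (Fin β.degree → ℝ)} (h : β.Periodic s) (g : β.lattice) :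
    (fun x => g +ᵥ x) ⁻¹' s = s := by
  obtain ⟨_, m, rfl⟩ := g
  ext p
  simp only [Set.mem_preimage, AddSubgroup.vadd_def, vadd_eq_add]
  rw [add_comm, h]

theorem Periodic.symmDiff {s t : Set (Fin β.degree → ℝ)} (hs : β.Periodic s) (ht : β.Periodic t) :
    β.Periodic (s ∆ t) := fun p m => by
  simp only [Set.mem_symmDiff, hs p m, ht p m]

theorem Periodic.translate {s : Set (Fin β.degree → ℝ)} (hs : β.Periodic s)
    (h : Fin β.degree → ℝ) : β.Periodic {p | p + h ∈ s} := fun p m => by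
  simp only [Set.mem_ofPred_eq, add_right_comm p, hs (p + h) m]

theorem Periodic.preimage_M {s : Set (Fin β.degree → ℝ)} (hs : β.Periodic s) :
    β.Periodic (β.M ⁻¹' s) := fun p m => by
  simp only [Set.mem_preimage, map_add, M_intVec]
  exact hs _ _

theorem Periodic.volume_eq_zero {s : Set (Fin β.degree → ℝ)} (hs : β.Periodic s)
    (h : volume (s ∩ β.cube) = 0) : volume s = 0 := by
  refine β.isAddFundamentalDomain_cube.measure_zero_of_invariant s (fun g => ?_) h
  ext p
  rw [Set.mem_vadd_set_iff_neg_vadd_mem]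
  exact Set.ext_iff.1 (hs.preimage_vadd (-g)) p

theorem Periodic.volume_preimage_M_inter_cube {s : Set (Fin β.degree → ℝ)} (hs : β.Periodic s)
    (hm : MeasurableSet s) : volume (β.M ⁻¹' s ∩ β.cube) = volume (s ∩ β.cube) := by
  rw [β.isAddFundamentalDomain_cube.measure_set_eq β.isAddFundamentalDomain_preimage_symm hm
    hs.preimage_vadd, ← β.volume_preimage_M (s ∩ _)]
  congr 1
  ext p
  simp [← equivM_apply]

/-- One-sided invariance suffices: s and its preimage have the same finite volume modulo ℤ^d, so
almost everywhere inclusion is equality. -/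
theorem Periodic.preimage_ae_eq {s : Set (Fin β.degree → ℝ)} (hs : β.Periodic s)
    (hm : MeasurableSet s) (h : ∀ᵐ p, p ∈ s → β.M p ∈ s) : β.M ⁻¹' s =ᵐ[volume] s := by
  have hm' : MeasurableSet (β.M ⁻¹' s) := β.continuous_M.measurable hm
  have h1 : s =ᵐ[volume.restrict β.cube] β.M ⁻¹' s := by
    refine ae_eq_of_ae_subset_of_measure_ge (ae_restrict_of_ae h) ?_ hm.nullMeasurableSet ?_
    · rw [Measure.restrict_apply hm, Measure.restrict_apply hm',
        hs.volume_preimage_M_inter_cube hm]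
    · rw [Measure.restrict_apply hm']
      exact measure_ne_top_of_subset Set.inter_subset_right β.volume_cube_ne_top
  have h2 : volume ((s ∆ (β.M ⁻¹' s)) ∩ β.cube) = 0 := by
    rw [← Measure.restrict_apply (hm.symmDiff hm')]
    exact measure_symmDiff_eq_zero_iff.2 h1
  exact (measure_symmDiff_eq_zero_iff.1 ((hs.symmDiff hs.preimage_M).volume_eq_zero h2)).symm

theorem Periodic.tendsto_symmDiff_translate {s : Set (Fin β.degree → ℝ)}
    (hm : MeasurableSet s) :
    Tendsto (fun t => volume ((s ∆ {p | p + t ∈ s}) ∩ β.cube)) (𝓝 0) (𝓝 0) := by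
  have hbd : Bornology.IsBounded β.cube := Bornology.IsBounded.pi fun _ => Metric.isBounded_Ico _ _
  obtain ⟨R, hR⟩ := hbd.exists_norm_le
  -- The truncation makes the measure finite. It is invisible on the cube for ‖t‖ ≤ 1, since p and p
  -- + t then stay in the ball.
  set s' := s ∩ Metric.closedBall 0 (R + 1) with hs'
  have hm' : MeasurableSet s' := hm.inter measurableSet_closedBall
  have hfin : volume s' ≠ ⊤ :=
    measure_ne_top_of_subset Set.inter_subset_right measure_closedBall_lt_top.ne
  let f : C((Fin β.degree → ℝ), C((Fin β.degree → ℝ), (Fin β.degree → ℝ))) :=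
    (ContinuousMap.mk (fun q : (Fin β.degree → ℝ) × (Fin β.degree → ℝ) => q.2 + q.1)
      (by fun_prop)).curry
  have hf : ∀ t p, f t p = p + t := fun t p => rfl
  have hmp : ∀ t, MeasurePreserving (f t) volume volume := fun t => measurePreserving_add_right _ t
  have h1 := tendsto_measure_symmDiff_preimage_nhds_zero (f.continuous.tendsto 0)
    (Eventually.of_forall hmp) (hmp 0) hm'.nullMeasurableSet hfin
  refine tendsto_of_tendsto_of_tendsto_of_le_of_le' tendsto_const_nhds h1
    (Eventually.of_forall fun _ => zero_le) ?_
  filter_upwards [Metric.closedBall_mem_nhds (0 : Fin β.degree → ℝ) one_pos] with t ht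
  refine measure_mono ?_
  rintro p ⟨hp, hpc⟩
  have h2 := hR p hpc
  have h3 : ‖t‖ ≤ 1 := mem_closedBall_zero_iff.1 ht
  have h4 : p ∈ Metric.closedBall (0 : Fin β.degree → ℝ) (R + 1) :=
    mem_closedBall_zero_iff.2 (by linarith)
  have h5 : p + t ∈ Metric.closedBall (0 : Fin β.degree → ℝ) (R + 1) :=
    mem_closedBall_zero_iff.2 ((norm_add_le _ _).trans (by linarith))
  simp only [Set.mem_symmDiff, Set.mem_ofPred_eq, Set.mem_preimage, hf, hs', Set.mem_inter_iff, h4,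
    h5, and_true, add_zero] at hp ⊢
  tauto

/-- An `M_β`-invariant `ℤ^d`-periodic set is almost invariant under translations by `H`. -/
theorem Periodic.translate_ae_eq {s : Set (Fin β.degree → ℝ)} (hs : β.Periodic s)
    (hm : MeasurableSet s) (h : β.M ⁻¹' s =ᵐ[volume] s) {t : Fin β.degree → ℝ} (ht : t ∈ β.H) :
    {p | p + t ∈ s} =ᵐ[volume] s := by
  have htr : ∀ t, MeasurePreserving (fun p : Fin β.degree → ℝ => p + t) volume volume :=
    measurePreserving_add_right _
  -- The discrepancy between s and its translate is the same for t and for M_β t, hence for M_β^n t,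
  -- which tends to 0 for t ∈ H.
  have hstep : ∀ t : Fin β.degree → ℝ, volume ((s ∆ {p | p + t ∈ s}) ∩ β.cube) =
      volume ((s ∆ {p | p + β.M t ∈ s}) ∩ β.cube) := by
    intro t
    rw [← (hs.symmDiff (hs.translate (β.M t))).volume_preimage_M_inter_cube
      (hm.symmDiff ((htr _).measurable hm))]
    refine measure_congr (EventuallyEq.inter ?_ (ae_eq_refl _))
    have h1 := (htr t).quasiMeasurePreserving.preimage_ae_eq h
    have h2 : β.M ⁻¹' (s ∆ {p | p + β.M t ∈ s}) =
        (β.M ⁻¹' s) ∆ ((fun p => p + t) ⁻¹' (β.M ⁻¹' s)) := by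
      ext p
      simp [Set.mem_symmDiff]
    rw [h2]
    exact (h.symmDiff h1).symm
  have hiter : ∀ n : ℕ, volume ((s ∆ {p | p + t ∈ s}) ∩ β.cube) =
      volume ((s ∆ {p | p + (β.M ^ n) t ∈ s}) ∩ β.cube) := by
    intro n
    induction n with
    | zero => simp
    | succ n ih => rw [ih, hstep, pow_succ', Module.End.mul_apply]
  have hlim := (tendsto_symmDiff_translate hm).comp (β.tendsto_M_pow ht)
  simp only [Function.comp_def, ← hiter] at hlim
  have h0 := tendsto_nhds_unique hlim tendsto_const_nhds
  exact (measure_symmDiff_eq_zero_iff.1 ((hs.symmDiff (hs.translate t)).volume_eq_zero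
    h0.symm)).symm

/-- As β is a unit, ℤ[β] contains all integer multiples of β⁻ⁿ. Density of ℤ[β] in ℝ means density
of H + ℤ^d in ℝ^d. -/
theorem exists_mem_ring_abs_sub_lt (β : PisotUnit) (t : ℝ) {ε : ℝ} (hε : 0 < ε) :
    ∃ x ∈ β.ring, |t - x| < ε := by
  obtain ⟨n, hn⟩ := exists_pow_lt_of_lt_one hε (inv_lt_one_of_one_lt₀ β.one_lt)
  have hp : 0 < β.toReal ^ n := pow_pos β.pos n
  refine ⟨(⌊t * β.toReal ^ n⌋ : ℝ) * β.toReal⁻¹ ^ n,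
    mul_mem (intCast_mem _ _) (pow_mem β.inv_mem_ring n), lt_of_le_of_lt ?_ hn⟩
  have h1 := Int.floor_le (t * β.toReal ^ n)
  have h2 := Int.lt_floor_add_one (t * β.toReal ^ n)
  have h3 : t - (⌊t * β.toReal ^ n⌋ : ℝ) * β.toReal⁻¹ ^ n =
      (t * β.toReal ^ n - ⌊t * β.toReal ^ n⌋) * β.toReal⁻¹ ^ n := by
    rw [inv_pow]; field_simp
  rw [h3, abs_mul, abs_of_nonneg (sub_nonneg.2 h1),
    abs_of_nonneg (pow_nonneg (inv_nonneg.2 β.pos.le) n)]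
  exact mul_le_of_le_one_left (pow_nonneg (inv_nonneg.2 β.pos.le) n) (by linarith)

/-- Ergodicity of the toral automorphism `M_β`, for sets that miss an open set. -/
theorem Periodic.volume_eq_zero_of_isOpen {s U : Set (Fin β.degree → ℝ)} (hs : β.Periodic s)
    (hm : MeasurableSet s) (h : ∀ᵐ p, p ∈ s → β.M p ∈ s) (hU : IsOpen U) (hne : U.Nonempty)
    (hdisj : Disjoint s U) : volume s = 0 := by
  have hinv := hs.preimage_ae_eq hm h
  refine measure_null_of_locally_null s fun q _ => ?_
  obtain ⟨u, hu⟩ := hne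
  have hcont : Continuous fun r : ℝ => u + r • β.v1 := by fun_prop
  have h1 : ∀ᶠ r in 𝓝 (0 : ℝ), u + r • β.v1 ∈ U :=
    hcont.tendsto' 0 u (by simp) |>.eventually (hU.mem_nhds hu)
  obtain ⟨ε, hε, h2⟩ := Metric.eventually_nhds_iff.1 h1
  obtain ⟨x, hx, hx'⟩ := β.exists_mem_ring_abs_sub_lt (β.proj (q - u)) hε
  -- The point u is moved inside U along v_1 until its v_1-coordinate differs from that of q by x ∈
  -- ℤ[β]. Then u' − q + Ψ(x) lies in H, and modulo ℤ^d it translates q into U.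
  set u' := u + (β.proj (q - u) - x) • β.v1 with hu'
  have hu'U : u' ∈ U := h2 (by rwa [Real.dist_0_eq_abs])
  obtain ⟨m, hm'⟩ := β.exists_intVec_eq_Psi hx
  set t : Fin β.degree → ℝ := u' - q + β.intVec m with ht
  have htH : t ∈ β.H := by
    rw [β.mem_H_iff, ht, hu', ← hm']
    simp only [map_add, map_sub, map_smul, β.proj_v1, β.proj_Psi, smul_eq_mul]
    ring
  have h3 := hs.translate_ae_eq hm hinv htH
  refine ⟨s ∩ {p | p + (u' - q) ∈ U}, inter_mem_nhdsWithin s ?_, ?_⟩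
  · have hc : Continuous fun p : Fin β.degree → ℝ => p + (u' - q) := by fun_prop
    refine (hU.preimage hc).mem_nhds ?_
    simpa using hu'U
  · have h4 := measure_congr (h3.inter (ae_eq_refl {p | p + (u' - q) ∈ U}))
    refine h4.symm.trans ?_
    convert measure_empty (μ := volume)
    rw [Set.eq_empty_iff_forall_notMem]
    rintro p ⟨hp1, hp2⟩
    rw [Set.mem_ofPred_eq, ht, ← add_assoc, hs] at hp1
    exact Set.disjoint_left.1 hdisj hp1 hp2

end PisotUnit

/-! ### Backward orbits in finite sets -/

theorem exists_iterate_eq_of_finite {α : Type*} {f : α → α} {z : ℕ → α} {Y : Set α}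
    (hY : Y.Finite) (hz : ∀ n, z n ∈ Y) (h : ∀ n, f (z (n + 1)) = z n) (n : ℕ) :
    ∃ p, 1 ≤ p ∧ f^[p] (z n) = z n := by
  have hit : ∀ k m, f^[k] (z (m + k)) = z m := fun k => by
    induction k with
    | zero => exact fun m => rfl
    | succ k ih => exact fun m => by rw [Function.iterate_succ_apply, ← add_assoc, h, ih]
  obtain ⟨a, ha, b, hb, hne, hab⟩ := (Set.Ici_infinite n).exists_ne_map_eq_of_mapsTo
    (f := z) (t := Y) (fun m _ => hz m) hY
  wlog hlt : a < b generalizing a b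
  · exact this b hb a ha hne.symm hab.symm (lt_of_le_of_ne (not_lt.1 hlt) hne.symm)
  refine ⟨b - a, by omega, ?_⟩
  have h1 : f^[b - a] (z a) = z a := by
    nth_rw 1 [hab]
    have := hit (b - a) a
    rwa [Nat.add_sub_cancel' hlt.le] at this
  have h2 : f^[a - n] (z a) = z n := by
    have := hit (a - n) n
    rwa [Nat.add_sub_cancel' ha] at this
  rw [← h2, ← Function.iterate_add_apply, add_comm, Function.iterate_add_apply, h1]

/-- The range is contained in its own image under f, and by finiteness the two are equal. -/
theorem iterate_mem_range_of_finite {α : Type*} {f : α → α} {z : ℕ → α}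
    (hY : (Set.range z).Finite) (h : ∀ n, f (z (n + 1)) = z n) (j : ℕ) :
    f^[j] (z 0) ∈ Set.range z := by
  have h1 : Set.range z ⊆ f '' Set.range z := by
    rintro _ ⟨n, rfl⟩
    exact ⟨_, ⟨n + 1, rfl⟩, h n⟩
  have h2 : Set.range z = f '' Set.range z :=
    hY.eq_of_subset_of_encard_le h1 (Set.encard_image_le f _)
  induction j with
  | zero => exact ⟨0, rfl⟩
  | succ j ih =>
    rw [Function.iterate_succ_apply', h2]
    exact ⟨_, ih, rfl⟩

/-! ### Overlaps of the integer translates of X̂ -/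

namespace BetaTransformation

variable {β : PisotUnit} {T : BetaTransformation β.toReal}

variable (T) in
/-- The points that have two translates by `ℤ^d` in `X̂`. -/
def overlap : Set (Fin β.degree → ℝ) :=
  {p | ∃ m n, m ≠ n ∧ p + β.intVec m ∈ T.XHat ∧ p + β.intVec n ∈ T.XHat}

theorem periodic_overlap : β.Periodic T.overlap := by
  have h : ∀ p m, p ∈ T.overlap → p + β.intVec m ∈ T.overlap := by
    rintro p k ⟨m, n, hne, hm, hn⟩
    refine ⟨m - k, n - k, fun h => hne (sub_left_injective h), ?_, ?_⟩
    · rwa [β.intVec_sub, add_add_sub_cancel]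
    · rwa [β.intVec_sub, add_add_sub_cancel]
  refine fun p m => ⟨fun hp => ?_, h p m⟩
  have := h _ (0 - m) hp
  rwa [β.intVec_sub, add_add_sub_cancel, show β.intVec 0 = 0 by ext; simp [PisotUnit.intVec],
    add_zero] at this

theorem measurableSet_overlap (hA : ∀ a ∈ T.A, a ∈ ZBeta β.toReal) :
    MeasurableSet T.overlap := by
  have h : T.overlap = ⋃ m, ⋃ n, ⋃ _ : m ≠ n,
      ((fun p => p + β.intVec m) ⁻¹' T.XHat ∩ (fun p => p + β.intVec n) ⁻¹' T.XHat) := by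
    ext p
    simp only [overlap, Set.mem_iUnion, Set.mem_inter_iff, Set.mem_preimage, exists_prop,
      Set.mem_ofPred_eq]
  rw [h]
  refine MeasurableSet.iUnion fun m => MeasurableSet.iUnion fun n => MeasurableSet.iUnion fun _ => ?_
  exact (measurable_add_const _ (measurableSet_XHat hA)).inter
    (measurable_add_const _ (measurableSet_XHat hA))

theorem measurableSet_XHatA (hA : ∀ a ∈ T.A, a ∈ ZBeta β.toReal) (a : ℝ) :
    MeasurableSet (T.XHatA a) := by
  have h : T.XHatA a = T.XHat ∩ (fun y => T.digit (β.proj y)) ⁻¹' {a} := by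
    ext y
    exact mem_XHatA_iff_proj hA
  rw [h]
  exact (measurableSet_XHat hA).inter ((measurable_digit.comp β.proj.continuous.measurable)
    (measurableSet_singleton a))

theorem volume_XHat_ne_top (hA : ∀ a ∈ T.A, a ∈ ZBeta β.toReal) : volume T.XHat ≠ ⊤ := by
  obtain ⟨R, hR⟩ := exists_norm_XHat_le hA
  have h : T.XHat ⊆ Metric.closedBall 0 R := fun y hy => mem_closedBall_zero_iff.2 (hR y hy)
  exact measure_ne_top_of_subset h measure_closedBall_lt_top.ne

variable (T) in
/-- The image of `X̂_a` under the natural extension map. -/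
def imageXHatA (a : ℝ) : Set (Fin β.degree → ℝ) := (fun y => β.M y - β.Psi a) '' T.XHatA a

theorem volume_imageXHatA (a : ℝ) : volume (T.imageXHatA a) = volume (T.XHatA a) := by
  have h : T.imageXHatA a = (fun y => y + β.Psi a) ⁻¹' (β.M '' T.XHatA a) := by
    ext y
    simp only [imageXHatA, Set.mem_image, Set.mem_preimage]
    refine exists_congr fun z => and_congr_right fun _ => ?_
    rw [sub_eq_iff_eq_add]
  rw [h, measure_preimage_add_right, β.volume_image_M]

theorem measurableSet_imageXHatA (hA : ∀ a ∈ T.A, a ∈ ZBeta β.toReal) (a : ℝ) :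
    MeasurableSet (T.imageXHatA a) := by
  have h : T.imageXHatA a = (fun y => β.equivM.symm (y + β.Psi a)) ⁻¹' (T.XHatA a) := by
    ext y
    simp only [imageXHatA, Set.mem_image, Set.mem_preimage]
    constructor
    · rintro ⟨z, hz, rfl⟩
      simpa [← β.equivM_apply] using hz
    · intro hy
      exact ⟨_, hy, by simp [← β.equivM_apply]⟩
  rw [h]
  have hc : Continuous β.equivM.symm :=
    LinearMap.continuous_of_finiteDimensional β.equivM.symm.toLinearMap
  exact (hc.comp (continuous_add_const _)).measurable (measurableSet_XHatA hA a)

/-- The natural extension map is injective almost everywhere. -/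
theorem volume_imageXHatA_inter (hA : ∀ a ∈ T.A, a ∈ ZBeta β.toReal) {a a' : ℝ} (ha : a ∈ T.A)
    (ha' : a' ∈ T.A) (hne : a ≠ a') : volume (T.imageXHatA a ∩ T.imageXHatA a') = 0 := by
  classical
  set Y := ⋃ b ∈ T.A.erase a', T.imageXHatA b with hY
  have hsub : T.imageXHatA a ⊆ Y :=
    Set.subset_biUnion_of_mem (u := T.imageXHatA) (Finset.mem_coe.2 (Finset.mem_erase.2 ⟨hne, ha⟩))
  have hun : T.XHat ⊆ Y ∪ T.imageXHatA a' := by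
    intro y hy
    obtain ⟨y', hy', rfl⟩ := exists_M_sub_Psi_eq hA hy
    have h1 : β.M y' - β.Psi (T.digit (β.proj y')) ∈ T.imageXHatA (T.digit (β.proj y')) :=
      ⟨y', (mem_XHatA_iff_proj hA).2 ⟨hy', rfl⟩, rfl⟩
    by_cases h : T.digit (β.proj y') = a'
    · exact Or.inr (h ▸ h1)
    · exact Or.inl (Set.mem_biUnion (Finset.mem_coe.2
        (Finset.mem_erase.2 ⟨h, T.digit_mem (proj_mem_X hA hy')⟩)) h1)
  -- The pieces X̂_b partition X̂, and their images have the same volumes and cover X̂. As the total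
  -- is finite, no mass is left for an overlap.
  have hsum : ∑ b ∈ T.A, volume (T.XHatA b) = volume T.XHat := by
    rw [← measure_biUnion_finset]
    · congr 1
      ext y
      simp only [Set.mem_iUnion, exists_prop, mem_XHatA_iff_proj hA]
      constructor
      · rintro ⟨b, -, h, -⟩
        exact h
      · exact fun h => ⟨_, T.digit_mem (proj_mem_X hA h), h, rfl⟩
    · intro b _ b' _ hbb
      refine Set.disjoint_left.2 fun y h h' => hbb ?_
      rw [← ((mem_XHatA_iff_proj hA).1 h).2, ((mem_XHatA_iff_proj hA).1 h').2]
    · exact fun b _ => measurableSet_XHatA hA b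
  have hYle : volume Y ≤ ∑ b ∈ T.A.erase a', volume (T.XHatA b) := by
    refine (measure_biUnion_finset_le _ _).trans (Finset.sum_le_sum fun b _ => ?_)
    rw [volume_imageXHatA]
  have h1 := measure_union_add_inter (μ := volume) Y (measurableSet_imageXHatA hA a')
  have h2 : volume Y + volume (T.imageXHatA a') ≤ volume T.XHat := by
    rw [← hsum, ← Finset.sum_erase_add _ _ ha', volume_imageXHatA]
    gcongr
  have h3 : volume T.XHat + volume (Y ∩ T.imageXHatA a') ≤ volume T.XHat + 0 := by
    rw [add_zero]
    calc _ ≤ volume (Y ∪ T.imageXHatA a') + volume (Y ∩ T.imageXHatA a') := by gcongr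
      _ ≤ _ := h1 ▸ h2
  have h4 := (ENNReal.add_le_add_iff_left (volume_XHat_ne_top hA)).1 h3
  exact measure_mono_null (Set.inter_subset_inter_left _ hsub) (le_antisymm h4 zero_le)

/-- T̂ sends two translates of p in X̂ to translates of M_β p in X̂. These are distinct: for equal
digits because M_β is injective, for different digits because a common value would lie in two of the
images, which happens on a null set only. -/
theorem ae_M_mem_overlap (hA : ∀ a ∈ T.A, a ∈ ZBeta β.toReal) :
    ∀ᵐ p, p ∈ T.overlap → β.M p ∈ T.overlap := by
  have hnull : ∀ k : Fin β.degree → ℤ, ∀ a ∈ T.A, ∀ a' ∈ T.A, a ≠ a' →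
      ∀ᵐ p, β.M p + β.intVec k ∉ T.imageXHatA a ∩ T.imageXHatA a' := by
    intro k a ha a' ha' hne
    have h0 := volume_imageXHatA_inter hA ha ha' hne
    have h1 := β.measurePreserving_M.quasiMeasurePreserving.preimage_null
      ((measurePreserving_add_right volume (β.intVec k)).quasiMeasurePreserving.preimage_null h0)
    exact measure_eq_zero_iff_ae_notMem.1 h1
  have hall : ∀ᵐ p, ∀ k : Fin β.degree → ℤ, ∀ a ∈ T.A, ∀ a' ∈ T.A, a ≠ a' →
      β.M p + β.intVec k ∉ T.imageXHatA a ∩ T.imageXHatA a' := by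
    rw [ae_all_iff]
    intro k
    refine (ae_ball_iff T.A.countable_toSet).2 fun a ha => ?_
    refine (ae_ball_iff T.A.countable_toSet).2 fun a' ha' => ?_
    by_cases hne : a = a'
    · exact Eventually.of_forall fun p h => absurd hne h
    · filter_upwards [hnull k a ha a' ha' hne] with p hp _ using hp
  filter_upwards [hall] with p hp
  rintro ⟨m, n, hne, hm, hn⟩
  have key : ∀ m, p + β.intVec m ∈ T.XHat → ∃ m',
      β.M (p + β.intVec m) - β.Psi (T.digit (β.proj (p + β.intVec m))) = β.M p + β.intVec m' := by
    intro m hm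
    obtain ⟨k, hk⟩ := β.exists_intVec_eq_Psi (digit_mem_ring hA (proj_mem_X hA hm))
    exact ⟨β.companionInt.mulVec m - k, by
      rw [hk, map_add, β.M_intVec, β.intVec_sub, add_sub_assoc]⟩
  obtain ⟨m', hm'⟩ := key m hm
  obtain ⟨n', hn'⟩ := key n hn
  refine ⟨m', n', fun h => ?_, hm' ▸ M_sub_Psi_mem_XHat hA hm, hn' ▸ M_sub_Psi_mem_XHat hA hn⟩
  subst h
  by_cases hd : T.digit (β.proj (p + β.intVec m)) = T.digit (β.proj (p + β.intVec n))
  · rw [← hn', hd, sub_left_inj] at hm'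
    exact hne (β.intVec_injective (add_left_cancel (β.M_injective hm')))
  · refine hp m' _ (T.digit_mem (proj_mem_X hA hm)) _ (T.digit_mem (proj_mem_X hA hn)) hd ⟨?_, ?_⟩
    · exact ⟨_, (mem_XHatA_iff_proj hA).2 ⟨hm, rfl⟩, hm'⟩
    · exact ⟨_, (mem_XHatA_iff_proj hA).2 ⟨hn, rfl⟩, hn'⟩

/-! ### Property (W) and a point covered by one tile -/

/-- For a backward orbit of T^n x passing through x, Φ(T^n x) and M_β^n Φ(x) differ by tail values
only, and these are bounded. -/
theorem Phi_iterate (hA : ∀ a ∈ T.A, a ∈ ZBeta β.toReal) :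
    ∃ C, 0 ≤ C ∧ ∀ x ∈ T.X, x ∈ β.ring → ∀ n, T.map^[n] x ∈ β.ring ∧
      ‖β.Phi (T.map^[n] x)‖ ≤ ‖(β.M ^ n) (β.Phi x)‖ + C := by
  obtain ⟨C, hC0, hC⟩ := exists_norm_M_pow_tailValue_le hA
  refine ⟨C + C, by linarith, fun x hx hxr n => ?_⟩
  obtain ⟨o, ho, hn⟩ := T.exists_isBackOrbit_apply hx n
  have h1 := ho.sub_mem_ring hA n
  rw [hn] at h1
  have h2 : β.toReal ^ n * x ∈ β.ring := mul_mem (pow_mem β.toReal_mem_ring n) hxr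
  have h3 : T.map^[n] x ∈ β.ring := by
    have := sub_mem h2 h1
    rwa [sub_sub_cancel] at this
  refine ⟨h3, ?_⟩
  have h4 := ho.tailValue_eq hA n
  rw [hn, β.Phi_sub (β.ring_subset_field h2) (β.ring_subset_field h3),
    ← β.M_pow_Phi (β.ring_subset_field hxr)] at h4
  have h5 : β.Phi (T.map^[n] x) = (β.M ^ n) (β.Phi x) +
      ((β.M ^ n) (T.tailValue fun m => o (m + n)) - T.tailValue o) := by
    rw [h4]; abel
  rw [h5]
  refine (norm_add_le _ _).trans (add_le_add le_rfl ((norm_sub_le _ _).trans (add_le_add ?_ ?_)))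
  · refine (hC _ _ (ho.shift n) n).trans ?_
    exact mul_le_of_le_one_right hC0 (pow_le_one₀ β.rho_pos.le β.rho_lt_one.le)
  · simpa using hC _ _ ho 0

theorem iterate_mul_eq {α : Type*} {f : α → α} {y : α} {p : ℕ} (hp : f^[p] y = y) (m : ℕ) :
    f^[p * m] y = y := by
  rw [Function.iterate_mul]
  exact Function.iterate_fixed hp m

/-- Taking n to be a large multiple of the period makes M_β^n Φ(y) smaller than 1, which bounds Φ(y)
uniformly in y. -/
theorem finite_P (hA : ∀ a ∈ T.A, a ∈ ZBeta β.toReal) : T.P.Finite := by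
  obtain ⟨R, hR0, hR⟩ := T.exists_bound
  obtain ⟨C, hC0, hC⟩ := Phi_iterate hA
  refine (β.finite_ring_bounded (max R (1 + C))).subset ?_
  rintro y ⟨⟨hyr, hyX⟩, p, hp, hper⟩
  refine ⟨hyr, (hR y hyX).trans (le_max_left _ _), ?_⟩
  have h1 := (β.tendsto_M_pow (β.Phi_mem_H y)).norm
  rw [norm_zero] at h1
  obtain ⟨N, hN⟩ := eventually_atTop.1 (h1.eventually (gt_mem_nhds one_pos))
  have h2 := (hC y hyX hyr (p * N)).2
  rw [iterate_mul_eq hper N] at h2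
  have h3 := hN (p * N) (Nat.le_mul_of_pos_left N hp)
  exact le_trans (by linarith) (le_max_right _ _)

theorem map_mem_P (hA : ∀ a ∈ T.A, a ∈ ZBeta β.toReal) {y : ℝ} (hy : y ∈ T.P) : T.map y ∈ T.P := by
  obtain ⟨⟨hyr, hyX⟩, p, hp, hper⟩ := hy
  obtain ⟨C, -, hC⟩ := Phi_iterate hA
  refine ⟨⟨(hC y hyX hyr 1).1, T.map_mem hyX⟩, p, hp, ?_⟩
  rw [← Function.iterate_succ_apply, Function.iterate_succ_apply', hper]

theorem iterate_mem_P (hA : ∀ a ∈ T.A, a ∈ ZBeta β.toReal) {y : ℝ} (hy : y ∈ T.P) (n : ℕ) :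
    T.map^[n] y ∈ T.P := by
  induction n with
  | zero => exact hy
  | succ n ih => rw [Function.iterate_succ_apply']; exact map_mem_P hA ih

theorem exists_mem_P_iterate_eq (hA : ∀ a ∈ T.A, a ∈ ZBeta β.toReal) {y : ℝ} (hy : y ∈ T.P)
    (n : ℕ) : ∃ y' ∈ T.P, T.map^[n] y' = y := by
  obtain ⟨p, hp, hper⟩ := hy.2
  refine ⟨_, iterate_mem_P hA hy (p * n - n), ?_⟩
  rw [← Function.iterate_add_apply, Nat.add_sub_cancel' (Nat.le_mul_of_pos_left n hp),
    iterate_mul_eq hper]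

/-- Points of `ℤ[β] ∩ X` are eventually periodic. -/
theorem eventually_iterate_mem_P (hA : ∀ a ∈ T.A, a ∈ ZBeta β.toReal) {x : ℝ} (hx : x ∈ T.X)
    (hxr : x ∈ β.ring) : ∃ N, ∀ n, N ≤ n → T.map^[n] x ∈ T.P := by
  obtain ⟨R, hR0, hR⟩ := T.exists_bound
  obtain ⟨C, hC0, hC⟩ := Phi_iterate hA
  obtain ⟨D, hD0, hD⟩ := β.exists_norm_M_pow_le (β.Phi_mem_H x)
  have hmem : ∀ n, T.map^[n] x ∈ {x | x ∈ β.ring ∧ |x| ≤ max R (D + C) ∧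
      ‖β.Phi x‖ ≤ max R (D + C)} := fun n => by
    refine ⟨(hC x hx hxr n).1, (hR _ (T.iterate_mem hx n)).trans (le_max_left _ _),
      ((hC x hx hxr n).2.trans (add_le_add ((hD n).trans ?_) le_rfl)).trans (le_max_right _ _)⟩
    exact mul_le_of_le_one_right hD0 (pow_le_one₀ β.rho_pos.le β.rho_lt_one.le)
  obtain ⟨a, -, b, -, hne, hab⟩ := Set.infinite_univ.exists_ne_map_eq_of_mapsTo
    (f := fun n => T.map^[n] x) (fun n _ => hmem n) (β.finite_ring_bounded (max R (D + C)))
  wlog hlt : a < b generalizing a b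
  · exact this b a hne.symm hab.symm (lt_of_le_of_ne (not_lt.1 hlt) hne.symm)
  have hP : T.map^[a] x ∈ T.P := by
    refine ⟨⟨(hmem a).1, T.iterate_mem hx a⟩, b - a, by omega, ?_⟩
    rw [← Function.iterate_add_apply, Nat.sub_add_cancel hlt.le]
    exact hab.symm
  refine ⟨a, fun n hn => ?_⟩
  have := iterate_mem_P hA hP (n - a)
  rwa [← Function.iterate_add_apply, Nat.sub_add_cancel hn] at this

theorem exists_notMem_Xa (y : ℝ) (a : ℝ) (ha : a ∈ T.A) : {z | y < z ∧ z ∉ T.Xa a}.Nonempty := by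
  obtain ⟨R, hR0, hR⟩ := T.exists_bound
  refine ⟨max R y + 1, by linarith [le_max_right R y], fun h => ?_⟩
  have := (le_abs_self _).trans (hR _ (T.mem_X.2 ⟨a, ha, h⟩))
  linarith [le_max_left R y]

theorem bddBelow_notMem_Xa (y a : ℝ) : BddBelow {z | y < z ∧ z ∉ T.Xa a} :=
  ⟨y, fun _ hz => hz.1.le⟩

theorem epsilon_pos (hA : ∀ a ∈ T.A, a ∈ ZBeta β.toReal) (hne : T.P.Nonempty) : 0 < T.epsilon := by
  have h := (hne.image (fun y => (sInf {z | y < z ∧ z ∉ T.Xa (T.b 1 y)} - y) *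
    β.toReal)).csInf_mem ((finite_P hA).image _)
  obtain ⟨y, hy, h⟩ := h
  rw [epsilon, ← h]
  refine mul_pos (sub_pos.2 ?_) β.pos
  have hyX := hy.1.2
  obtain ⟨u, hu, h1⟩ := mem_nhdsGE_iff_exists_Ico_subset.1
    (T.eventually_right_mem_Xa y (T.digit y))
  refine lt_of_lt_of_le hu (le_csInf (exists_notMem_Xa y _ (T.digit_mem hyX)) fun z hz => ?_)
  by_contra hlt
  exact hz.2 ((h1 ⟨hz.1.le, not_le.1 hlt⟩).2 (T.mem_Xa_digit hyX))

/-- The factor β in ε accounts for the division of the shift by β. -/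
theorem add_div_mem_Xa (hA : ∀ a ∈ T.A, a ∈ ZBeta β.toReal) {y t : ℝ} (hy : y ∈ T.P) (ht : 0 ≤ t)
    (ht' : t < T.epsilon) : y + t / β.toReal ∈ T.Xa (T.digit y) := by
  rcases ht.eq_or_lt with rfl | hpos
  · simpa using T.mem_Xa_digit hy.1.2
  by_contra hn
  have h1 : sInf {z | y < z ∧ z ∉ T.Xa (T.b 1 y)} ≤ y + t / β.toReal :=
    csInf_le (bddBelow_notMem_Xa y _) ⟨by linarith [div_pos hpos β.pos], hn⟩
  have h2 : T.epsilon ≤ (sInf {z | y < z ∧ z ∉ T.Xa (T.b 1 y)} - y) * β.toReal :=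
    csInf_le ((finite_P hA).image _).bddBelow ⟨y, hy, rfl⟩
  have h3 : (sInf {z | y < z ∧ z ∉ T.Xa (T.b 1 y)} - y) * β.toReal ≤ t := by
    rw [← le_div_iff₀ β.pos]; linarith
  linarith

theorem iterate_add_div (hA : ∀ a ∈ T.A, a ∈ ZBeta β.toReal) {y t : ℝ} (hy : y ∈ T.P) (ht : 0 ≤ t)
    (ht' : t < T.epsilon) (n : ℕ) : T.map^[n] (y + t / β.toReal ^ n) = T.map^[n] y + t := by
  induction n generalizing y with
  | zero => simp
  | succ n ih =>
    have h1 : 0 ≤ t / β.toReal ^ n := div_nonneg ht (pow_nonneg β.pos.le n)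
    have h2 : t / β.toReal ^ n < T.epsilon :=
      (div_le_self ht (one_le_pow₀ β.one_lt.le)).trans_lt ht'
    have h3 := T.digit_eq (T.digit_mem hy.1.2) (add_div_mem_Xa hA hy h1 h2)
    have h4 : T.map (y + t / β.toReal ^ (n + 1)) = T.map y + t / β.toReal ^ n := by
      rw [pow_succ, ← div_div, map, h3, map]
      have := β.pos
      field_simp
      ring
    rw [Function.iterate_succ_apply, h4, ih (map_mem_P hA hy), Function.iterate_succ_apply]

theorem add_mem_X (hA : ∀ a ∈ T.A, a ∈ ZBeta β.toReal) {y t : ℝ} (hy : y ∈ T.P) (ht : 0 ≤ t)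
    (ht' : t < T.epsilon) : y + t ∈ T.X := by
  obtain ⟨y', hy', rfl⟩ := exists_mem_P_iterate_eq hA hy 1
  rw [← iterate_add_div hA hy' ht ht' 1, pow_one]
  exact T.iterate_mem (T.mem_X.2 ⟨_, T.digit_mem hy'.1.2, add_div_mem_Xa hA hy' ht ht'⟩) 1

theorem tendsto_add_div (β : PisotUnit) (x : ℝ) {t : ℝ} (ht : 0 ≤ t) :
    Tendsto (fun n : ℕ => x + t / β.toReal ^ n) atTop (𝓝[≥] x) := by
  refine tendsto_nhdsWithin_iff.2 ⟨?_, Eventually.of_forall fun n =>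
    le_add_of_nonneg_right (div_nonneg ht (pow_nonneg β.pos.le n))⟩
  have := (tendsto_pow_atTop_atTop_of_one_lt β.one_lt).const_div_atTop t
  simpa using this.const_add x

/-- For large n the shift is too small to change a digit before time N; from then on the orbit is in
P and `iterate_add_div` applies. The threshold does not depend on t. -/
theorem eventually_iterate_add_div (hA : ∀ a ∈ T.A, a ∈ ZBeta β.toReal) {y : ℝ} {N : ℕ}
    (hy : y ∈ T.X) (hN : T.map^[N] y ∈ T.P) : ∀ᶠ n in atTop, ∀ t, 0 ≤ t → t < T.epsilon →
      T.map^[n] (y + t / β.toReal ^ n) = T.map^[n] y + t := by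
  have hε := (epsilon_pos hA ⟨_, hN⟩).le
  have h1 := T.eventually_right_iterate hy N
  obtain ⟨u, hu, h2⟩ := mem_nhdsGE_iff_exists_Ico_subset.1 h1
  filter_upwards [(tendsto_add_div β y hε).eventually
    (mem_nhdsWithin_of_mem_nhds (gt_mem_nhds hu)), eventually_ge_atTop N] with n hn hNn t ht ht'
  have hp : 0 < β.toReal ^ n := pow_pos β.pos n
  have h3 : y + t / β.toReal ^ n < u :=
    lt_of_le_of_lt (by gcongr) hn
  have h4 := (h2 ⟨le_add_of_nonneg_right (div_nonneg ht hp.le), h3⟩).2.2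
  obtain ⟨k, rfl⟩ := Nat.exists_eq_add_of_le' hNn
  rw [Function.iterate_add_apply, h4, Function.iterate_add_apply, add_sub_cancel_left,
    ← iterate_add_div hA hN ht ht' k, pow_add]
  congr 2
  have := β.pos
  field_simp

/-- Under property (W), a common translation moves all points of `P` to orbits that end in one
point of `P`. -/
theorem exists_common_translation (hA : ∀ a ∈ T.A, a ∈ ZBeta β.toReal) (hW : T.PropertyW) :
    ∃ x ∈ T.P, ∃ s ∈ β.ring, 0 ≤ s ∧ s < T.epsilon ∧ ∃ K : ℕ, ∀ y ∈ T.P, T.map^[K] (y + s) = x := by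
  classical
  obtain ⟨x, hx, hW⟩ := hW
  have hε := epsilon_pos hA ⟨x, hx⟩
  obtain ⟨p, hp, hper⟩ := hx.2
  suffices h : ∀ Q : Finset ℝ, (Q : Set ℝ) ⊆ T.P → ∃ s ∈ β.ring, 0 ≤ s ∧ s < T.epsilon ∧
      ∃ K : ℕ, ∀ y ∈ insert x Q, T.map^[K] (y + s) = x by
    obtain ⟨s, hs, h0, h1, K, hK⟩ := h (finite_P hA).toFinset (by simp)
    exact ⟨x, hx, s, hs, h0, h1, K, fun y hy => hK y (by simp [hy])⟩
  intro Q
  induction Q using Finset.induction with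
  | empty => exact fun _ => ⟨0, zero_mem _, le_rfl, hε, 0, by simp⟩
  | insert y Q _ ih =>
    intro hQ
    rw [Finset.coe_insert, Set.insert_subset_iff] at hQ
    obtain ⟨s, hs, h0, h1, K, hK⟩ := ih hQ.2
    have hinP : ∀ y' ∈ insert x (insert y Q), y' ∈ T.P := by
      intro y' hy'
      rcases Finset.mem_insert.1 hy' with rfl | hy'
      · exact hx
      rcases Finset.mem_insert.1 hy' with rfl | hy'
      · exact hQ.1
      · exact hQ.2 hy'
    have hX : ∀ y' ∈ insert x (insert y Q), y' + s ∈ T.X := fun y' hy' =>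
      add_mem_X hA (hinP y' hy') h0 h1
    have hev : ∀ y' ∈ insert x (insert y Q), ∃ N, ∀ n, N ≤ n → T.map^[n] (y' + s) ∈ T.P :=
      fun y' hy' => eventually_iterate_mem_P hA (hX y' hy') (add_mem (hinP y' hy').1.1 hs)
    have h2 : ∀ᶠ n in atTop, ∀ y' ∈ insert x (insert y Q), ∀ t, 0 ≤ t → t < T.epsilon →
        T.map^[n] (y' + s + t / β.toReal ^ n) = T.map^[n] (y' + s) + t := by
      rw [eventually_all_finset]
      intro y' hy'
      obtain ⟨N, hN⟩ := hev y' hy'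
      exact eventually_iterate_add_div hA (hX y' hy') (hN N le_rfl)
    have h3 : ∀ᶠ n in atTop, s + T.epsilon / β.toReal ^ n < T.epsilon :=
      (tendsto_add_div β s hε.le).eventually (mem_nhdsWithin_of_mem_nhds (gt_mem_nhds h1))
    obtain ⟨N, hN⟩ := hev y (by simp)
    obtain ⟨n0, hn0⟩ := eventually_atTop.1 (h2.and (h3.and (eventually_ge_atTop N)))
    -- After K steps the points already treated have merged at x, and p · n0 more steps, a multiple
    -- of the period, leave them there, while y + s has reached P. Property (W) at T^n(y + s) gives
    -- s', which is divided by β^n to act only after n steps.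
    set n := p * n0 + K with hn
    obtain ⟨h4, h5, h6⟩ := hn0 n (by nlinarith)
    obtain ⟨s', ⟨hs', h0', h1'⟩, k, hk, hk'⟩ := hW _ (hN n h6)
    refine ⟨s + s' / β.toReal ^ n, add_mem hs ?_, add_nonneg h0 (div_nonneg h0'
      (pow_nonneg β.pos.le n)), lt_trans ?_ h5, k + n, fun y' hy' => ?_⟩
    · rw [div_eq_mul_inv, ← inv_pow]
      exact mul_mem hs' (pow_mem β.inv_mem_ring n)
    · have : 0 < β.toReal ^ n := pow_pos β.pos n
      gcongr
    · rw [Function.iterate_add_apply, ← add_assoc, h4 y' hy' s' h0' h1']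
      by_cases hyy : y' = y
      · rw [hyy, hk]
      · have hy'' : y' ∈ insert x Q := by
          rw [Finset.mem_insert, Finset.mem_insert] at hy'
          rw [Finset.mem_insert]
          tauto
        rw [hn, Function.iterate_add_apply, hK y' hy'', iterate_mul_eq hper, hk']

/-- With Z = β^K s, the shift Z / β^n has grown to s after n − K steps, when the orbit of y is still
in P; the last K steps lead to x. -/
theorem exists_exclusive (hA : ∀ a ∈ T.A, a ∈ ZBeta β.toReal) (hW : T.PropertyW) :
    ∃ x, ∃ Z ∈ β.ring, 0 ≤ Z ∧ ∃ K : ℕ, ∀ n, K ≤ n → ∀ y ∈ T.P,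
      T.map^[n] (y + Z / β.toReal ^ n) = x := by
  obtain ⟨x, hx, s, hs, h0, h1, K, hK⟩ := exists_common_translation hA hW
  refine ⟨x, β.toReal ^ K * s, mul_mem (pow_mem β.toReal_mem_ring K) hs,
    mul_nonneg (pow_nonneg β.pos.le K) h0, K, fun n hn y hy => ?_⟩
  obtain ⟨j, rfl⟩ := Nat.exists_eq_add_of_le hn
  have h2 : β.toReal ^ K * s / β.toReal ^ (K + j) = s / β.toReal ^ j := by
    have := β.pos
    rw [pow_add]; field_simp
  rw [h2, Function.iterate_add_apply, iterate_add_div hA hy h0 h1, hK _ (iterate_mem_P hA hy j)]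

/-- The point `Φ(Z)` lies in one tile only. -/
theorem eq_of_Phi_eq_add_tailValue (hA : ∀ a ∈ T.A, a ∈ ZBeta β.toReal) {x Z : ℝ}
    (hZ : Z ∈ β.ring) (hZ0 : 0 ≤ Z) {K : ℕ}
    (hK : ∀ n, K ≤ n → ∀ y ∈ T.P, T.map^[n] (y + Z / β.toReal ^ n) = x)
    {ξ : ℝ} (hξ : ξ ∈ β.ring) {o : ℕ → ℝ} (ho : T.IsBackOrbit ξ o)
    (h : β.Phi Z = β.Phi ξ + T.tailValue o) : ξ = x := by
  obtain ⟨R, hR0, hR⟩ := T.exists_bound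
  obtain ⟨C, hC0, hC⟩ := exists_norm_M_pow_tailValue_le hA
  have hβ := β.pos
  -- Removing Z from the backward orbit of ξ leaves points of ℤ[β] for which Φ(y_n) is minus a tail
  -- value, hence bounded.
  set y : ℕ → ℝ := fun n => o n - Z / β.toReal ^ n with hy
  have hor : ∀ n, o n ∈ β.ring := fun n => by
    have h1 := mul_mem (pow_mem β.inv_mem_ring n) (add_mem (ho.sub_mem_ring hA n) hξ)
    rwa [sub_add_cancel, inv_pow, inv_mul_cancel_left₀ (pow_pos hβ n).ne'] at h1
  have hyr : ∀ n, y n ∈ β.ring := fun n => by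
    refine sub_mem (hor n) ?_
    rw [div_eq_mul_inv, ← inv_pow]
    exact mul_mem hZ (pow_mem β.inv_mem_ring n)
  have hinj : ∀ n : ℕ, Function.Injective (β.M ^ n) := fun n => by
    rw [Module.End.coe_pow]
    exact β.M_injective.iterate n
  have hPhi : ∀ n, β.Phi (y n) = -T.tailValue fun m => o (m + n) := fun n => by
    apply hinj n
    have h1 : β.toReal ^ n * y n = (β.toReal ^ n * o n - ξ) + ξ - Z := by
      rw [hy]; field_simp; ring
    have h2 := ho.sub_mem_ring hA n
    rw [β.M_pow_Phi (β.ring_subset_field (hyr n)), h1, β.Phi_sub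
      (β.ring_subset_field (add_mem h2 hξ)) (β.ring_subset_field hZ),
      β.Phi_add (β.ring_subset_field h2) (β.ring_subset_field hξ), h, ho.tailValue_eq hA n, map_neg]
    abel
  set Y := {x | x ∈ β.ring ∧ |x| ≤ max (R + Z) C ∧ ‖β.Phi x‖ ≤ max (R + Z) C} with hY
  have hYfin : Y.Finite := β.finite_ring_bounded _
  have hyY : ∀ n, y n ∈ Y := fun n => by
    refine ⟨hyr n, ?_, ?_⟩
    · refine le_trans ((abs_sub _ _).trans (add_le_add (hR _ (ho.2 n).1) ?_)) (le_max_left _ _)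
      rw [abs_of_nonneg (div_nonneg hZ0 (pow_nonneg hβ.le n))]
      exact div_le_self hZ0 (one_le_pow₀ β.one_lt.le)
    · rw [hPhi, norm_neg]
      refine le_trans ?_ (le_max_right _ _)
      simpa using hC _ _ (ho.shift n) 0
  -- Since Y is finite, the shift Z / β^n is eventually too small to change a digit of any y_n. So
  -- y_n becomes a backward orbit of T in a finite set, which lies in P.
  have hev : ∀ᶠ n in atTop, ∀ z ∈ Y, (z + Z / β.toReal ^ n ∈ T.X ↔ z ∈ T.X) ∧
      (z ∈ T.X → T.digit (z + Z / β.toReal ^ n) = T.digit z) := by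
    rw [eventually_all_finite hYfin]
    intro z _
    refine (((tendsto_add_div β z hZ0).eventually (T.eventually_right_mem_X z))).and ?_
    by_cases hz : z ∈ T.X
    · filter_upwards [(tendsto_add_div β z hZ0).eventually (T.eventually_right_digit hz)]
        with n hn _ using hn.2
    · exact Eventually.of_forall fun n h => absurd h hz
  obtain ⟨N, hN⟩ := eventually_atTop.1 hev
  have hyo : ∀ n, y n + Z / β.toReal ^ n = o n := fun n => sub_add_cancel _ _
  have hyX : ∀ n, N ≤ n → y n ∈ T.X ∧ T.digit (o n) = T.digit (y n) := fun n hn => by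
    have h1 := hN n hn (y n) (hyY n)
    rw [hyo] at h1
    exact ⟨h1.1.1 (ho.2 n).1, h1.2 (h1.1.1 (ho.2 n).1)⟩
  have hyT : ∀ n, N ≤ n → T.map (y (n + 1)) = y n := fun n hn => by
    rw [map, ← (hyX (n + 1) (by omega)).2]
    have h1 := (ho.2 n).2
    rw [map] at h1
    simp only [hy, ← h1, pow_succ]
    field_simp
    ring
  have hyP : ∀ n, N ≤ n → y n ∈ T.P := fun n hn => by
    obtain ⟨p, hp, hper⟩ := exists_iterate_eq_of_finite (f := T.map) (z := fun m => y (m + n)) hYfin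
      (fun m => hyY _) (fun m => by
        have := hyT (m + n) (by omega)
        rwa [Nat.add_right_comm] at this) 0
    rw [zero_add] at hper
    exact ⟨⟨hyr n, (hyX n hn).1⟩, p, hp, hper⟩
  have h1 := hK (max N K) (le_max_right _ _) _ (hyP (max N K) (le_max_left _ _))
  rw [hyo, ho.iterate_zero] at h1
  exact h1

/-- By compactness: counterexamples with t → 0 and h → Φ(Z) involve finitely many ξ, so ξ is
constant along an ultrafilter, and upper semicontinuity contradicts `eq_of_Phi_eq_add_tailValue`.
The condition t ≥ 0 is there because semicontinuity holds from the right. -/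
theorem exists_exclusive_nhds (hA : ∀ a ∈ T.A, a ∈ ZBeta β.toReal) (hW : T.PropertyW) :
    ∃ x, ∃ q ∈ β.H, ∃ δ > 0, ∀ t, 0 ≤ t → t < δ → ∀ h, ‖h - q‖ < δ → ∀ ξ ∈ β.ring, ∀ o,
      T.IsBackOrbit (t + ξ) o → h = β.Phi ξ + T.tailValue o → ξ = x := by
  obtain ⟨x, Z, hZ, hZ0, K, hK⟩ := exists_exclusive hA hW
  refine ⟨x, β.Phi Z, β.Phi_mem_H Z, ?_⟩
  by_contra! hcon
  obtain ⟨R, hR0, hR⟩ := T.exists_bound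
  obtain ⟨C, hC0, hC⟩ := exists_norm_M_pow_tailValue_le hA
  have hlim := tendsto_one_div_add_atTop_nhds_zero_nat (𝕜 := ℝ)
  choose t ht0 ht h hh ξ hξ o ho hhe hne using fun n : ℕ =>
    hcon (1 / ((n : ℝ) + 1)) Nat.one_div_pos_of_nat
  have hle : ∀ n : ℕ, 1 / ((n : ℝ) + 1) ≤ 1 := fun n => by
    rw [div_le_one (by positivity)]; linarith [n.cast_nonneg (α := ℝ)]
  set B := max (R + 1) (‖β.Phi Z‖ + 1 + C)
  have hfin := β.finite_ring_bounded B
  have hmem : ∀ n, ξ n ∈ {x | x ∈ β.ring ∧ |x| ≤ B ∧ ‖β.Phi x‖ ≤ B} := fun n => by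
    refine ⟨hξ n, le_trans ?_ (le_max_left _ _), le_trans ?_ (le_max_right _ _)⟩
    · have h1 := hR _ (ho n).mem
      rw [abs_le] at h1 ⊢
      constructor <;> linarith [h1.1, h1.2, ht n, ht0 n, hle n]
    · have h1 : β.Phi (ξ n) = β.Phi Z + (h n - β.Phi Z) - T.tailValue (o n) := by
        rw [hhe n]; abel
      have h2 : ‖T.tailValue (o n)‖ ≤ C := by simpa using hC _ _ (ho n) 0
      rw [h1]
      refine (norm_sub_le _ _).trans (add_le_add ((norm_add_le _ _).trans ?_) h2)
      linarith [hh n, hle n]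
  obtain ⟨η, ⟨hη, -, -⟩, hηe⟩ := (Ultrafilter.eventually_exists_mem_iff hfin
    (f := hyperfilter ℕ) (P := fun η n => ξ n = η)).1
    (Eventually.of_forall fun n => ⟨_, hmem n, rfl⟩)
  have htlim : Tendsto t (hyperfilter ℕ) (𝓝 0) :=
    (squeeze_zero ht0 (fun n => (ht n).le) hlim).mono_left Nat.hyperfilter_le_atTop
  have hhlim : Tendsto h (hyperfilter ℕ) (𝓝 (β.Phi Z)) := by
    rw [tendsto_iff_norm_sub_tendsto_zero]
    exact (squeeze_zero (fun _ => norm_nonneg _) (fun n => (hh n).le) hlim).mono_left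
      Nat.hyperfilter_le_atTop
  have hy : Tendsto (fun n => t n + η) (hyperfilter ℕ) (𝓝[≥] η) := by
    refine tendsto_nhdsWithin_iff.2 ⟨by simpa using htlim.add_const η, ?_⟩
    exact Eventually.of_forall fun n => le_add_of_nonneg_left (ht0 n)
  obtain ⟨o', ho', hlim'⟩ := exists_isBackOrbit_of_tendsto hA (hyperfilter ℕ) hy
    (o := o) (hηe.mono fun n hn => hn ▸ ho n)
  have h1 : Tendsto (fun n => T.tailValue (o n)) (hyperfilter ℕ) (𝓝 (β.Phi Z - β.Phi η)) := by
    refine (hhlim.sub_const (β.Phi η)).congr' (hηe.mono fun n hn => ?_)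
    rw [hhe n, hn, add_sub_cancel_left]
  have h2 := tendsto_nhds_unique hlim' h1
  have h3 := eq_of_Phi_eq_add_tailValue hA hZ hZ0 hK hη ho' (by rw [h2]; abel)
  obtain ⟨n, hn⟩ := hηe.exists
  exact hne n (hn.trans h3)

/-- Under property (W), the translates of `X̂` by `ℤ^d` overlap in a null set only. -/
theorem volume_overlap (hA : ∀ a ∈ T.A, a ∈ ZBeta β.toReal) (hW : T.PropertyW) :
    volume T.overlap = 0 := by
  obtain ⟨x, q, hq, δ, hδ, hx⟩ := exists_exclusive_nhds hA hW
  have hc1 := β.proj.continuous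
  have hc2 : Continuous fun p : Fin β.degree → ℝ => ‖β.proj p • β.v1 - p - q‖ := by fun_prop
  refine periodic_overlap.volume_eq_zero_of_isOpen (measurableSet_overlap hA)
    (ae_M_mem_overlap hA) (U := {p | 0 < β.proj p} ∩ {p | β.proj p < δ} ∩
      {p | ‖β.proj p • β.v1 - p - q‖ < δ})
    (((isOpen_lt continuous_const hc1).inter (isOpen_lt hc1 continuous_const)).inter
      (isOpen_lt hc2 continuous_const)) ⟨(δ / 2) • β.v1 - q, ?_⟩ ?_
  · have h1 : β.proj ((δ / 2) • β.v1 - q) = δ / 2 := by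
      rw [map_sub, map_smul, β.proj_v1, β.proj_of_mem_H hq]; simp
    simp only [Set.mem_inter_iff, Set.mem_ofPred_eq, h1]
    refine ⟨⟨by linarith, by linarith⟩, ?_⟩
    simpa using hδ
  · refine Set.disjoint_left.2 ?_
    rintro p ⟨m, n, hne, hm, hn⟩ ⟨⟨h1, h2⟩, h3⟩
    -- p + Ψ(ξ) ∈ X̂ means that the H-part of −p lies in the tile Φ(ξ) + 𝒟_{π(p)+ξ}; near q and for
    -- small heights only ξ = x is possible.
    have key : ∀ m, p + β.intVec m ∈ T.XHat → β.intVec m = β.Psi x := by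
      intro m hm
      obtain ⟨ξ, hξ, hξm⟩ := β.exists_Psi_eq_intVec m
      obtain ⟨o, ho, hp⟩ := (mem_XHat_iff_proj hA).1 hm
      rw [← hξm, map_add, β.proj_Psi] at ho hp
      have h4 : β.proj p • β.v1 - p = β.Phi ξ + T.tailValue o := by
        rw [PisotUnit.Psi, add_smul] at hp
        rw [sub_eq_iff_eq_add, ← sub_eq_zero]
        rw [← sub_eq_zero] at hp
        rw [← neg_eq_zero, ← hp]
        abel
      rw [← hξm, hx _ h1.le h2 _ h3 ξ hξ o ho h4]
    exact hne (β.intVec_injective ((key m hm).trans (key n hn).symm))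

/-! ### Left limits, the set 𝒱 and lower semicontinuity of 𝒟_x -/

theorem eventually_left_mem_Xa {p a : ℝ} (hp : p ∈ T.XaLeft a) : ∀ᶠ q in 𝓝[<] p, q ∈ T.Xa a := by
  simp only [XaLeft, Set.mem_iUnion] at hp
  obtain ⟨i, hi, h1, h2⟩ := hp
  filter_upwards [self_mem_nhdsWithin, mem_nhdsWithin_of_mem_nhds (lt_mem_nhds h1)] with q hq hq'
  exact Set.mem_biUnion (Finset.mem_coe.2 hi) ⟨le_of_lt hq', lt_of_lt_of_le hq h2⟩

theorem mem_XaLeft_of_frequently {p a : ℝ} (hp : ∃ᶠ q in 𝓝[<] p, q ∈ T.Xa a) :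
    p ∈ T.XaLeft a := by
  by_contra hn
  refine hp ?_
  have h : ∀ᶠ q in 𝓝[<] p, ∀ i ∈ T.endpoints a, q ∉ Set.Ico i.1 i.2 := by
    rw [eventually_all_finset]
    intro i hi
    have h1 : p ∉ Set.Ioc i.1 i.2 := fun h => hn (Set.mem_biUnion (Finset.mem_coe.2 hi) h)
    by_cases h2 : i.1 < p
    · have h3 : i.2 < p := not_le.1 fun h => h1 ⟨h2, h⟩
      filter_upwards [mem_nhdsWithin_of_mem_nhds (lt_mem_nhds h3)] with q hq hq'
      exact lt_asymm hq hq'.2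
    · filter_upwards [self_mem_nhdsWithin] with q hq hq'
      exact h2 (lt_of_le_of_lt hq'.1 hq)
  filter_upwards [h] with q hq
  simp only [Xa, Set.mem_iUnion, not_exists]
  exact hq

theorem mem_XLeft {p : ℝ} : p ∈ T.XLeft ↔ ∃ a ∈ T.A, p ∈ T.XaLeft a := by
  simp [XLeft]

theorem mem_XLeft_of_eventually {p : ℝ} (hp : ∀ᶠ q in 𝓝[<] p, q ∈ T.X) : p ∈ T.XLeft := by
  by_contra hn
  have h : ∀ᶠ q in 𝓝[<] p, ∀ a ∈ T.A, q ∉ T.Xa a := by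
    rw [eventually_all_finset]
    intro a ha
    by_contra h
    refine hn (mem_XLeft.2 ⟨a, ha, mem_XaLeft_of_frequently fun h' => h h'⟩)
  obtain ⟨q, h1, h2⟩ := (hp.and h).exists
  obtain ⟨a, ha, h3⟩ := T.mem_X.1 h1
  exact h2 a ha h3

theorem eventually_left_digit {p : ℝ} (hp : p ∈ T.XLeft) :
    ∀ᶠ q in 𝓝[<] p, q ∈ T.X ∧ T.digit q = T.digitLeft p := by
  have h := mem_XLeft.1 hp
  have h1 : T.digitLeft p = h.choose := by rw [digitLeft, dif_pos h]
  filter_upwards [eventually_left_mem_Xa h.choose_spec.2] with q hq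
  exact ⟨T.mem_X.2 ⟨_, h.choose_spec.1, hq⟩, by rw [h1, T.digit_eq h.choose_spec.1 hq]⟩

theorem tendsto_affine_left {p c s : ℝ} (hs : 0 < s) :
    Tendsto (fun q => c + s * (q - p)) (𝓝[<] p) (𝓝[<] c) := by
  refine tendsto_nhdsWithin_iff.2 ⟨?_, ?_⟩
  · have : Continuous fun q => c + s * (q - p) := by fun_prop
    exact (this.tendsto' p c (by simp)).mono_left nhdsWithin_le_nhds
  · filter_upwards [self_mem_nhdsWithin] with q hq
    exact add_lt_of_neg_right c (mul_neg_of_pos_of_neg hs (sub_neg.2 hq))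

/-- T̃^n p is the left limit of T^n at p. Every point just left of it is T^n of a point of X just
left of p, so it is approached from the left by X and belongs to X̃. -/
theorem iterate_mapLeft {p : ℝ} (hp : p ∈ T.XLeft) (n : ℕ) : T.mapLeft^[n] p ∈ T.XLeft ∧
    ∀ᶠ q in 𝓝[<] p, T.map^[n] q = T.mapLeft^[n] p + β.toReal ^ n * (q - p) := by
  induction n with
  | zero => exact ⟨hp, by simp⟩
  | succ n ih =>
    obtain ⟨h1, h2⟩ := ih
    have h3 : ∀ᶠ q in 𝓝[<] p,
        T.map^[n + 1] q = T.mapLeft^[n + 1] p + β.toReal ^ (n + 1) * (q - p) := by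
      filter_upwards [h2, (tendsto_affine_left (pow_pos β.pos n)).eventually
        (eventually_left_digit h1)] with q hq hq'
      rw [Function.iterate_succ_apply', Function.iterate_succ_apply', map, mapLeft, hq, hq'.2]
      ring
    refine ⟨mem_XLeft_of_eventually ?_, h3⟩
    have h4 : Tendsto (fun r => p + (β.toReal ^ (n + 1))⁻¹ * (r - T.mapLeft^[n + 1] p))
        (𝓝[<] (T.mapLeft^[n + 1] p)) (𝓝[<] p) :=
      tendsto_affine_left (inv_pos.2 (pow_pos β.pos _))
    filter_upwards [h4.eventually (h3.and (eventually_left_digit hp))] with r hr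
    have h5 := hr.1
    have h6 := pow_pos β.pos (n + 1)
    rw [add_sub_cancel_left, mul_inv_cancel_left₀ h6.ne', add_sub_cancel] at h5
    rw [← h5]
    exact T.iterate_mem hr.2.1 _

theorem finite_XLeft_diff_X : (T.XLeft \ T.X).Finite := by
  refine (Set.Finite.biUnion T.A.finite_toSet fun a _ =>
    (T.endpoints a).finite_toSet.image Prod.snd).subset ?_
  rintro p ⟨hp, hpX⟩
  obtain ⟨a, ha, hp⟩ := mem_XLeft.1 hp
  simp only [XaLeft, Set.mem_iUnion] at hp
  obtain ⟨i, hi, h1, h2⟩ := hp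
  refine Set.mem_biUnion (Finset.mem_coe.2 ha) ⟨i, hi, le_antisymm (not_lt.1 fun h => hpX ?_) h2⟩
  exact T.mem_X.2 ⟨a, ha, Set.mem_biUnion (Finset.mem_coe.2 hi) ⟨h1.le, h⟩⟩

theorem lt_mergeTime {x : ℝ} {k : ℕ}
    (h : ∀ m, 1 ≤ m → m ≤ k → T.mapLeft^[m] x ≠ T.map^[m] x) : (k : ℕ∞) < T.mergeTime x := by
  have h1 : ((k + 1 : ℕ) : ℕ∞) ≤ T.mergeTime x := by
    refine le_iInf₂ fun m hm => Nat.cast_le.2 ?_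
    by_contra hlt
    exact h m hm.1 (by omega) hm.2
  exact lt_of_lt_of_le (by exact_mod_cast k.lt_succ_self) h1

/-- Let i ≤ N be the last time at which the T- and T̃-orbits of p agree. Then T^i p lies in X ∩ X̃
and its merging time exceeds N − i. -/
theorem mapLeft_iterate_mem_V {p : ℝ} {N : ℕ} (hp : p ∈ T.X) (hp' : p ∈ T.XLeft)
    (hne : T.mapLeft^[N] p ≠ T.map^[N] p) (hX : T.mapLeft^[N] p ∈ T.X) :
    T.mapLeft^[N] p ∈ T.V := by
  classical
  set i := Nat.findGreatest (fun i => T.mapLeft^[i] p = T.map^[i] p) N with hi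
  have h1 : T.mapLeft^[i] p = T.map^[i] p :=
    Nat.findGreatest_spec (P := fun i => T.mapLeft^[i] p = T.map^[i] p) (Nat.zero_le N) rfl
  have h2 : i ≤ N := Nat.findGreatest_le N
  have h3 : i ≠ N := fun h => hne (h ▸ h1)
  have hit : ∀ m, T.mapLeft^[m] (T.map^[i] p) = T.mapLeft^[m + i] p := fun m => by
    rw [Function.iterate_add_apply, h1]
  have hk : (((N - i : ℕ)) : ℕ∞) < T.mergeTime (T.map^[i] p) := by
    refine lt_mergeTime fun m hm hmk => ?_
    rw [hit, ← Function.iterate_add_apply]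
    exact Nat.findGreatest_is_greatest (P := fun i => T.mapLeft^[i] p = T.map^[i] p)
      (n := N) (k := m + i) (by omega) (by omega)
  refine Or.inr (Set.mem_biUnion (x := T.map^[i] p) ⟨T.iterate_mem hp i, h1 ▸
    (iterate_mapLeft hp' i).1⟩ (Set.mem_iUnion₂.2 ⟨N - i, ⟨by omega, hk⟩, ?_, hX⟩))
  right
  rw [Set.mem_singleton_iff, hit, Nat.sub_add_cancel h2]

/-- The first obstruction to translating a branch of `T^N` to the right lies outside `X`. -/
theorem exists_first_exit {x y : ℝ} {o : ℕ → ℝ} (ho : T.IsBackOrbit x o) (hxy : x < y)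
    (hX : Set.Ioc x y ⊆ T.X) (hV : Disjoint (Set.Ioc x y) T.V) (N : ℕ)
    (hbad : ¬ (o N + (y - x) / β.toReal ^ N ∈ T.X ∧
      T.map^[N] (o N + (y - x) / β.toReal ^ N) = y)) :
    ∃ p ∈ T.XLeft \ T.X, o N < p ∧ p ≤ o N + (y - x) / β.toReal ^ N ∧
      T.mapLeft^[N] p ∈ Set.Ioc x y := by
  have hpos := pow_pos β.pos N
  set yN := o N + (y - x) / β.toReal ^ N with hyN
  have hlt : o N < yN := lt_add_of_pos_right _ (div_pos (sub_pos.2 hxy) hpos)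
  have hval : x + β.toReal ^ N * (yN - o N) = y := by rw [hyN]; field_simp; ring
  -- At a good s, the affine branch of T^N through o_N is still valid.
  let good : ℝ → Prop := fun s => s ∈ T.X ∧ T.map^[N] s = x + β.toReal ^ N * (s - o N)
  have hgo : good (o N) := ⟨(ho.2 N).1, by rw [ho.iterate_zero]; ring⟩
  have hright : ∀ s, good s → ∀ᶠ r in 𝓝[≥] s, good r := fun s hs => by
    filter_upwards [T.eventually_right_iterate hs.1 N, T.eventually_right_digit hs.1] with r h1 h2
    exact ⟨h2.1, by rw [h1.2.2, hs.2]; ring⟩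
  let B : Set ℝ := {s | o N ≤ s ∧ s ≤ yN ∧ ¬ good s}
  have hBne : B.Nonempty := ⟨yN, hlt.le, le_rfl, fun h => hbad ⟨h.1, by rw [h.2, hval]⟩⟩
  have hBbd : BddBelow B := ⟨o N, fun s hs => hs.1⟩
  set p := sInf B with hp
  have hp1 : o N ≤ p := le_csInf hBne fun s hs => hs.1
  have hp2 : p ≤ yN := by
    obtain ⟨s, hs⟩ := hBne
    exact (csInf_le hBbd hs).trans hs.2.1
  have hbelow : ∀ s, o N ≤ s → s < p → good s := fun s h1 h2 => by
    by_contra h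
    exact absurd (csInf_le hBbd ⟨h1, h2.le.trans hp2, h⟩) (not_le.2 h2)
  -- Goodness persists to the right, so the infimum of the bad points is itself bad; the points to
  -- its left down to o_N are good, so T̃^N p has the affine value.
  have hpbad : ¬ good p := fun h => by
    obtain ⟨u, hu, h1⟩ := mem_nhdsGE_iff_exists_Ico_subset.1 (hright p h)
    refine absurd (le_csInf hBne fun s hs => ?_) (not_le.2 hu)
    by_contra hsu
    exact hs.2.2 (h1 ⟨csInf_le hBbd hs, not_le.1 hsu⟩)
  have hp3 : o N < p := lt_of_le_of_ne hp1 fun h => hpbad (h ▸ hgo)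
  have hleft : ∀ᶠ q in 𝓝[<] p, good q := by
    filter_upwards [self_mem_nhdsWithin, mem_nhdsWithin_of_mem_nhds (lt_mem_nhds hp3)] with q h1 h2
    exact hbelow q (le_of_lt h2) h1
  have hpL : p ∈ T.XLeft := mem_XLeft_of_eventually (hleft.mono fun q h => h.1)
  have hpT : T.mapLeft^[N] p = x + β.toReal ^ N * (p - o N) := by
    obtain ⟨q, h1, h2⟩ := (hleft.and (iterate_mapLeft hpL N).2).exists
    have := h1.2.symm.trans h2
    linarith
  have hpIoc : T.mapLeft^[N] p ∈ Set.Ioc x y := by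
    rw [hpT]
    refine ⟨lt_add_of_pos_right _ (mul_pos hpos (sub_pos.2 hp3)), ?_⟩
    rw [← hval]
    gcongr
  refine ⟨p, ⟨hpL, fun hpX => ?_⟩, hp3, hp2, hpIoc⟩
  refine Set.disjoint_left.1 hV hpIoc (mapLeft_iterate_mem_V hpX hpL (fun h => hpbad ⟨hpX, ?_⟩)
    (hX hpIoc))
  rw [← h, hpT]

/-- A branch of the backward orbits of `x` can be translated to a nearby `y > x` at infinitely
many levels. -/
theorem frequently_translate {x y : ℝ} {o : ℕ → ℝ} (ho : T.IsBackOrbit x o) (hxy : x < y)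
    (hX : Set.Ioc x y ⊆ T.X) (hV : Disjoint (Set.Ioc x y) T.V) :
    ∃ᶠ N in atTop, o N + (y - x) / β.toReal ^ N ∈ T.X ∧
      T.map^[N] (o N + (y - x) / β.toReal ^ N) = y := by
  intro hbad
  have hyx : 0 ≤ y - x := sub_nonneg.2 hxy.le
  have hex : ∀ᶠ N in atTop, ∃ p ∈ T.XLeft \ T.X, o N < p ∧
      p ≤ o N + (y - x) / β.toReal ^ N ∧ T.mapLeft^[N] p ∈ Set.Ioc x y :=
    hbad.mono fun N hN => exists_first_exit ho hxy hX hV N hN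
  have hE := T.finite_XLeft_diff_X
  have hlim : Tendsto (fun N : ℕ => (y - x) / β.toReal ^ N) atTop (𝓝 0) :=
    (tendsto_pow_atTop_atTop_of_one_lt β.one_lt).const_div_atTop _
  have hdig : ∀ᶠ N in atTop, ∀ e ∈ T.XLeft \ T.X, ∀ s, s < e → e ≤ s + (y - x) / β.toReal ^ N →
      T.digit s = T.digitLeft e := by
    rw [eventually_all_finite hE]
    intro e he
    obtain ⟨l, hl, h1⟩ := mem_nhdsLT_iff_exists_Ioo_subset.1 (eventually_left_digit he.1)
    filter_upwards [hlim.eventually (gt_mem_nhds (sub_pos.2 hl))] with N hN s hs hs'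
    exact (h1 ⟨by linarith, hs⟩).2
  -- X̃ ∖ X is finite, so once (y − x) / β^N is below all nonzero distances, closeness of T̃ p_{N+1}
  -- to p_N forces equality.
  have hsep : ∀ᶠ N : ℕ in atTop, ∀ e ∈ T.XLeft \ T.X, ∀ e' ∈ T.XLeft \ T.X,
      |T.mapLeft e - e'| ≤ (y - x) / β.toReal ^ N → T.mapLeft e = e' := by
    rw [eventually_all_finite hE]
    intro e _
    rw [eventually_all_finite hE]
    intro e' _
    by_cases h : T.mapLeft e = e'
    · exact Eventually.of_forall fun _ _ => h
    · filter_upwards [hlim.eventually (gt_mem_nhds (abs_pos.2 (sub_ne_zero.2 h)))] with N hN hN'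
      exact absurd hN' (not_le.2 hN)
  obtain ⟨N0, hN0⟩ := eventually_atTop.1 (hex.and (hdig.and hsep))
  choose! p hpE hp1 hp2 hp3 using fun N hN => (hN0 N hN).1
  have hstep : ∀ N, N0 ≤ N → T.mapLeft (p (N + 1)) = p N := fun N hN => by
    have hN' : N0 ≤ N + 1 := by omega
    refine (hN0 N hN).2.2 _ (hpE _ hN') _ (hpE _ hN) ?_
    have h1 := (hN0 (N + 1) hN').2.1 _ (hpE _ hN') _ (hp1 _ hN') (hp2 _ hN')
    have h2 : T.mapLeft (p (N + 1)) - o N = β.toReal * (p (N + 1) - o (N + 1)) := by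
      rw [← (ho.2 N).2, map, mapLeft, h1]; ring
    have h3 : β.toReal * (p (N + 1) - o (N + 1)) ≤ (y - x) / β.toReal ^ N := by
      have h4 : p (N + 1) - o (N + 1) ≤ (y - x) / β.toReal ^ (N + 1) := by
        linarith [hp2 _ hN']
      refine (mul_le_mul_of_nonneg_left h4 β.pos.le).trans (le_of_eq ?_)
      have := β.pos
      rw [pow_succ]; field_simp
    have h5 := mul_pos β.pos (sub_pos.2 (hp1 _ hN'))
    rw [abs_le]
    constructor <;> linarith [hp1 _ hN, hp2 _ hN]
  have hrange : Set.range (fun n => p (n + N0)) ⊆ T.XLeft \ T.X := by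
    rintro _ ⟨n, rfl⟩
    exact hpE _ (by omega)
  -- The exit points form a backward T̃-orbit in X̃ ∖ X, hence their forward orbits stay in X̃ ∖ X;
  -- but the N0-th iterate of p N0 lies in (x, y] ⊆ X.
  have h1 := iterate_mem_range_of_finite (hE.subset hrange) (f := T.mapLeft) (fun n => by
    have := hstep (n + N0) (by omega)
    rwa [Nat.add_right_comm] at this) N0
  rw [zero_add] at h1
  exact (hrange h1).2 (hX (hp3 N0 le_rfl))

/-- The sets `𝒟_x` are lower semicontinuous from the right if `𝒱` is finite. -/
theorem eventually_right_D_subset (hA : ∀ a ∈ T.A, a ∈ ZBeta β.toReal) (hV : T.V.Finite) {x : ℝ}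
    (hx : x ∈ T.X) : ∀ᶠ y in 𝓝[≥] x, T.D x ⊆ T.D y := by
  -- The point x may itself belong to 𝒱; only (x, y] has to avoid it.
  have h1 : ∀ᶠ y in 𝓝[≥] x, y ∈ T.X ∧ y ∉ T.V \ {x} := by
    have h2 : (T.V \ {x})ᶜ ∈ 𝓝 x := (hV.subset Set.sdiff_subset).isClosed.isOpen_compl.mem_nhds
      (by simp)
    filter_upwards [T.eventually_right_mem_X x, mem_nhdsWithin_of_mem_nhds h2] with y h3 h4
    exact ⟨h3.2 hx, h4⟩
  obtain ⟨u, hu, h2⟩ := mem_nhdsGE_iff_exists_Ico_subset.1 h1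
  filter_upwards [self_mem_nhdsWithin, mem_nhdsWithin_of_mem_nhds (gt_mem_nhds hu)] with y hxy hyu
  rcases (Set.mem_Ici.1 hxy).eq_or_lt with rfl | hxy
  · exact subset_rfl
  have hsub : ∀ s ∈ Set.Ioc x y, s ∈ T.X ∧ s ∉ T.V := fun s hs => by
    have := h2 ⟨hs.1.le, lt_of_le_of_lt hs.2 hyu⟩
    exact ⟨this.1, fun h => this.2 ⟨h, hs.1.ne'⟩⟩
  intro v hv
  obtain ⟨o, ho, rfl⟩ := (mem_D_iff hx).1 hv
  have hfr := frequently_translate ho hxy (fun s hs => (hsub s hs).1)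
    (Set.disjoint_left.2 fun s hs => (hsub s hs).2)
  choose N hN hNX hNT using fun n => frequently_atTop.1 hfr n
  choose o' ho' hoN using fun n => T.exists_isBackOrbit_apply (hNX n) (N n)
  simp only [hNT] at ho'
  obtain ⟨C, hC0, hC⟩ := exists_norm_M_pow_tailValue_le hA
  obtain ⟨o'', h3, h4⟩ := exists_isBackOrbit_of_tendsto hA (hyperfilter ℕ) (x := y)
    (y := fun _ => y) (o := o') (tendsto_nhdsWithin_iff.2 ⟨tendsto_const_nhds, by simp⟩)
    (Eventually.of_forall ho')
  refine (mem_D_iff (hsub y ⟨hxy, le_rfl⟩).1).2 ⟨o'', h3, tendsto_nhds_unique h4 ?_⟩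
  refine Tendsto.mono_left ?_ Nat.hyperfilter_le_atTop
  rw [tendsto_iff_norm_sub_tendsto_zero]
  refine squeeze_zero (fun _ => norm_nonneg _) (fun n => ?_) (β.tendsto_rho_pow (2 * C))
  -- The translated and the original orbit contribute the same element of ℤ[β] up to level N n, so
  -- their tail values differ by at most 2Cρ^{N n}.
  have h5 : β.toReal ^ N n * o' n (N n) - y = β.toReal ^ N n * o (N n) - x := by
    have := pow_pos β.pos (N n)
    rw [hoN]; field_simp; ring
  rw [(ho' n).tailValue_eq hA (N n), ho.tailValue_eq hA (N n), h5, add_sub_add_left_eq_sub]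
  refine (norm_sub_le _ _).trans ((add_le_add (hC _ _ ((ho' n).shift (N n)) (N n))
    (hC _ _ (ho.shift (N n)) (N n))).trans ?_)
  have h6 : β.rho ^ N n ≤ β.rho ^ n := pow_le_pow_of_le_one β.rho_pos.le β.rho_lt_one.le (hN n)
  nlinarith

end BetaTransformation

/-! ### Local structure of X̂ to the right of a point -/

namespace PisotUnit

variable (β : PisotUnit)

theorem volume_preimage_M_pow (n : ℕ) (s : Set (Fin β.degree → ℝ)) :
    volume ((β.M ^ n) ⁻¹' s) = volume s := by
  induction n with
  | zero => simp
  | succ n ih =>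
    rw [pow_succ, Module.End.coe_mul, Set.preimage_comp, volume_preimage_M, ih]

theorem proj_M_pow (n : ℕ) (y : Fin β.degree → ℝ) :
    β.proj ((β.M ^ n) y) = β.toReal ^ n * β.proj y := by
  induction n with
  | zero => simp
  | succ n ih => rw [pow_succ', Module.End.mul_apply, proj_M, ih, pow_succ', mul_assoc]

end PisotUnit

namespace BetaTransformation

variable {β : PisotUnit} {T : BetaTransformation β.toReal}

/-- The iterates of the natural extension map are affine near a given point, from the right. -/
theorem exists_eventually_M_pow_sub_mem (hA : ∀ a ∈ T.A, a ∈ ZBeta β.toReal) {x : ℝ}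
    (hx : x ∈ T.X) (n : ℕ) : ∃ m, ∀ᶠ t in 𝓝[≥] x, ∀ y ∈ T.XHat, β.proj y = t →
      (β.M ^ n) y - β.intVec m ∈ T.XHat ∧
      β.proj ((β.M ^ n) y - β.intVec m) = T.map^[n] t := by
  induction n with
  | zero =>
    refine ⟨0, Eventually.of_forall ?_⟩
    rintro t y hy rfl
    have h0 : β.intVec 0 = 0 := by ext; simp [PisotUnit.intVec]
    simp [h0, hy]
  | succ n ih =>
    obtain ⟨m, hm⟩ := ih
    obtain ⟨k, hk⟩ := β.exists_intVec_eq_Psi (digit_mem_ring hA (T.iterate_mem hx n))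
    refine ⟨β.companionInt.mulVec m + k, ?_⟩
    filter_upwards [hm, T.eventually_right_iterate hx n] with t h1 h2 y hy hyt
    obtain ⟨h3, h4⟩ := h1 y hy hyt
    have h5 := M_sub_Psi_mem_XHat hA h3
    have h6 : β.M ((β.M ^ n) y - β.intVec m) - β.Psi (T.digit (T.map^[n] t)) =
        (β.M ^ (n + 1)) y - β.intVec (β.companionInt.mulVec m + k) := by
      rw [h2.2.1, hk, map_sub, β.M_intVec, β.intVec_add, pow_succ', Module.End.mul_apply]
      abel
    rw [h4, h6] at h5
    refine ⟨h5, ?_⟩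
    rw [← h6, map_sub, β.proj_M, β.proj_Psi, h4, Function.iterate_succ_apply', map]

/-- A point of X slightly to the right of c lies in the support of μ and has (c, c + δ) as a
neighbourhood. -/
theorem volume_XHat_inter_pos (hsupp : T.mu.support = closure T.X) {c : ℝ} (hc : c ∈ T.X)
    {δ : ℝ} (hδ : 0 < δ) : 0 < volume {y | y ∈ T.XHat ∧ c < β.proj y ∧ β.proj y < c + δ} := by
  obtain ⟨u, hu, h1⟩ := mem_nhdsGE_iff_exists_Ico_subset.1 (T.eventually_right_mem_X c)
  have hu' : 0 < min δ (u - c) := lt_min hδ (sub_pos.2 hu)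
  have h2 : c + min δ (u - c) / 2 ∈ T.mu.support := by
    rw [hsupp]
    refine subset_closure ((h1 ⟨by linarith, ?_⟩).2 hc)
    linarith [min_le_right δ (u - c)]
  have h3 : Set.Ioo c (c + δ) ∈ 𝓝 (c + min δ (u - c) / 2) :=
    Ioo_mem_nhds (by linarith) (by linarith [min_le_left δ (u - c)])
  have h4 := (Measure.mem_support_iff_forall _).1 h2 _ h3
  have hp : Measurable β.pi1 := by
    rw [funext β.pi1_eq]
    exact β.proj.continuous.measurable
  rw [mu, Measure.map_apply hp measurableSet_Ioo,
    Measure.restrict_apply (hp measurableSet_Ioo)] at h4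
  refine h4.trans_le (measure_mono ?_)
  rintro y ⟨hy1, hy2⟩
  rw [Set.mem_preimage, β.pi1_eq] at hy1
  exact ⟨hy2, hy1.1, hy1.2⟩

/-- Every point of `X̂` is, from the right, a limit of parts of `X̂` of positive measure. -/
theorem volume_XHat_inter_ball_pos (hA : ∀ a ∈ T.A, a ∈ ZBeta β.toReal)
    (hsupp : T.mu.support = closure T.X) {z : Fin β.degree → ℝ} (hz : z ∈ T.XHat) {r : ℝ}
    (hr : 0 < r) :
    0 < volume {q | q ∈ T.XHat ∧ β.proj z ≤ β.proj q ∧ ‖q - z‖ < r} := by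
  obtain ⟨C, hC0, hC⟩ := exists_norm_M_pow_tailValue_le hA
  obtain ⟨o, ho, hzo⟩ := (mem_XHat_iff_proj hA).1 hz
  obtain ⟨N, hN⟩ := ((β.tendsto_rho_pow (2 * C)).eventually (gt_mem_nhds (half_pos hr))).exists
  have hpos := pow_pos β.pos N
  obtain ⟨m, hm⟩ := exists_eventually_M_pow_sub_mem hA (ho.2 N).1 N
  set zN := o N • β.v1 - T.tailValue fun n => o (n + N) with hzN
  have hzNX : zN ∈ T.XHat := mem_XHat_iff.2 ⟨_, _, ho.shift N, rfl⟩
  have hzNp : β.proj zN = o N := proj_sub_tailValue hA (ho.shift N)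
  have hm0 := (hm.self_of_nhdsWithin Set.self_mem_Ici zN hzNX hzNp).2
  rw [ho.iterate_zero, map_sub, β.proj_M_pow, hzNp] at hm0
  -- An integer vector is determined by its projection, because π(Ψ(ξ)) = ξ. It follows that T̂^N
  -- carries zN to z.
  have hmΨ : β.intVec m = β.Psi (β.toReal ^ N * o N - β.proj z) := by
    obtain ⟨ξ, -, hξ⟩ := β.exists_Psi_eq_intVec m
    rw [← hξ, β.proj_Psi] at hm0
    rw [← hξ]
    congr 1
    linarith
  have hz' : (β.M ^ N) zN - β.intVec m = z := by
    rw [hmΨ, hzN, map_sub, map_smul, β.M_pow_v1]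
    nth_rw 2 [hzo]
    rw [ho.tailValue_eq hA N, PisotUnit.Psi, sub_smul, smul_smul, mul_comm (o N)]
    abel
  obtain ⟨u, hu, h1⟩ := mem_nhdsGE_iff_exists_Ico_subset.1 hm
  have hV : 0 < β.toReal ^ N * (‖β.v1‖ + 1) := mul_pos hpos (by positivity)
  -- The first bound keeps π(q) where the same m applies. The second keeps the v_1-part, stretched
  -- by β^N, within r/2; the H-part is below r/2 by the choice of N.
  set δ := min (u - o N) (r / 2 / (β.toReal ^ N * (‖β.v1‖ + 1))) with hδ
  have hδ0 : 0 < δ := lt_min (sub_pos.2 hu) (div_pos (half_pos hr) hV)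
  have hδ1 : δ * (β.toReal ^ N * (‖β.v1‖ + 1)) ≤ r / 2 := by
    rw [← le_div_iff₀ hV]
    exact min_le_right _ _
  have hδ2 : δ ≤ u - o N := min_le_left _ _
  refine (volume_XHat_inter_pos hsupp (ho.2 N).1 hδ0).trans_le ?_
  set S := {q | q ∈ T.XHat ∧ β.proj z ≤ β.proj q ∧ ‖q - z‖ < r} with hS
  have hvol : volume ((β.M ^ N) ⁻¹' ((fun q => q + -β.intVec m) ⁻¹' S)) = volume S := by
    rw [β.volume_preimage_M_pow, measure_preimage_add_right]
  rw [← hvol]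
  refine measure_mono ?_
  rintro q ⟨hq, hq1, hq2⟩
  change (β.M ^ N) q + -β.intVec m ∈ S
  rw [← sub_eq_add_neg]
  obtain ⟨h2, -⟩ := h1 (⟨hq1.le, by linarith⟩ : β.proj q ∈ Set.Ico (o N) u) q hq rfl
  have h3 : (β.M ^ N) q - β.intVec m - z = (β.M ^ N) (q - zN) := by
    rw [← hz', map_sub _ q zN]; abel
  refine ⟨h2, ?_, ?_⟩
  · have h4 : β.proj ((β.M ^ N) q - β.intVec m) - β.proj z =
        β.toReal ^ N * (β.proj q - o N) := by
      rw [← map_sub, h3, β.proj_M_pow, map_sub, hzNp]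
    have := mul_pos hpos (sub_pos.2 hq1)
    linarith
  · obtain ⟨o', ho', hqo⟩ := (mem_XHat_iff_proj hA).1 hq
    have h4 : (β.M ^ N) (q - zN) = (β.toReal ^ N * (β.proj q - o N)) • β.v1 +
        ((β.M ^ N) (T.tailValue fun n => o (n + N)) - (β.M ^ N) (T.tailValue o')) := by
      nth_rw 1 [hqo]
      rw [hzN]
      simp only [map_sub, map_smul, β.M_pow_v1, smul_smul, mul_sub, sub_smul]
      rw [mul_comm (β.proj q), mul_comm (o N)]
      abel
    rw [h3, h4]
    refine lt_of_le_of_lt (norm_add_le _ _) ?_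
    have h5 : ‖(β.toReal ^ N * (β.proj q - o N)) • β.v1‖ ≤ r / 2 := by
      rw [norm_smul, Real.norm_of_nonneg (mul_nonneg hpos.le (by linarith))]
      refine le_trans ?_ hδ1
      have h6 : β.proj q - o N ≤ δ := by linarith
      have h7 : ‖β.v1‖ ≤ ‖β.v1‖ + 1 := by linarith
      calc β.toReal ^ N * (β.proj q - o N) * ‖β.v1‖
          ≤ β.toReal ^ N * δ * (‖β.v1‖ + 1) := by gcongr
        _ = δ * (β.toReal ^ N * (‖β.v1‖ + 1)) := by ring
    have h6 := (norm_sub_le ((β.M ^ N) (T.tailValue fun n => o (n + N)))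
      ((β.M ^ N) (T.tailValue o'))).trans (add_le_add (hC _ _ (ho.shift N) N) (hC _ _ ho' N))
    linarith

/-- If `𝒟_x` contains a neighbourhood of `0` in `H`, then `X̂` contains a neighbourhood of `x v_1`
in the half-space to its right. -/
theorem eventually_mem_XHat (hA : ∀ a ∈ T.A, a ∈ ZBeta β.toReal) (hV : T.V.Finite) {x : ℝ}
    (hx : x ∈ T.X)
    (hinner : (0 : β.H) ∈ interior {y : β.H | (y : Fin β.degree → ℝ) ∈ T.D x}) :
    ∀ᶠ w in 𝓝[{w | x ≤ β.proj w}] (x • β.v1), w ∈ T.XHat := by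
  -- The sign is negative because the slice of X̂ at height t is t v_1 − 𝒟_t.
  let g : (Fin β.degree → ℝ) → β.H := fun w => -⟨w - β.proj w • β.v1, β.sub_proj_mem_H w⟩
  have hp : β.proj (x • β.v1) = x := by rw [map_smul, β.proj_v1]; simp
  have hg0 : g (x • β.v1) = 0 := by
    apply Subtype.ext
    simp [g, hp]
  have hc := β.proj.continuous
  have hgc : Continuous g := (Continuous.subtype_mk (by fun_prop) _).neg
  have h1 : ∀ᶠ w in 𝓝 (x • β.v1), ((g w : β.H) : Fin β.degree → ℝ) ∈ T.D x := by
    have h := mem_interior_iff_mem_nhds.1 hinner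
    exact (hgc.tendsto' _ _ hg0).eventually h
  have h2 : Tendsto β.proj (𝓝[{w | x ≤ β.proj w}] (x • β.v1)) (𝓝[≥] x) := by
    refine tendsto_nhdsWithin_iff.2 ⟨(hc.tendsto' _ _ hp).mono_left nhdsWithin_le_nhds, ?_⟩
    exact self_mem_nhdsWithin
  filter_upwards [mem_nhdsWithin_of_mem_nhds h1,
    h2.eventually ((eventually_right_D_subset hA hV hx).and (T.eventually_right_mem_X x))]
    with w hw1 hw2
  obtain ⟨o, ho, hw⟩ := (mem_D_iff (hw2.2.2 hx)).1 (hw2.1 hw1)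
  refine (mem_XHat_iff_proj hA).2 ⟨o, ho, ?_⟩
  rw [hw]
  simp [g]

end BetaTransformation

theorem mainTheorem9 (β : PisotUnit) (T : BetaTransformation β.toReal)
    (hA : ∀ a ∈ T.A, a ∈ ZBeta β.toReal)
    (hsupp : T.mu.support = closure T.X)
    (hV : T.V.Finite)
    (hW : T.PropertyW)
    (x : ℝ) (hx : x ∈ T.X)
    (hinner : (0 : β.H) ∈ interior {y : β.H | (y : Fin β.degree → ℝ) ∈ T.D x})
    (k : ℕ) (hk : 1 ≤ k) (a : ℝ) (ha : a ∈ T.A) :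
    T.b k x = a ↔
      ∃ n : Fin β.degree → ℤ,
        (β.toReal ^ (k - 1) * x) • β.v1 - (fun i => (n i : ℝ)) ∈ T.XHatA a := by
  have hp : β.proj (x • β.v1) = x := by rw [map_smul, β.proj_v1]; simp
  have hnear := T.eventually_mem_XHat hA hV hx hinner
  have h0 : x • β.v1 ∈ T.XHat := hnear.self_of_nhdsWithin (by simp [hp])
  -- A single m describes T̂^{k-1} at all points of X̂ over a right neighbourhood of x.
  obtain ⟨m, hm⟩ := BetaTransformation.exists_eventually_M_pow_sub_mem hA hx (k - 1)
  have hM : (β.M ^ (k - 1)) (x • β.v1) = (β.toReal ^ (k - 1) * x) • β.v1 := by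
    rw [map_smul, β.M_pow_v1, smul_smul, mul_comm]
  have hm0 := hm.self_of_nhdsWithin Set.self_mem_Ici _ h0 hp
  rw [hM] at hm0
  constructor
  · intro hb
    exact ⟨m, (BetaTransformation.mem_XHatA_iff_proj hA).2
      ⟨hm0.1, (congrArg T.digit hm0.2).trans hb⟩⟩
  · rintro ⟨n, hn⟩
    change (β.toReal ^ (k - 1) * x) • β.v1 - β.intVec n ∈ T.XHatA a at hn
    obtain ⟨hz, hza⟩ := (BetaTransformation.mem_XHatA_iff_proj hA).1 hn
    by_contra hne
    have hmn : m ≠ n := by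
      rintro rfl
      rw [hm0.2] at hza
      exact hne hza
    set z := (β.toReal ^ (k - 1) * x) • β.v1 - β.intVec n with hzdef
    have hpos := pow_pos β.pos (k - 1)
    have hinj : Function.Injective (β.M ^ (k - 1)) := by
      rw [Module.End.coe_pow]
      exact β.M_injective.iterate _
    let e := LinearEquiv.ofInjectiveEndo (β.M ^ (k - 1)) hinj
    have he : ∀ y, (β.M ^ (k - 1)) (e.symm y) = y := fun y => e.apply_symm_apply y
    have hproj : ∀ y, β.toReal ^ (k - 1) * β.proj (e.symm y) = β.proj y := fun y => by
      rw [← β.proj_M_pow, he]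
    have hec : Continuous e.symm := LinearMap.continuous_of_finiteDimensional e.symm.toLinearMap
    have hez : e.symm (z + β.intVec n) = x • β.v1 := by
      apply hinj
      rw [he, hM, hzdef, sub_add_cancel]
    -- The inverse of M_β^{k-1} carries q + n, for q near z on its right, to the right of x v_1,
    -- where X̂ fills a half-neighbourhood.
    have hlim : Tendsto (fun q => e.symm (q + β.intVec n)) (𝓝[{q | β.proj z ≤ β.proj q}] z)
        (𝓝[{w | x ≤ β.proj w}] (x • β.v1)) := by
      refine tendsto_nhdsWithin_iff.2 ⟨?_, ?_⟩
      · exact ((hec.comp (continuous_add_const _)).tendsto' z _ hez).mono_left nhdsWithin_le_nhds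
      · filter_upwards [self_mem_nhdsWithin] with q hq
        have h1 := hproj (z + β.intVec n)
        have h2 := hproj (q + β.intVec n)
        rw [hez, hp, map_add] at h1
        have h3 : β.proj z ≤ β.proj q := hq
        refine le_of_mul_le_mul_left ?_ hpos
        rw [h1, h2, map_add]
        linarith
    have hlim' : Tendsto β.proj (𝓝[{w | x ≤ β.proj w}] (x • β.v1)) (𝓝[≥] x) :=
      tendsto_nhdsWithin_iff.2 ⟨(β.proj.continuous.tendsto' _ _ hp).mono_left nhdsWithin_le_nhds,
        self_mem_nhdsWithin⟩
    have hev := hlim.eventually (hnear.and (hlim'.eventually hm))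
    obtain ⟨r, hr, hball⟩ := Metric.mem_nhdsWithin_iff.1 hev
    have hvol := BetaTransformation.volume_XHat_inter_ball_pos hA hsupp hz hr
    -- Applying T̂^{k-1} to the point pulled back from q gives q + n − m ∈ X̂, so every q ∈ X̂ in
    -- the half-ball is covered twice.
    refine hvol.ne' (measure_mono_null ?_ (BetaTransformation.volume_overlap hA hW))
    rintro q ⟨hq1, hq2, hq3⟩
    obtain ⟨h1, h2⟩ := hball ⟨mem_ball_iff_norm.2 hq3, hq2⟩
    have h3 := (h2 _ h1 rfl).1
    rw [he] at h3
    have hzero : β.intVec 0 = 0 := by ext; simp [PisotUnit.intVec]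
    refine ⟨0, n - m, fun h => hmn (sub_eq_zero.1 h.symm).symm, by rwa [hzero, add_zero], ?_⟩
    rwa [β.intVec_sub, ← add_sub_assoc]
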